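/- **Setting.** Let $n\ge 1$ and let $(X,m)$ be a standard Borel space with a non-atomic probability measure. Realize $U(n,1)$ as the group of linear transformations of $\mathbb C^{n+1}$ preserving the form $x_1\bar x_{n+1}+x_{n+1}\bar x_1+|x_2|^2+\dots+|x_n|^2$, and write $g=(g_{ij})_{i,j=1,2,3}$ in blocks with diagonal blocks of orders $1,n-1,1$. Let $P\subset U(n,1)$ be the subgroup of lower triangular block matrices, $P=\mathbb R^*_+\rightthreetimes P_0$ with $P_0=\{g\in P: |g_{11}|=1\}$ and $r\in\mathbb R_+^*$ identified with $d_r=\mathrm{diag}(r^{-1},1,r)$; put $g^r=d_r g d_r^{-1}$ for $g\in P_0$. Let $U(n,1)^X$ be the group of bounded measurable mappings $X\to U(n,1)$ with pointwise multiplication, and let $P^X$, $P_0^X$ be its subgroups of mappings to $P$, $P_0$. *Canonical representations.* $H^+$ (respectively $H^-$) is the space of entire analytic (respectively anti-analytic) functions on $\mathbb C^{n-1}$ with $\|f\|^2=\pi^{-(n-1)}\int|f(z)|^2e^{-zz^*}\,dz<\infty$ ($z$ a row vector). The representation $T^+$ of $P_0$ in $H^+$ is $(T^+(g)f)(z)=\exp\bigl(g_{11}^{-1}(g_{31}+zg_{21})\bigr)\,f\bigl(g_{11}^{-1}(zg_{22}+g_{32})\bigr)$,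 and $T^-(g)\bar f=\overline{T^+(g)f}$. $T^0$ is the restriction of $T^+\oplus T^-$ to the real space $H^0\subset H^+\oplus H^-$ of vectors $(f,\bar f)$. The distinguished unit vectors are $h=1$ in $H^\pm$ and $h=(2^{-1/2},2^{-1/2})$ in $H^0$. Put $T_r(g)=T(g^r)$. *Integral models.* Let $\mathcal L$ be the $\sigma$-finite measure on the cone $l^1_+(X)$ of measures $\xi=\sum_k r_k\delta_{x_k}=\{r_k,x_k\}$ ($r_k>0$, $\sum r_k<\infty$) with Laplace transform $\int \exp(-\sum_k r_kf(x_k))\,d\mathcal L(\xi)=\exp(-\int_X\log f\,dm)$; it is the law of the gamma process on $(X,m)$ multiplied by the density $e^{\sum r_k}$. For $(H,T)=(H^\pm,T^\pm)$ or $(H^0,T^0)$ let $H_\xi=\bigotimes_k H_{r_k}$, $H_{r}=H$, be the countable tensor product with stabilizing vector $h$ (over $\mathbb C$ for $H^\pm$, over $\mathbb R$ for $H^0$), and $\mathrm{INT}\,H=\int^\oplus H_\xi\,d\mathcal L(\xi)$. The integral model $\mathrm{INT}\,T$ is the representation of $P^X$ in $\mathrm{INT}\,H$ for which $g\in P_0^X$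 acts by $F(\xi)\mapsto\bigl(\bigotimes_kT_{r_k}(g(x_k))\bigr)F(\xi)$ and $r\in(\mathbb R_+^*)^X$ acts by $F(\xi)\mapsto e^{\frac12\int_X\log r\,dm}F(r\xi)$, $r\xi=\{r(x_k)r_k,x_k\}$. *The total families.* Let $L=\{v=(a,b)\in\mathbb C\oplus\mathbb C^{n-1}: a+\bar a+b^*b<0\}$, on which $U(n,1)$ acts by $g(a,b)=(a',b')$ with $a'=j^{-1}(g_{31}+g_{32}b+g_{33}a)$, $b'=j^{-1}(g_{21}+g_{22}b+g_{23}a)$, $j=g_{11}+g_{12}b+g_{13}a$. Let $L^X$ be the set of measurable $v:X\to L$ whose image lies in a compact subset of $L$. For $v=(a,b)\in L^X$ put $f_{v,r,x}(z)=\exp(r^2a(x)+r\sum_iz_ib_i(x))$ and $$F_v^+(\xi)=\bigotimes_kf_{v,r_k,x_k},\qquad F_v^-(\xi)=\overline{F_v^+(\xi)}=\bigotimes_k\overline{f_{v,r_k,x_k}},\qquad F_v^0(\xi)=\bigotimes_k\bigl(2^{-1/2}f_{v,r_k,x_k},\,2^{-1/2}\overline{f_{v,r_k,x_k}}\bigr).$$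 Let $c(v_1,v_2)=\log(-a_1-\bar a_2-b_2^*b_1)$ (principal branch) for $v_i=(a_i,b_i)\in L$, let $v_0=(-1,0)$, and $$u^+(g,v)=\overline{u^-(g,v)}=c(gv,gv_0)-c(v,v_0)-\tfrac12\bigl(c(gv_0,gv_0)-c(v_0,v_0)\bigr).$$ **Theorem.** The group $U(n,1)^X$ acts on $L^X$ pointwise; the vectors $F_v^\pm$ and $F_v^0$, $v\in L^X$, lie in $\mathrm{INT}\,H^\pm$ and $\mathrm{INT}\,H^0$, respectively, and form total subsets there. The operators $$U^\pm(g)F_v^\pm=e^{\frac12\int_Xu^\pm(g(x),v(x))\,dm(x)}F_{gv}^\pm,\qquad U^0(g)F_v^0=e^{\frac12\mathrm{Re}\int_Xu^+(g(x),v(x))\,dm(x)}F_{gv}^0,\qquad g\in U(n,1)^X,$$ extend to unitary operators on $\mathrm{INT}\,H^\pm$ and to orthogonal operators on $\mathrm{INT}\,H^0$, respectively. The operators $U^\pm(g)$ form projective unitary representations of $U(n,1)^X$ (that is, $U^\pm(g_1g_2)=\lambda(g_1,g_2)\,U^\pm(g_1)U^\pm(g_2)$ with $|\lambda(g_1,g_2)|=1$),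 the operators $U^0(g)$ form an orthogonal representation of $U(n,1)^X$, and the restrictions of $U^\pm$ and $U^0$ to $P^X$ coincide with $\mathrm{INT}\,T^\pm$ and $\mathrm{INT}\,T^0$. -/

import Mathlib

noncomputable section

open MeasureTheory Filter Topology Complex ComplexConjugate Matrix
open scoped InnerProductSpace ENNReal

namespace CurrentGroups

/-! ### Countable tensor products with a stabilizing unit vector -/

section Tensor

variable {E : Type*} [NormedAddCommGroup E]

/-- Unit vectors of `E`. -/
abbrev UnitVec (E : Type*) [NormedAddCommGroup E] := {h : E // ‖h‖ = 1}

/-- Sequences `(f_k)` of vectors that approach the stabilizing vector `h` in the sense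
`∑ ‖f_k - h‖ < ∞`; every sequence which is eventually equal to `h` is of this kind. -/
abbrev Adm (h : UnitVec E) := {f : ℕ → E // Summable fun k => ‖f k - h‖}

variable (𝕜 : Type*) [RCLike 𝕜] [InnerProductSpace 𝕜 E]

/-- The inner product `∏ ⟪f_k, g_k⟫` of the decomposable vectors `⊗ f_k` and `⊗ g_k`. -/
def tensorKernel {h : UnitVec E} (f g : Adm h) : 𝕜 := ∏' k, ⟪f.1 k, g.1 k⟫_𝕜

theorem tensorKernel_tendsto {h : UnitVec E} (f g : Adm h) :
    Tendsto (fun N => ∏ k ∈ Finset.range N, ⟪f.1 k, g.1 k⟫_𝕜) atTop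
      (𝓝 (tensorKernel 𝕜 f g)) := by
  have h1 : ⟪(h : E), h⟫_𝕜 = 1 := by
    rw [inner_self_eq_norm_sq_to_K, h.2]; simp
  have key : ∀ k, ‖⟪f.1 k, g.1 k⟫_𝕜 - 1‖ ≤
      ‖f.1 k - h‖ * ‖g.1 k - h‖ + ‖f.1 k - h‖ + ‖g.1 k - h‖ := by
    intro k
    have e : ⟪f.1 k, g.1 k⟫_𝕜 - 1 = ⟪f.1 k - h, g.1 k - h⟫_𝕜 + ⟪f.1 k - h, (h : E)⟫_𝕜
        + ⟪(h : E), g.1 k - h⟫_𝕜 := by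
      simp only [inner_sub_left, inner_sub_right, h1]; ring
    rw [e]
    refine (norm_add_le _ _).trans (add_le_add ((norm_add_le _ _).trans (add_le_add ?_ ?_)) ?_)
    · exact norm_inner_le_norm _ _
    · simpa [h.2] using norm_inner_le_norm (𝕜 := 𝕜) (f.1 k - h) (h : E)
    · simpa [h.2] using norm_inner_le_norm (𝕜 := 𝕜) (h : E) (g.1 k - h)
  have hs : Summable fun k => ‖⟪f.1 k, g.1 k⟫_𝕜 - 1‖ := by
    refine Summable.of_nonneg_of_le (fun _ => norm_nonneg _) key ?_
    refine ((Summable.of_nonneg_of_le (fun k => by positivity) (fun k => ?_)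
      (f.2.mul_right (∑' k, ‖g.1 k - h‖))).add f.2).add g.2
    gcongr
    exact g.2.le_tsum k (fun _ _ => norm_nonneg _)
  have hm := multipliable_one_add_of_summable hs
  simp only [add_sub_cancel] at hm
  exact hm.hasProd.tendsto_prod_nat

theorem tensorKernel_conj {h : UnitVec E} (f g : Adm h) :
    conj (tensorKernel 𝕜 g f) = tensorKernel 𝕜 f g := by
  refine tendsto_nhds_unique ?_ (tensorKernel_tendsto 𝕜 f g)
  have := (RCLike.continuous_conj (K := 𝕜)).continuousAt.tendsto.comp (tensorKernel_tendsto 𝕜 g f)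
  refine this.congr fun N => ?_
  simp [map_prod]

open scoped ComplexOrder in
theorem posSemidef_partial {h : UnitVec E} (N : ℕ) :
    (Matrix.of fun f g : Adm h => ∏ k ∈ Finset.range N, ⟪f.1 k, g.1 k⟫_𝕜).PosSemidef := by
  have gramPos : ∀ v : Adm h → E, (Matrix.of fun f g : Adm h => ⟪v f, v g⟫_𝕜).PosSemidef := by
    intro v
    refine ⟨Matrix.isHermitian_gram 𝕜 v, fun x => ?_⟩
    have e : (x.sum fun i xi => x.sum fun j xj =>
        star xi * (Matrix.of fun f g : Adm h => ⟪v f, v g⟫_𝕜) i j * xj) =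
        ⟪x.sum fun i c => c • v i, x.sum fun i c => c • v i⟫_𝕜 := by
      rw [Finsupp.sum_inner]
      refine Finsupp.sum_congr fun i _ => ?_
      rw [Finsupp.inner_sum]
      refine Finsupp.sum_congr fun j _ => ?_
      rw [inner_smul_left, inner_smul_right]
      simp only [Matrix.of_apply, RCLike.star_def]
      ring
    rw [e, RCLike.nonneg_iff]
    exact ⟨inner_self_nonneg, inner_self_im _⟩
  induction N with
  | zero =>
    convert! gramPos (fun _ => (h : E)) using 1
    ext f g
    simp [inner_self_eq_norm_sq_to_K, h.2]
  | succ N ih =>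
    have := ih.hadamard (gramPos fun f => f.1 N)
    convert! this using 1
    ext f g
    simp [Finset.prod_range_succ, Matrix.hadamard]

/-- Finite formal linear combinations of decomposable vectors `⊗ f_k`. -/
def PreTensor (_h : UnitVec E) := Adm _h →₀ 𝕜

instance (h : UnitVec E) : AddCommGroup (PreTensor 𝕜 h) :=
  inferInstanceAs (AddCommGroup (Adm h →₀ 𝕜))
instance (h : UnitVec E) : Module 𝕜 (PreTensor 𝕜 h) :=
  inferInstanceAs (Module 𝕜 (Adm h →₀ 𝕜))

/-- The sesquilinear extension of `⟪⊗ f_k, ⊗ g_k⟫ = ∏ ⟪f_k, g_k⟫`. -/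
def preInner {h : UnitVec E} (x y : Adm h →₀ 𝕜) : 𝕜 :=
  x.sum fun f a => y.sum fun g b => conj a * tensorKernel 𝕜 f g * b

theorem preInner_tendsto {h : UnitVec E} (x y : Adm h →₀ 𝕜) :
    Tendsto (fun N => x.sum fun f a => y.sum fun g b =>
      conj a * (∏ k ∈ Finset.range N, ⟪f.1 k, g.1 k⟫_𝕜) * b) atTop (𝓝 (preInner 𝕜 x y)) := by
  refine tendsto_finsetSum _ fun f _ => tendsto_finsetSum _ fun g _ => ?_
  exact ((tensorKernel_tendsto 𝕜 f g).const_mul _).mul_const _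

theorem preInner_conj {h : UnitVec E} (x y : Adm h →₀ 𝕜) :
    conj (preInner 𝕜 y x) = preInner 𝕜 x y := by
  unfold preInner
  rw [Finsupp.sum_comm]
  simp only [map_finsuppSum, map_mul, tensorKernel_conj, RCLike.conj_conj]
  refine Finsupp.sum_congr fun f _ => Finsupp.sum_congr fun g _ => ?_
  ring

theorem preInner_nonneg {h : UnitVec E} (x : Adm h →₀ 𝕜) : 0 ≤ RCLike.re (preInner 𝕜 x x) := by
  refine ge_of_tendsto' (RCLike.continuous_re.continuousAt.tendsto.comp
    (preInner_tendsto 𝕜 x x)) fun N => ?_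
  have := (posSemidef_partial 𝕜 (h := h) N).2 x
  exact (RCLike.nonneg_iff.1 this).1

theorem preInner_add_left {h : UnitVec E} (x y z : Adm h →₀ 𝕜) :
    preInner 𝕜 (x + y) z = preInner 𝕜 x z + preInner 𝕜 y z := by
  unfold preInner
  classical
  rw [Finsupp.sum_add_index'] <;> simp [add_mul, Finsupp.sum_add]

theorem preInner_smul_left {h : UnitVec E} (x y : Adm h →₀ 𝕜) (r : 𝕜) :
    preInner 𝕜 (r • x) y = conj r * preInner 𝕜 x y := by
  unfold preInner
  rw [Finsupp.sum_smul_index] <;> simp [Finsupp.mul_sum, mul_assoc]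

instance preCore (h : UnitVec E) : PreInnerProductSpace.Core 𝕜 (PreTensor 𝕜 h) where
  inner x y := preInner 𝕜 (h := h) x y
  conj_inner_symm x y := preInner_conj 𝕜 (h := h) x y
  re_inner_nonneg x := preInner_nonneg 𝕜 (h := h) x
  add_left x y z := preInner_add_left 𝕜 (h := h) x y z
  smul_left x y r := preInner_smul_left 𝕜 (h := h) x y r

instance (h : UnitVec E) : SeminormedAddCommGroup (PreTensor 𝕜 h) :=
  InnerProductSpace.Core.toSeminormedAddCommGroup (𝕜 := 𝕜)

instance (h : UnitVec E) : InnerProductSpace 𝕜 (PreTensor 𝕜 h) := .ofCore _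

/-- The countable tensor product `⊗_k E` with stabilizing vector `h`: the Hilbert space
generated by the decomposable vectors `⊗ f_k` with inner products `∏ ⟪f_k, g_k⟫`. It is the
completion of the inductive limit of the finite tensor products under `x ↦ x ⊗ h`, since the
vectors `⊗ f_k` with `f_k = h` for all large `k` span a dense subspace. -/
def TensorPow (h : UnitVec E) := UniformSpace.Completion (PreTensor 𝕜 h)

instance (h : UnitVec E) : NormedAddCommGroup (TensorPow 𝕜 h) :=
  inferInstanceAs (NormedAddCommGroup (UniformSpace.Completion (PreTensor 𝕜 h)))
instance (h : UnitVec E) : InnerProductSpace 𝕜 (TensorPow 𝕜 h) :=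
  inferInstanceAs (InnerProductSpace 𝕜 (UniformSpace.Completion (PreTensor 𝕜 h)))
instance (h : UnitVec E) : CompleteSpace (TensorPow 𝕜 h) :=
  inferInstanceAs (CompleteSpace (UniformSpace.Completion (PreTensor 𝕜 h)))

/-- The generator `⊗ f_k` of the space of formal combinations. -/
def preTprod {h : UnitVec E} (f : Adm h) : PreTensor 𝕜 h := (Finsupp.single f 1 : Adm h →₀ 𝕜)

/-- The decomposable vector `⊗ f_k`. -/
def admTprod {h : UnitVec E} (f : Adm h) : TensorPow 𝕜 h :=
  ((preTprod 𝕜 f : PreTensor 𝕜 h) : UniformSpace.Completion (PreTensor 𝕜 h))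

open scoped Classical in
/-- The decomposable vector `⊗ f_k` for an arbitrary sequence, with the value zero if the
sequence does not approach `h`. -/
def tprod (h : UnitVec E) (f : ℕ → E) : TensorPow 𝕜 h :=
  if hf : Summable fun k => ‖f k - h‖ then admTprod 𝕜 ⟨f, hf⟩ else 0

theorem inner_admTprod {h : UnitVec E} (f g : Adm h) :
    ⟪admTprod 𝕜 f, admTprod 𝕜 g⟫_𝕜 = ∏' k, ⟪f.1 k, g.1 k⟫_𝕜 := by
  refine (UniformSpace.Completion.inner_coe _ _).trans ?_
  change preInner 𝕜 (Finsupp.single f 1) (Finsupp.single g 1) = _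
  simp [preInner, tensorKernel]

/-- The linear map of formal combinations induced by a map of sequences. -/
def preMap {h : UnitVec E} (φ : Adm h → Adm h) : PreTensor 𝕜 h →ₗ[𝕜] PreTensor 𝕜 h :=
  (Finsupp.lmapDomain 𝕜 𝕜 φ : (Adm h →₀ 𝕜) →ₗ[𝕜] (Adm h →₀ 𝕜))

theorem preInner_mapDomain {h : UnitVec E} (φ : Adm h → Adm h)
    (hφ : ∀ f g, tensorKernel 𝕜 (φ f) (φ g) = tensorKernel 𝕜 f g) (x y : Adm h →₀ 𝕜) :
    preInner 𝕜 (x.mapDomain φ) (y.mapDomain φ) = preInner 𝕜 x y := by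
  unfold preInner
  rw [Finsupp.sum_mapDomain_index]
  · refine Finsupp.sum_congr fun f _ => ?_
    rw [Finsupp.sum_mapDomain_index] <;> simp [hφ, mul_add]
  · simp
  · intro f a b
    simp [add_mul, Finsupp.sum_add]

/-- `preMap` as an isometry. -/
def preIsometry {h : UnitVec E} (φ : Adm h → Adm h)
    (hφ : ∀ f g, tensorKernel 𝕜 (φ f) (φ g) = tensorKernel 𝕜 f g) :
    PreTensor 𝕜 h →ₗᵢ[𝕜] PreTensor 𝕜 h where
  toLinearMap := preMap 𝕜 φ
  norm_map' x := by
    rw [norm_eq_sqrt_re_inner (𝕜 := 𝕜), norm_eq_sqrt_re_inner (𝕜 := 𝕜)]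
    congr 2
    exact preInner_mapDomain 𝕜 φ hφ x x

/-- The operator on the tensor product with `⊗ f ↦ ⊗ φ(f)`, for a map `φ` of sequences which
preserves the inner products of the decomposable vectors. -/
def inducedOp {h : UnitVec E} (φ : Adm h → Adm h)
    (hφ : ∀ f g, tensorKernel 𝕜 (φ f) (φ g) = tensorKernel 𝕜 f g) :
    TensorPow 𝕜 h →L[𝕜] TensorPow 𝕜 h :=
  (preIsometry 𝕜 φ hφ).toContinuousLinearMap.completion

theorem inducedOp_admTprod {h : UnitVec E} (φ : Adm h → Adm h)
    (hφ : ∀ f g, tensorKernel 𝕜 (φ f) (φ g) = tensorKernel 𝕜 f g) (f : Adm h) :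
    inducedOp 𝕜 φ hφ (admTprod 𝕜 f) = admTprod 𝕜 (φ f) := by
  refine (ContinuousLinearMap.completion_apply_coe _ _).trans ?_
  congr 1
  exact Finsupp.mapDomain_single

variable {𝕜} in
/-- The sequence `(A_k f_k)` for isometries `A_k` with `∑ ‖A_k h - h‖ < ∞`. -/
def admMap {h : UnitVec E} (A : ℕ → E →ₗᵢ[𝕜] E) (hA : Summable fun k => ‖A k h - h‖)
    (f : Adm h) : Adm h :=
  ⟨fun k => A k (f.1 k), by
    refine Summable.of_nonneg_of_le (fun _ => norm_nonneg _) (fun k => ?_) (f.2.add hA)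
    calc ‖A k (f.1 k) - h‖ = ‖A k (f.1 k - h) + (A k h - h)‖ := by rw [map_sub]; congr 1; abel
      _ ≤ ‖A k (f.1 k - h)‖ + ‖A k h - h‖ := norm_add_le _ _
      _ = ‖f.1 k - h‖ + ‖A k h - h‖ := by rw [(A k).norm_map]⟩

open scoped Classical in
variable {𝕜} in
/-- The operator `⊗ A_k : ⊗ f_k ↦ ⊗ A_k f_k`, defined when `∑ ‖A_k h - h‖ < ∞`. -/
def tensorOp (h : UnitVec E) (A : ℕ → E →ₗᵢ[𝕜] E) : TensorPow 𝕜 h →L[𝕜] TensorPow 𝕜 h :=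
  if hA : Summable fun k => ‖A k h - h‖ then
    inducedOp 𝕜 (admMap A hA) (fun f g => by simp [tensorKernel, admMap])
  else 0

/-- The operator `⊗ f_k ↦ ⊗ f_{σ⁻¹ k}` that moves the factor number `k` to the place `σ k`. -/
def permOp (h : UnitVec E) (σ : Equiv.Perm ℕ) : TensorPow 𝕜 h →L[𝕜] TensorPow 𝕜 h :=
  inducedOp 𝕜 (fun f => ⟨fun k => f.1 (σ.symm k), (σ.symm.summable_iff).2 f.2⟩)
    (fun f g => σ.symm.tprod_eq fun k => ⟪f.1 k, g.1 k⟫_𝕜)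

end Tensor
/-! ### The group `U(n,1)` and its maximal parabolic subgroup; here `d = n - 1` -/

/-- Indices of the coordinates of `ℂ^{n+1} = ℂ ⊕ ℂ^{n-1} ⊕ ℂ`. -/
abbrev Idx (d : ℕ) := Unit ⊕ Fin d ⊕ Unit

/-- Matrix of the Hermitian form `x₁ x̄_{n+1} + x_{n+1} x̄₁ + |x₂|² + ⋯ + |x_n|²`. -/
def formMatrix (d : ℕ) : Matrix (Idx d) (Idx d) ℂ := Matrix.of fun i j =>
  match i, j with
  | .inl _, .inr (.inr _) => 1
  | .inr (.inr _), .inl _ => 1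
  | .inr (.inl a), .inr (.inl b) => if a = b then 1 else 0
  | _, _ => 0

/-- `U(n,1)`: the linear transformations of `ℂ^{n+1}` that preserve the Hermitian form. -/
def UGroup (d : ℕ) : Subgroup (GL (Idx d) ℂ) where
  carrier := {g | (g : Matrix (Idx d) (Idx d) ℂ)ᴴ * formMatrix d * (g : Matrix _ _ ℂ)
    = formMatrix d}
  mul_mem' := by
    intro g k hg hk
    simp only [Set.mem_ofPred_eq, Units.val_mul, conjTranspose_mul] at *
    calc _ = (k : Matrix (Idx d) (Idx d) ℂ)ᴴ * ((g : Matrix (Idx d) (Idx d) ℂ)ᴴ * formMatrix d *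
          (g : Matrix _ _ ℂ)) * (k : Matrix _ _ ℂ) := by simp only [Matrix.mul_assoc]
      _ = _ := by rw [hg, hk]
  one_mem' := by simp
  inv_mem' := by
    intro g hg
    simp only [Set.mem_ofPred_eq] at *
    have h1 : (g : Matrix (Idx d) (Idx d) ℂ) * ((g⁻¹ : GL (Idx d) ℂ) : Matrix _ _ ℂ) = 1 :=
      g.mul_inv
    have h2 : ((g⁻¹ : GL (Idx d) ℂ) : Matrix (Idx d) (Idx d) ℂ)ᴴ *
        (g : Matrix (Idx d) (Idx d) ℂ)ᴴ = 1 := by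
      rw [← conjTranspose_mul, h1, conjTranspose_one]
    conv_lhs => rw [← hg]
    calc _ = (((g⁻¹ : GL (Idx d) ℂ) : Matrix (Idx d) (Idx d) ℂ)ᴴ *
        (g : Matrix (Idx d) (Idx d) ℂ)ᴴ) * formMatrix d *
          ((g : Matrix (Idx d) (Idx d) ℂ) * ((g⁻¹ : GL (Idx d) ℂ) : Matrix _ _ ℂ)) := by
          simp only [Matrix.mul_assoc]
      _ = _ := by rw [h1, h2]; simp

variable {d : ℕ}

/-- The matrix of an element of `U(n,1)`. -/
def mat (g : UGroup d) : Matrix (Idx d) (Idx d) ℂ := ((g : GL (Idx d) ℂ) : Matrix _ _ ℂ)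

/-! The blocks `g_{ij}`, with diagonal blocks of orders `1`, `n - 1`, `1`. -/

def b11 (g : UGroup d) : ℂ := mat g (.inl ()) (.inl ())
def b12 (g : UGroup d) : Fin d → ℂ := fun j => mat g (.inl ()) (.inr (.inl j))
def b13 (g : UGroup d) : ℂ := mat g (.inl ()) (.inr (.inr ()))
def b21 (g : UGroup d) : Fin d → ℂ := fun i => mat g (.inr (.inl i)) (.inl ())
def b22 (g : UGroup d) : Matrix (Fin d) (Fin d) ℂ :=
  Matrix.of fun i j => mat g (.inr (.inl i)) (.inr (.inl j))
def b23 (g : UGroup d) : Fin d → ℂ := fun i => mat g (.inr (.inl i)) (.inr (.inr ()))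
def b31 (g : UGroup d) : ℂ := mat g (.inr (.inr ())) (.inl ())
def b32 (g : UGroup d) : Fin d → ℂ := fun j => mat g (.inr (.inr ())) (.inr (.inl j))
def b33 (g : UGroup d) : ℂ := mat g (.inr (.inr ())) (.inr (.inr ()))

theorem formMatrix_mul_self (d : ℕ) : formMatrix d * formMatrix d = 1 := by
  ext i j
  rcases i with i | i | i <;> rcases j with j | j | j <;>
    simp [formMatrix, Matrix.mul_apply, Fintype.sum_sum_type, Matrix.one_apply]

theorem mat_mul (g k : UGroup d) : mat (g * k) = mat g * mat k := rfl

theorem mat_inv (g : UGroup d) : mat g⁻¹ = formMatrix d * (mat g)ᴴ * formMatrix d := by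
  have hg : (mat g)ᴴ * formMatrix d * mat g = formMatrix d := g.2
  have h1 : mat g * mat g⁻¹ = 1 := by rw [← mat_mul, mul_inv_cancel]; rfl
  calc mat g⁻¹ = (formMatrix d * formMatrix d) * mat g⁻¹ := by rw [formMatrix_mul_self, one_mul]
    _ = formMatrix d * ((mat g)ᴴ * formMatrix d * mat g) * mat g⁻¹ := by
        rw [hg]
    _ = formMatrix d * (mat g)ᴴ * formMatrix d * (mat g * mat g⁻¹) := by
        simp only [Matrix.mul_assoc]
    _ = _ := by rw [h1, Matrix.mul_one]

/-- The permutation of the indices that exchanges the first and the last coordinate. -/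
def swapIdx : Idx d → Idx d
  | .inl _ => .inr (.inr ())
  | .inr (.inl a) => .inr (.inl a)
  | .inr (.inr _) => .inl ()

theorem mat_inv_apply (g : UGroup d) (i j : Idx d) :
    mat g⁻¹ i j = conj (mat g (swapIdx j) (swapIdx i)) := by
  rw [mat_inv]
  rcases i with i | i | i <;> rcases j with j | j | j <;>
    simp [formMatrix, Matrix.mul_apply, Fintype.sum_sum_type, swapIdx]

theorem mat_form_row (g : UGroup d) : mat g * formMatrix d * (mat g)ᴴ = formMatrix d := by
  have h1 : mat g * mat g⁻¹ = 1 := by rw [← mat_mul, mul_inv_cancel]; rfl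
  rw [mat_inv] at h1
  calc _ = (mat g * (formMatrix d * (mat g)ᴴ * formMatrix d)) * formMatrix d := by
        simp only [Matrix.mul_assoc, formMatrix_mul_self, Matrix.mul_one]
    _ = _ := by rw [h1, one_mul]

/-- The maximal parabolic subgroup `P` of lower triangular block matrices. -/
def Parabolic (d : ℕ) : Subgroup (UGroup d) where
  carrier := {g | b12 g = 0 ∧ b13 g = 0 ∧ b23 g = 0}
  mul_mem' := by
    rintro g k ⟨h1, h2, h3⟩ ⟨h4, h5, h6⟩
    simp only [funext_iff, b12, b13, b23, Pi.zero_apply, Set.mem_ofPred_eq] at *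
    refine ⟨fun j => ?_, ?_, fun i => ?_⟩ <;>
      simp [mat_mul, Matrix.mul_apply, Fintype.sum_sum_type, *]
  one_mem' := by
    refine ⟨funext fun j => ?_, ?_, funext fun i => ?_⟩ <;> simp [b12, b13, b23, mat]
  inv_mem' := by
    rintro g ⟨h1, h2, h3⟩
    simp only [funext_iff, b12, b13, b23, Pi.zero_apply, Set.mem_ofPred_eq] at *
    refine ⟨fun j => ?_, ?_, fun i => ?_⟩ <;>
      simp [mat_inv, Matrix.mul_apply, Fintype.sum_sum_type, formMatrix, *]

theorem b11_mul {g k : UGroup d} (hg : g ∈ Parabolic d) : b11 (g * k) = b11 g * b11 k := by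
  obtain ⟨h1, h2, h3⟩ := hg
  simp only [funext_iff, b12, b13, b23, Pi.zero_apply] at *
  simp [b11, mat_mul, Matrix.mul_apply, Fintype.sum_sum_type, *]

theorem b11_one : b11 (1 : UGroup d) = 1 := by simp [b11, mat]

theorem b11_ne_zero {g : UGroup d} (hg : g ∈ Parabolic d) : b11 g ≠ 0 := by
  intro h0
  have := b11_mul (k := g⁻¹) hg
  rw [mul_inv_cancel, b11_one, h0, zero_mul] at this
  exact one_ne_zero this

/-- The subgroup `P₀ = (U(1) × U(n-1)) ⋉ N` of `P`, where `N` is the Heisenberg group. -/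
def Parabolic0 (d : ℕ) : Subgroup (UGroup d) where
  carrier := {g | g ∈ Parabolic d ∧ ‖b11 g‖ = 1}
  mul_mem' := by
    rintro g k ⟨h1, h2⟩ ⟨h3, h4⟩
    exact ⟨mul_mem h1 h3, by rw [b11_mul h1, norm_mul, h2, h4, one_mul]⟩
  one_mem' := ⟨one_mem _, by rw [b11_one, norm_one]⟩
  inv_mem' := by
    rintro g ⟨h1, h2⟩
    refine ⟨inv_mem h1, ?_⟩
    have := b11_mul (k := g⁻¹) h1
    rw [mul_inv_cancel, b11_one] at this
    simpa [h2] using (congrArg norm this).symm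

/-- The multiplicative group `ℝ*₊`. -/
abbrev RPos := {r : ℝ // 0 < r}

/-- The matrix `diag(r⁻¹, 1, r)` with its inverse. -/
def dilGL (d : ℕ) (r : RPos) : GL (Idx d) ℂ where
  val := Matrix.diagonal (Sum.elim (fun _ => (r : ℂ)⁻¹) (Sum.elim (fun _ => 1) fun _ => (r : ℂ)))
  inv := Matrix.diagonal (Sum.elim (fun _ => (r : ℂ)) (Sum.elim (fun _ => 1) fun _ => (r : ℂ)⁻¹))
  val_inv := by
    have : ((r : ℝ) : ℂ) ≠ 0 := ofReal_ne_zero.2 r.2.ne'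
    rw [Matrix.diagonal_mul_diagonal, ← Matrix.diagonal_one]
    congr 1; ext i; rcases i with i | i | i <;> simp [this]
  inv_val := by
    have : ((r : ℝ) : ℂ) ≠ 0 := ofReal_ne_zero.2 r.2.ne'
    rw [Matrix.diagonal_mul_diagonal, ← Matrix.diagonal_one]
    congr 1; ext i; rcases i with i | i | i <;> simp [this]

/-- The element `diag(r⁻¹, 1, r)` of `P`; these elements form the factor `ℝ*₊` of
`P = ℝ*₊ ⋌ P₀`. -/
def dil (r : RPos) : UGroup d := ⟨dilGL d r, by
  have : ((r : ℝ) : ℂ) ≠ 0 := ofReal_ne_zero.2 r.2.ne'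
  change (Matrix.diagonal _)ᴴ * formMatrix d * Matrix.diagonal _ = formMatrix d
  rw [Matrix.diagonal_conjTranspose]
  ext i j
  rw [Matrix.mul_diagonal, Matrix.diagonal_mul]
  rcases i with i | i | i <;> rcases j with j | j | j <;> simp [formMatrix, this]⟩

theorem mat_dil (r : RPos) : mat (dil r : UGroup d) =
    Matrix.diagonal (Sum.elim (fun _ => (r : ℂ)⁻¹) (Sum.elim (fun _ => 1) fun _ => (r : ℂ))) := rfl

theorem dil_mem (r : RPos) : (dil r : UGroup d) ∈ Parabolic d := by
  refine ⟨funext fun j => ?_, ?_, funext fun i => ?_⟩ <;> simp [b12, b13, b23, mat_dil]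

theorem b11_dil (r : RPos) : b11 (dil r : UGroup d) = (r : ℂ)⁻¹ := by simp [b11, mat_dil]

/-- The automorphism `g ↦ g^r` of `P₀`. -/
def autP0 (r : RPos) (g : Parabolic0 d) : Parabolic0 d :=
  ⟨(dil r : UGroup d) * (g : UGroup d) * (dil r : UGroup d)⁻¹, by
    have h1 : ((dil r : UGroup d) * (g : UGroup d)) ∈ Parabolic d := mul_mem (dil_mem r) g.2.1
    refine ⟨mul_mem h1 (inv_mem (dil_mem r)), ?_⟩
    have h2 := b11_mul (k := (dil r : UGroup d)⁻¹) (dil_mem (d := d) r)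
    rw [mul_inv_cancel, b11_one] at h2
    have h3 : ‖b11 ((dil r : UGroup d) * (g : UGroup d) * (dil r : UGroup d)⁻¹)‖ =
        ‖b11 (dil r : UGroup d) * b11 (dil r : UGroup d)⁻¹‖ * ‖b11 (g : UGroup d)‖ := by
      rw [b11_mul h1, b11_mul (dil_mem r)]; simp only [norm_mul]; ring
    rw [h3, ← h2, g.2.2]; simp⟩

/-- The component in `ℝ*₊` of an element of `P = ℝ*₊ ⋌ P₀`. -/
def radial (p : Parabolic d) : RPos := ⟨‖b11 (p : UGroup d)‖⁻¹, by
  have := b11_ne_zero p.2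
  positivity⟩

/-- The component in `P₀` of an element of `P = ℝ*₊ ⋌ P₀`, so that `p = radial p · unip p`. -/
def unip (p : Parabolic d) : Parabolic0 d := ⟨(dil (radial p) : UGroup d)⁻¹ * (p : UGroup d), by
  refine ⟨mul_mem (inv_mem (dil_mem _)) p.2, ?_⟩
  have h2 := b11_mul (k := (dil (radial p))⁻¹ * (p : UGroup d)) (dil_mem (d := d) (radial p))
  rw [mul_inv_cancel_left, b11_dil] at h2
  have h3 := congrArg norm h2
  have h4 : ‖b11 (p : UGroup d)‖ ≠ 0 := norm_ne_zero_iff.2 (b11_ne_zero p.2)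
  rw [norm_mul] at h3
  simp only [radial, ofReal_inv, inv_inv, norm_real, norm_norm] at h3
  have h5 := mul_left_cancel₀ h4 ((mul_one _).trans h3)
  exact h5.symm⟩

/-! ### Current groups -/

/-- The group of bounded measurable mappings of `X` to `U(n,1)`. -/
def CurrentGroup (d : ℕ) (X : Type*) [MeasurableSpace X] : Subgroup (X → UGroup d) where
  carrier := {g | (∀ i j, Measurable fun x => mat (g x) i j) ∧ ∃ C : ℝ, ∀ x i j, ‖mat (g x) i j‖ ≤ C}
  mul_mem' := by
    rintro g k ⟨h1, C, hC⟩ ⟨h2, D, hD⟩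
    refine ⟨fun i j => ?_, ∑ l : Idx d, |C| * |D|, fun x i j => ?_⟩
    · simp only [Pi.mul_apply, mat_mul, Matrix.mul_apply]
      exact Finset.measurable_sum _ fun l _ => (h1 i l).mul (h2 l j)
    · simp only [Pi.mul_apply, mat_mul, Matrix.mul_apply]
      refine (norm_sum_le _ _).trans (Finset.sum_le_sum fun l _ => ?_)
      rw [norm_mul]
      exact mul_le_mul ((hC _ _ _).trans (le_abs_self _)) ((hD _ _ _).trans (le_abs_self _))
        (norm_nonneg _) (abs_nonneg _)
  one_mem' := by
    refine ⟨fun i j => measurable_const, 1, fun x i j => ?_⟩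
    by_cases h : i = j <;> simp [mat, h]
  inv_mem' := by
    rintro g ⟨h1, C, hC⟩
    refine ⟨fun i j => ?_, C, fun x i j => ?_⟩
    · simp only [Pi.inv_apply, mat_inv_apply]
      exact Complex.continuous_conj.measurable.comp (h1 _ _)
    · simp only [Pi.inv_apply, mat_inv_apply, RCLike.norm_conj]
      exact hC _ _ _

/-! ### The canonical representations of `P₀` on spaces of entire functions -/

/-- The choice between the analytic (`plus`) and the anti-analytic (`minus`) case. -/
inductive Sgn
  | plus
  | minus

/-- The identity in the analytic case, complex conjugation in the anti-analytic case. -/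
def cj : Sgn → ℂ → ℂ
  | .plus, z => z
  | .minus, z => conj z

theorem cj_add (ε : Sgn) (z w : ℂ) : cj ε (z + w) = cj ε z + cj ε w := by cases ε <;> simp [cj]
theorem cj_mul (ε : Sgn) (z w : ℂ) : cj ε (z * w) = cj ε z * cj ε w := by cases ε <;> simp [cj]
theorem cj_cj (ε : Sgn) (z : ℂ) : cj ε (cj ε z) = z := by cases ε <;> simp [cj]
theorem norm_cj (ε : Sgn) (z : ℂ) : ‖cj ε z‖ = ‖z‖ := by cases ε <;> simp [cj]
theorem continuous_cj (ε : Sgn) : Continuous (cj ε) := by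
  cases ε
  · exact continuous_id
  · exact Complex.continuous_conj

/-- The density `π^{-(n-1)} exp(-z z*)` with respect to Lebesgue measure. -/
def gaussDensity (d : ℕ) (z : Fin d → ℂ) : ℝ := Real.pi⁻¹ ^ d * Real.exp (-∑ i, ‖z i‖ ^ 2)

/-- The normalized measure `exp(-z z*) dμ(z)` on `ℂ^{n-1}`. -/
def gauss (d : ℕ) : Measure (Fin d → ℂ) :=
  volume.withDensity fun z => ENNReal.ofReal (gaussDensity d z)

theorem gaussDensity_eq_prod (d : ℕ) (z : Fin d → ℂ) :
    gaussDensity d z = ∏ i, (Real.pi⁻¹ * Real.exp (-‖z i‖ ^ (2 : ℝ))) := by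
  simp [gaussDensity, Finset.prod_mul_distrib, ← Real.exp_sum]

theorem continuous_gaussDensity (d : ℕ) : Continuous (gaussDensity d) := by
  unfold gaussDensity
  fun_prop

theorem gaussDensity_pos (d : ℕ) (z : Fin d → ℂ) : 0 < gaussDensity d z := by
  unfold gaussDensity
  have := Real.pi_pos
  positivity

theorem integral_gauss_one : ∫ z : ℂ, Real.pi⁻¹ * Real.exp (-‖z‖ ^ (2 : ℝ)) = 1 := by
  rw [integral_const_mul, Complex.integral_exp_neg_rpow (by norm_num)]
  norm_num

instance (d : ℕ) : IsProbabilityMeasure (gauss d) := by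
  have hone : Integrable fun z : ℂ => Real.pi⁻¹ * Real.exp (-‖z‖ ^ (2 : ℝ)) := by
    by_contra h
    have := integral_gauss_one
    rw [integral_undef h] at this
    exact zero_ne_one this
  have hint : Integrable (gaussDensity d) := by
    have := Integrable.fintype_prod (f := fun (_ : Fin d) (z : ℂ) =>
      Real.pi⁻¹ * Real.exp (-‖z‖ ^ (2 : ℝ))) (μ := fun _ => volume) fun _ => hone
    refine this.congr (Eventually.of_forall fun z => (gaussDensity_eq_prod d z).symm)
  constructor
  rw [gauss, withDensity_apply _ MeasurableSet.univ, Measure.restrict_univ,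
    ← ofReal_integral_eq_lintegral_ofReal hint
      (Eventually.of_forall fun z => (gaussDensity_pos d z).le)]
  have h2 : ∫ z, gaussDensity d z = 1 := by
    simp_rw [gaussDensity_eq_prod]
    rw [integral_fintype_prod_volume_eq_prod (fun _ z => Real.pi⁻¹ * Real.exp (-‖z‖ ^ (2 : ℝ)))]
    simp only [integral_gauss_one, Finset.prod_const_one]
  rw [h2, ENNReal.ofReal_one]

/-- The space `H^±` of entire analytic (anti-analytic) functions `f` on `ℂ^{n-1}` with
`∫ |f(z)|² exp(-z z*) dμ(z) < ∞`. -/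
def Fock (ε : Sgn) (d : ℕ) : Submodule ℂ ((Fin d → ℂ) → ℂ) where
  carrier := {f | (Differentiable ℂ fun z => cj ε (f z)) ∧ MemLp f 2 (gauss d)}
  add_mem' := by
    rintro f g ⟨h1, h2⟩ ⟨h3, h4⟩
    refine ⟨?_, h2.add h4⟩
    simp only [Pi.add_apply, cj_add]
    exact h1.add h3
  zero_mem' := by
    refine ⟨?_, MemLp.zero⟩
    have : (fun z : Fin d → ℂ => cj ε ((0 : (Fin d → ℂ) → ℂ) z)) = fun _ => 0 := by
      cases ε <;> simp [cj]
    rw [this]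
    exact differentiable_const _
  smul_mem' := by
    rintro c f ⟨h1, h2⟩
    refine ⟨?_, h2.const_smul c⟩
    simp only [Pi.smul_apply, smul_eq_mul, cj_mul]
    exact h1.const_mul _

variable {ε : Sgn}

theorem Fock.continuous_coe (f : Fock ε d) : Continuous (f : (Fin d → ℂ) → ℂ) := by
  have := (continuous_cj ε).comp f.2.1.continuous
  simpa [Function.comp_def, cj_cj] using this

theorem Fock.integrable_inner (f g : Fock ε d) :
    Integrable (fun z => conj ((f : (Fin d → ℂ) → ℂ) z) * (g : (Fin d → ℂ) → ℂ) z) (gauss d) :=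
  MemLp.integrable_mul f.2.2.star g.2.2

theorem Fock.eq_zero_of_integral (f : Fock ε d)
    (h : ∫ z, ‖(f : (Fin d → ℂ) → ℂ) z‖ ^ 2 ∂gauss d = 0) : f = 0 := by
  rw [integral_eq_zero_iff_of_nonneg (fun z => by positivity)
    (f.2.2.integrable_norm_pow two_ne_zero)] at h
  have hac : (volume : Measure (Fin d → ℂ)) ≪ gauss d :=
    withDensity_absolutelyContinuous'
      (ENNReal.measurable_ofReal.comp (continuous_gaussDensity d).measurable).aemeasurable
      (Eventually.of_forall fun z => by simpa using gaussDensity_pos d z)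
  have h2 : (f : (Fin d → ℂ) → ℂ) =ᵐ[volume] fun _ => 0 := by
    filter_upwards [hac.ae_le h] with z hz
    simpa using hz
  exact Subtype.ext ((Continuous.ae_eq_iff_eq volume (Fock.continuous_coe f) continuous_const).1 h2)

theorem Fock.re_inner_self (f : Fock ε d) :
    (∫ z, conj ((f : (Fin d → ℂ) → ℂ) z) * (f : (Fin d → ℂ) → ℂ) z ∂gauss d : ℂ) =
      ((∫ z, ‖(f : (Fin d → ℂ) → ℂ) z‖ ^ 2 ∂gauss d : ℝ) : ℂ) := by
  refine Eq.trans ?_ integral_ofReal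
  refine integral_congr_ae (Eventually.of_forall fun z => ?_)
  simp [Complex.conj_mul']

instance fockCore (ε : Sgn) (d : ℕ) : InnerProductSpace.Core ℂ (Fock ε d) where
  inner f g := ∫ z, conj ((f : (Fin d → ℂ) → ℂ) z) * (g : (Fin d → ℂ) → ℂ) z ∂gauss d
  conj_inner_symm f g := by
    rw [← integral_conj]
    refine integral_congr_ae (Eventually.of_forall fun z => ?_)
    simp [mul_comm]
  re_inner_nonneg f := by
    rw [Fock.re_inner_self]
    exact integral_nonneg fun z => by positivity
  add_left f g k := by
    rw [← integral_add (Fock.integrable_inner f k) (Fock.integrable_inner g k)]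
    refine integral_congr_ae (Eventually.of_forall fun z => ?_)
    simp [add_mul]
  smul_left f g r := by
    rw [← integral_const_mul]
    refine integral_congr_ae (Eventually.of_forall fun z => ?_)
    simp [mul_assoc]
  definite f hf := by
    rw [Fock.re_inner_self] at hf
    exact Fock.eq_zero_of_integral f (by exact_mod_cast hf)

instance (ε : Sgn) (d : ℕ) : NormedAddCommGroup (Fock ε d) :=
  InnerProductSpace.Core.toNormedAddCommGroup (𝕜 := ℂ)

instance (ε : Sgn) (d : ℕ) : InnerProductSpace ℂ (Fock ε d) := .ofCore _

theorem Fock.norm_sq (f : Fock ε d) :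
    ‖f‖ ^ 2 = ∫ z, ‖(f : (Fin d → ℂ) → ℂ) z‖ ^ 2 ∂gauss d := by
  rw [← inner_self_eq_norm_sq (𝕜 := ℂ)]
  change RCLike.re (∫ z, conj ((f : (Fin d → ℂ) → ℂ) z) * (f : (Fin d → ℂ) → ℂ) z ∂gauss d) = _
  rw [Fock.re_inner_self]
  rfl

/-! The relations between the blocks of an element of `P`. -/

theorem b33_conj_mul {g : UGroup d} (hg : g ∈ Parabolic d) : b11 g * conj (b33 g) = 1 := by
  obtain ⟨h1, h2, h3⟩ := hg
  have := congrFun (congrFun (mat_form_row g) (.inl ())) (.inr (.inr ()))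
  simp only [funext_iff, b12, b13, b23, Pi.zero_apply] at *
  simpa [Matrix.mul_apply, Fintype.sum_sum_type, formMatrix, b11, b33, *] using this

theorem b22_mul {g : UGroup d} (hg : g ∈ Parabolic d) : b22 g * (b22 g)ᴴ = 1 := by
  obtain ⟨h1, h2, h3⟩ := hg
  ext i j
  have := congrFun (congrFun (mat_form_row g) (.inr (.inl i))) (.inr (.inl j))
  simp only [funext_iff, b12, b13, b23, Pi.zero_apply] at *
  simpa [Matrix.mul_apply, Fintype.sum_sum_type, formMatrix, b22, Matrix.one_apply, *] using this

theorem b22_b32 {g : UGroup d} (hg : g ∈ Parabolic d) (i : Fin d) :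
    b21 g i * conj (b33 g) + ∑ j, b22 g i j * conj (b32 g j) = 0 := by
  obtain ⟨h1, h2, h3⟩ := hg
  have := congrFun (congrFun (mat_form_row g) (.inr (.inl i))) (.inr (.inr ()))
  simp only [funext_iff, b12, b13, b23, Pi.zero_apply] at *
  simp [Matrix.mul_apply, Fintype.sum_sum_type, formMatrix] at this
  simp only [b22, b21, b32, b33, of_apply]
  linear_combination this - conj (mat g (.inr (.inr ())) (.inl ())) * h3 i

theorem b31_b32 {g : UGroup d} (hg : g ∈ Parabolic d) :
    b31 g * conj (b33 g) + b33 g * conj (b31 g) + ∑ j, b32 g j * conj (b32 g j) = 0 := by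
  obtain ⟨h1, h2, h3⟩ := hg
  have := congrFun (congrFun (mat_form_row g) (.inr (.inr ()))) (.inr (.inr ()))
  simp only [funext_iff, b12, b13, b23, Pi.zero_apply] at *
  simp [Matrix.mul_apply, Fintype.sum_sum_type, formMatrix] at this
  simp only [b31, b32, b33]
  linear_combination this

/-- The affine map `z ↦ g₁₁⁻¹ (z g₂₂ + g₃₂)` of the space of row vectors. -/
def affMap (g : UGroup d) (z : Fin d → ℂ) : Fin d → ℂ := (b11 g)⁻¹ • (z ᵥ* b22 g + b32 g)

/-- The multiplier `exp(g₁₁⁻¹ (g₃₁ + z g₂₁))`. -/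
def multiplier (g : UGroup d) (z : Fin d → ℂ) : ℂ := exp ((b11 g)⁻¹ * (b31 g + z ⬝ᵥ b21 g))

theorem sum_norm_sq (z : Fin d → ℂ) : ((∑ i, ‖z i‖ ^ 2 : ℝ) : ℂ) = z ⬝ᵥ star z := by
  simp [dotProduct, Complex.mul_conj']

theorem b11_inv {g : UGroup d} (hg : g ∈ Parabolic d) : (b11 g)⁻¹ = conj (b33 g) :=
  inv_eq_of_mul_eq_one_right (b33_conj_mul hg)

theorem affMap_norm_sq (g : Parabolic0 d) (z : Fin d → ℂ) :
    ∑ i, ‖affMap (g : UGroup d) z i‖ ^ 2 = ∑ i, ‖z i‖ ^ 2 -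
      2 * ((b11 (g : UGroup d))⁻¹ * (b31 (g : UGroup d) + z ⬝ᵥ b21 (g : UGroup d))).re := by
  obtain ⟨g, hP, hn⟩ := g
  have hw : conj (b33 g) * b33 g = 1 := by
    rw [← b11_inv hP, ← Complex.conj_conj (b33 g), ← b11_inv hP, Complex.mul_conj']
    simp [hn]
  have h22 : (z ᵥ* b22 g) ⬝ᵥ star (z ᵥ* b22 g) = z ⬝ᵥ star z := by
    rw [star_vecMul, ← dotProduct_mulVec, mulVec_mulVec, b22_mul hP, one_mulVec]
  have h23 : (z ᵥ* b22 g) ⬝ᵥ star (b32 g) = -(conj (b33 g) * (z ⬝ᵥ b21 g)) := by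
    rw [← dotProduct_mulVec]
    simp only [dotProduct, Finset.mul_sum, ← Finset.sum_neg_distrib]
    refine Finset.sum_congr rfl fun i _ => ?_
    have := b22_b32 hP i
    simp only [mulVec, dotProduct, Pi.star_apply, RCLike.star_def]
    linear_combination z i * this
  have h32 : b32 g ⬝ᵥ star (z ᵥ* b22 g) = -(b33 g * conj (z ⬝ᵥ b21 g)) := by
    have hc : b32 g ⬝ᵥ star (z ᵥ* b22 g) = conj ((z ᵥ* b22 g) ⬝ᵥ star (b32 g)) := by
      simp [dotProduct, map_sum, mul_comm]
    rw [hc, h23]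
    simp
  have h33 := b31_b32 hP
  have hbb : b32 g ⬝ᵥ star (b32 g) = ∑ j, b32 g j * conj (b32 g j) := rfl
  apply Complex.ofReal_injective
  rw [Complex.ofReal_sub, sum_norm_sq, sum_norm_sq, affMap]
  simp only [star_smul, star_add, smul_dotProduct, dotProduct_smul, add_dotProduct,
    dotProduct_add, h22, h23, h32, hbb, smul_eq_mul, RCLike.star_def, b11_inv hP,
    Complex.conj_conj, Complex.ofReal_mul, Complex.re_eq_add_conj, map_mul, map_add]
  push_cast
  linear_combination (z ⬝ᵥ star z - conj (b33 g) * (z ⬝ᵥ b21 g) - b33 g * conj (z ⬝ᵥ b21 g) +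
    ∑ j, b32 g j * conj (b32 g j)) * hw + h33

theorem multiplier_density (g : Parabolic0 d) (z : Fin d → ℂ) :
    ‖multiplier (g : UGroup d) z‖ ^ 2 * gaussDensity d z =
      gaussDensity d (affMap (g : UGroup d) z) := by
  rw [multiplier, Complex.norm_exp, gaussDensity, gaussDensity, affMap_norm_sq, neg_sub,
    sub_eq_add_neg, Real.exp_add, ← Real.exp_nat_mul]
  push_cast
  ring

theorem measurePreserving_affMap (g : Parabolic0 d) :
    MeasurePreserving (affMap (g : UGroup d)) volume volume := by
  obtain ⟨g, hP, hn⟩ := g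
  set A : Matrix (Fin d) (Fin d) ℂ := (b11 g)⁻¹ • (b22 g)ᵀ with hA
  have hdet : ‖A.det‖ = 1 := by
    have h1 := congrArg (fun M => ‖Matrix.det M‖) (b22_mul hP)
    simp only [det_mul, det_conjTranspose, det_one, norm_mul, norm_star, norm_one] at h1
    have h2 : ‖(b22 g).det‖ = 1 := by
      have h3 := norm_nonneg (b22 g).det
      nlinarith
    simp [hA, hn, h2]
  have hlin : MeasurePreserving (fun z : Fin d → ℂ => A *ᵥ z) volume volume := by
    have hr : LinearMap.det ((Matrix.toLin' A).restrictScalars ℝ) = 1 := by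
      rw [LinearMap.det_restrictScalars, LinearMap.det_toLin', Algebra.norm_complex_eq]
      simp [Complex.normSq_eq_norm_sq, hdet]
    have := Measure.map_linearMap_addHaar_eq_smul_addHaar (volume : Measure (Fin d → ℂ))
      (f := (Matrix.toLin' A).restrictScalars ℝ) (by rw [hr]; exact one_ne_zero)
    rw [hr] at this
    refine ⟨(by fun_prop : Continuous fun z : Fin d → ℂ => A *ᵥ z).measurable, ?_⟩
    exact (by simpa using this : Measure.map (⇑(toLin' A)) volume = volume)
  have := (measurePreserving_add_right (volume : Measure (Fin d → ℂ)) ((b11 g)⁻¹ • b32 g)).comp hlin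
  refine cast (congrArg (fun F => MeasurePreserving F volume volume) ?_) this
  funext z
  simp [affMap, hA, smul_mulVec, mulVec_transpose]

/-- The canonical representation `T^±` of `P₀` in `H^±`. In the analytic case it is
`(T(g) f)(z) = exp(g₁₁⁻¹ (g₃₁ + z g₂₁)) f(g₁₁⁻¹ (z g₂₂ + g₃₂))`; the anti-analytic case is
obtained by complex conjugation. -/
def canonicalFun (ε : Sgn) (g : UGroup d) (f : (Fin d → ℂ) → ℂ) (z : Fin d → ℂ) : ℂ :=
  cj ε (multiplier g z) * f (affMap g z)

theorem differentiable_affMap (g : UGroup d) : Differentiable ℂ (affMap g) := by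
  have : affMap g = fun z => (b11 g)⁻¹ • (Matrix.toLin' (b22 g)ᵀ z + b32 g) := by
    funext z
    simp [affMap, mulVec_transpose]
  rw [this]
  have h2 : Differentiable ℂ fun z => Matrix.toLin' (b22 g)ᵀ z :=
    (LinearMap.toContinuousLinearMap (Matrix.toLin' (b22 g)ᵀ)).differentiable
  exact (h2.add_const _).const_smul ((b11 g)⁻¹)

theorem differentiable_multiplier (g : UGroup d) : Differentiable ℂ (multiplier g) := by
  unfold multiplier dotProduct
  fun_prop

theorem lintegral_canonicalFun (ε : Sgn) (g : Parabolic0 d) (f : Fock ε d) :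
    ∫⁻ z, ‖canonicalFun ε (g : UGroup d) (f : (Fin d → ℂ) → ℂ) z‖ₑ ^ (2 : ℝ) ∂gauss d =
      ∫⁻ z, ‖(f : (Fin d → ℂ) → ℂ) z‖ₑ ^ (2 : ℝ) ∂gauss d := by
  have hm : Measurable fun z => ENNReal.ofReal (gaussDensity d z) :=
    ENNReal.measurable_ofReal.comp (continuous_gaussDensity d).measurable
  have hf : Measurable fun z => ‖(f : (Fin d → ℂ) → ℂ) z‖ₑ ^ (2 : ℝ) :=
    ((Fock.continuous_coe f).measurable.enorm).pow_const _
  have hc : Measurable fun z =>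
      ‖canonicalFun ε (g : UGroup d) (f : (Fin d → ℂ) → ℂ) z‖ₑ ^ (2 : ℝ) := by
    refine (Continuous.measurable ?_).enorm.pow_const _
    exact ((continuous_cj ε).comp (differentiable_multiplier _).continuous).mul
      ((Fock.continuous_coe f).comp (differentiable_affMap _).continuous)
  rw [gauss, lintegral_withDensity_eq_lintegral_mul _ hm hf,
    lintegral_withDensity_eq_lintegral_mul _ hm hc,
    ← (measurePreserving_affMap g).lintegral_comp (hm.mul hf)]
  refine lintegral_congr fun z => ?_
  simp only [Pi.mul_apply, canonicalFun, ← multiplier_density]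
  rw [enorm_mul, ENNReal.mul_rpow_of_nonneg _ _ (by norm_num),
    ENNReal.ofReal_mul (by positivity), ENNReal.ofReal_pow (norm_nonneg _), ofReal_norm]
  have : ‖cj ε (multiplier (g : UGroup d) z)‖ₑ = ‖multiplier (g : UGroup d) z‖ₑ := by
    rw [← ofReal_norm, norm_cj, ofReal_norm]
  rw [this]
  norm_num
  ring

theorem canonicalFun_mem (ε : Sgn) (g : Parabolic0 d) (f : Fock ε d) :
    canonicalFun ε (g : UGroup d) (f : (Fin d → ℂ) → ℂ) ∈ Fock ε d := by
  refine ⟨?_, ?_, ?_⟩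
  · simp only [canonicalFun, cj_mul, cj_cj]
    exact (differentiable_multiplier _).mul (f.2.1.comp (differentiable_affMap _))
  · exact (((continuous_cj ε).comp (differentiable_multiplier _).continuous).mul
      ((Fock.continuous_coe f).comp (differentiable_affMap _).continuous)).aestronglyMeasurable
  · have h := f.2.2.2
    rw [eLpNorm_lt_top_iff_lintegral_rpow_enorm_lt_top two_ne_zero ENNReal.ofNat_ne_top] at h ⊢
    exact (lintegral_canonicalFun ε g f).trans_lt h

/-- The canonical representation `T^±` as a family of isometric operators in `H^±`. -/
def canonicalRep (ε : Sgn) (g : Parabolic0 d) : Fock ε d →ₗᵢ[ℂ] Fock ε d where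
  toFun f := ⟨canonicalFun ε (g : UGroup d) (f : (Fin d → ℂ) → ℂ), canonicalFun_mem ε g f⟩
  map_add' f k := by
    ext z
    simp [canonicalFun, mul_add]
  map_smul' c f := by
    ext z
    simp [canonicalFun, mul_left_comm]
  norm_map' f := by
    have h : ∀ k : Fock ε d, ‖k‖ ^ 2 =
        (∫⁻ z, ‖(k : (Fin d → ℂ) → ℂ) z‖ₑ ^ (2 : ℝ) ∂gauss d).toReal := by
      intro k
      rw [Fock.norm_sq, integral_eq_lintegral_of_nonneg_ae
        (Eventually.of_forall fun z => sq_nonneg ‖(k : (Fin d → ℂ) → ℂ) z‖)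
        (show Continuous fun z => ‖(k : (Fin d → ℂ) → ℂ) z‖ ^ 2 from
          (Fock.continuous_coe k).norm.pow 2).aestronglyMeasurable]
      congr 1
      refine lintegral_congr fun z => ?_
      rw [ENNReal.ofReal_pow (norm_nonneg _), ofReal_norm]
      norm_num
    refine (sq_eq_sq₀ (norm_nonneg _) (norm_nonneg _)).1 ?_
    rw [h, h]
    exact congrArg _ (lintegral_canonicalFun ε g f)

/-- The function `exp(α + (z, β))`, respectively its complex conjugate. -/
def expFun (ε : Sgn) (α : ℂ) (β : Fin d → ℂ) (z : Fin d → ℂ) : ℂ := cj ε (exp (α + z ⬝ᵥ β))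

theorem expFun_mem (ε : Sgn) (α : ℂ) (β : Fin d → ℂ) : expFun ε α β ∈ Fock ε d := by
  have hd : Differentiable ℂ fun z : Fin d → ℂ => exp (α + z ⬝ᵥ β) := by
    unfold dotProduct
    fun_prop
  have hcont : Continuous (expFun ε α β) := (continuous_cj ε).comp hd.continuous
  refine ⟨by simpa [expFun, cj_cj] using hd, ?_⟩
  rw [memLp_two_iff_integrable_sq_norm hcont.aestronglyMeasurable, gauss,
    integrable_withDensity_iff_integrable_smul' (f := fun z => ENNReal.ofReal (gaussDensity d z))
      (ENNReal.measurable_ofReal.comp (continuous_gaussDensity d).measurable)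
      (Eventually.of_forall fun z => ENNReal.ofReal_lt_top)]
  have hone : ∀ b : ℂ, Integrable fun w : ℂ =>
      Real.pi⁻¹ * Real.exp (-‖w‖ ^ (2 : ℝ)) * Real.exp (2 * (w * b).re) := by
    intro b
    have h1 := (GaussianFourier.integrable_cexp_neg_mul_sq_norm_add (V := ℂ) (b := 1)
      (by simp) 2 (conj b)).norm.const_mul Real.pi⁻¹
    refine h1.congr (Eventually.of_forall fun w => ?_)
    simp only [Complex.norm_exp, mul_assoc, ← Real.exp_add]
    congr 2
    simp [Complex.inner, pow_two]
  have hprod := (Integrable.fintype_prod (f := fun (i : Fin d) (w : ℂ) =>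
      Real.pi⁻¹ * Real.exp (-‖w‖ ^ (2 : ℝ)) * Real.exp (2 * (w * β i).re))
      (μ := fun _ => volume) fun i => hone (β i)).const_mul (Real.exp (2 * α.re))
  refine hprod.congr (Eventually.of_forall fun z => ?_)
  have hn : ‖expFun ε α β z‖ ^ 2 = Real.exp (2 * α.re) * ∏ i, Real.exp (2 * (z i * β i).re) := by
    rw [expFun, norm_cj, Complex.norm_exp, ← Real.exp_nat_mul, ← Real.exp_sum, ← Real.exp_add]
    simp [dotProduct, mul_add, ← Finset.mul_sum]
  change _ = (ENNReal.ofReal (gaussDensity d z)).toReal • ‖expFun ε α β z‖ ^ 2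
  rw [hn, smul_eq_mul, ENNReal.toReal_ofReal (gaussDensity_pos d z).le, gaussDensity_eq_prod]
  simp only [Finset.prod_mul_distrib]
  ring

/-- The spaces `H^+` and `H^-` as Hilbert spaces. -/
def H (ε : Sgn) (d : ℕ) : Type := Fock ε d

instance (ε : Sgn) (d : ℕ) : NormedAddCommGroup (H ε d) :=
  inferInstanceAs (NormedAddCommGroup (Fock ε d))
instance (ε : Sgn) (d : ℕ) : InnerProductSpace ℂ (H ε d) :=
  inferInstanceAs (InnerProductSpace ℂ (Fock ε d))
instance (ε : Sgn) (d : ℕ) : InnerProductSpace ℝ (H ε d) := InnerProductSpace.rclikeToReal ℂ (H ε d)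

/-- The function underlying an element of `H^±`. -/
def H.toFun (f : H ε d) : (Fin d → ℂ) → ℂ := Subtype.val (p := fun f => f ∈ Fock ε d) f

/-- The canonical representation `T^±` of `P₀` in `H^±`. -/
def T (ε : Sgn) (g : Parabolic0 d) : H ε d →ₗᵢ[ℂ] H ε d := canonicalRep ε g

/-- `exp(α + (z, β))`, respectively its complex conjugate, as an element of `H^±`. -/
def expVec (ε : Sgn) (α : ℂ) (β : Fin d → ℂ) : H ε d :=
  (⟨expFun ε α β, expFun_mem ε α β⟩ : Fock ε d)

theorem norm_expVec_zero (ε : Sgn) : ‖expVec ε 0 (0 : Fin d → ℂ)‖ = 1 := by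
  refine (sq_eq_sq₀ (norm_nonneg _) zero_le_one).1 ?_
  refine (Fock.norm_sq (⟨expFun ε 0 0, expFun_mem ε 0 0⟩ : Fock ε d)).trans ?_
  simp [expFun, norm_cj]

/-- The almost invariant unit vector `h = 1` of `H^±`. -/
def vac (ε : Sgn) (d : ℕ) : UnitVec (H ε d) := ⟨expVec ε 0 0, norm_expVec_zero ε⟩

/-- The real subspace `H^0 ⊆ H^+ ⊕ H^-` of vectors of the form `(f, f̄)`. -/
def pairs (d : ℕ) : Submodule ℝ (WithLp 2 (H .plus d × H .minus d)) where
  carrier := {p | ∀ z, p.snd.toFun z = conj (p.fst.toFun z)}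
  add_mem' := by
    intro p q hp hq z
    have := congrArg₂ (· + ·) (hp z) (hq z)
    rw [← map_add] at this
    exact this
  zero_mem' := by
    intro z
    exact (map_zero conj).symm
  smul_mem' := by
    intro c p hp z
    have := congrArg (((c : ℝ) : ℂ) * ·) (hp z)
    have h2 : conj ((c : ℂ) * p.fst.toFun z) = (c : ℂ) * conj (p.fst.toFun z) := by
      rw [map_mul, Complex.conj_ofReal]
    exact this.trans h2.symm

theorem cj_minus (z : ℂ) : cj .minus z = conj (cj .plus z) := rfl

theorem T_pair (g : Parabolic0 d) (p : pairs d) :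
    WithLp.toLp 2 (T .plus g p.1.fst, T .minus g p.1.snd) ∈ pairs d := by
  intro z
  change cj .minus (multiplier (g : UGroup d) z) * p.1.snd.toFun _ =
    conj (cj .plus (multiplier (g : UGroup d) z) * p.1.fst.toFun _)
  rw [p.2, map_mul, cj_minus]

/-- The restriction of the operators `T^+ ⊕ T^-` to pairs `(f, f̄)`. -/
def pairRep (g : Parabolic0 d) : pairs d →ₗᵢ[ℝ] pairs d where
  toFun p := ⟨WithLp.toLp 2 (T .plus g p.1.fst, T .minus g p.1.snd), T_pair g p⟩
  map_add' p q := by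
    apply Subtype.ext
    apply (WithLp.ofLp_injective 2)
    exact Prod.ext (map_add (T .plus g) _ _) (map_add (T .minus g) _ _)
  map_smul' c p := by
    apply Subtype.ext
    apply (WithLp.ofLp_injective 2)
    exact Prod.ext (map_smul (T .plus g) ((c : ℝ) : ℂ) _) (map_smul (T .minus g) ((c : ℝ) : ℂ) _)
  norm_map' p := by
    change ‖WithLp.toLp 2 (T .plus g p.1.fst, T .minus g p.1.snd)‖ = ‖p.1‖
    rw [WithLp.prod_norm_eq_of_L2, WithLp.prod_norm_eq_of_L2]
    simp [(T .plus g).norm_map, (T .minus g).norm_map]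

/-- `H^0` as a real Hilbert space. -/
def H0 (d : ℕ) : Type := pairs d

instance (d : ℕ) : NormedAddCommGroup (H0 d) := inferInstanceAs (NormedAddCommGroup (pairs d))
instance (d : ℕ) : InnerProductSpace ℝ (H0 d) := inferInstanceAs (InnerProductSpace ℝ (pairs d))

/-- The orthogonal canonical representation `T^0` of `P₀` in `H^0`. -/
def T0 (g : Parabolic0 d) : H0 d →ₗᵢ[ℝ] H0 d := pairRep g

/-- The vector `(2^{-1/2} f, 2^{-1/2} f̄)` of `H^0` for `f(z) = exp(α + (z, β))`. -/
def expVec0 (α : ℂ) (β : Fin d → ℂ) : H0 d := show pairs d from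
  ⟨WithLp.toLp 2 ((((√2)⁻¹ : ℝ) : ℂ) • expVec .plus α β, (((√2)⁻¹ : ℝ) : ℂ) • expVec .minus α β), by
    intro z
    change (((√2)⁻¹ : ℝ) : ℂ) * conj (exp (α + z ⬝ᵥ β)) =
      conj ((((√2)⁻¹ : ℝ) : ℂ) * exp (α + z ⬝ᵥ β))
    rw [map_mul, Complex.conj_ofReal]⟩

/-- The almost invariant unit vector of `H^0`. -/
def vac0 (d : ℕ) : UnitVec (H0 d) := ⟨expVec0 0 0, by
  change ‖WithLp.toLp 2 ((((√2)⁻¹ : ℝ) : ℂ) • expVec .plus 0 (0 : Fin d → ℂ),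
    (((√2)⁻¹ : ℝ) : ℂ) • expVec .minus 0 (0 : Fin d → ℂ))‖ = 1
  rw [WithLp.prod_norm_eq_of_L2]
  simp [norm_smul, norm_expVec_zero]
  norm_num⟩

/-! ### The infinite-dimensional Lebesgue measure on `l^1_+(X)` -/

section Integral

variable {X : Type*} [MeasurableSpace X]

/-- Enumerated configurations `ξ = {r_k, x_k}`. An element `ξ = ∑ r_k δ_{x_k}` of `l^1_+(X)` with
pairwise distinct weights is represented by its unique enumeration with
`r_0 > r_1 > r_2 > ⋯`. -/
abbrev Config (X : Type*) := ℕ → RPos × X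

/-- The tail `∫_r^∞ s⁻¹ e^{-s} ds` of the Lévy measure of the gamma process. -/
def levyTail (r : ℝ) : ℝ := ∫ s in Set.Ioi r, s⁻¹ * Real.exp (-s)

open scoped Classical in
/-- The inverse `(0, ∞) → (0, ∞)` of the decreasing function `levyTail`. -/
def levyTailInv (t : ℝ) : RPos :=
  if h : 0 < sInf {r : ℝ | 0 < r ∧ levyTail r ≤ t} then ⟨_, h⟩ else 1

/-- The configuration with weights `r_k = levyTailInv (e_0 + ⋯ + e_k)`. -/
def gammaConfig (ω : ℕ → ℝ × X) : Config X := fun k =>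
  (levyTailInv (∑ j ∈ Finset.range (k + 1), (ω j).1), (ω k).2)

/-- The law of the gamma process on `(X, m)`: the atoms `(r_k, x_k)` form a Poisson process with
intensity `r⁻¹ e^{-r} dr dm(x)`, the arrival times `e_0 + ⋯ + e_k` being those of a Poisson process
of rate one and the `x_k` being independent with law `m`. Its Laplace transform is
`exp(-∫ log(1 + f) dm)`. -/
def gammaLaw (m : Measure X) : Measure (Config X) :=
  (Measure.infinitePi fun _ : ℕ => (ProbabilityTheory.expMeasure 1).prod m).map gammaConfig

/-- The infinite-dimensional Lebesgue measure `𝓛`, with density `exp(∑ r_k)` with respect to the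
law of the gamma process; hence
`∫ exp(-∑ r_k f(x_k)) d𝓛(ξ) = exp(-∫ log f dm)`. -/
def lebesgueInf (m : Measure X) : Measure (Config X) :=
  (gammaLaw m).withDensity fun ξ => ENNReal.ofReal (Real.exp (∑' k, ((ξ k).1 : ℝ)))

/-! ### Integral models -/

variable {𝕜 : Type*} [RCLike 𝕜] {E : Type*} [NormedAddCommGroup E] [InnerProductSpace 𝕜 E]

variable (𝕜) in
/-- The direct integral `INT (E, h) = ∫^⊕ E_ξ d𝓛(ξ)` of the tensor products
`E_ξ = ⊗_k E_{r_k}`, `E_r = E`, over the atoms of `ξ`. The enumeration of the atoms by decreasing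
weights identifies every `E_ξ` with the same tensor product, and the direct integral is the space
of its square integrable sections. -/
abbrev INT (h : UnitVec E) (m : Measure X) := Lp (TensorPow 𝕜 h) 2 (lebesgueInf m)

open scoped Classical in
variable (𝕜) in
/-- The value of a section at a configuration `ξ` enumerated in an arbitrary order: if `ξ ∘ σ` is
the enumeration by decreasing weights, then the factor number `k` of the value at `ξ ∘ σ` is
moved to the place `σ k`. -/
def evalAt {h : UnitVec E} (F : Config X → TensorPow 𝕜 h) (ξ : Config X) : TensorPow 𝕜 h :=
  if hσ : ∃ σ : Equiv.Perm ℕ, StrictAnti fun k => (ξ (σ k)).1 then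
    permOp 𝕜 h hσ.choose (F fun k => ξ (hσ.choose k))
  else 0

/-- The action of the current group `P₀^X`:
`(U(g) F)(ξ) = T_ξ(g) F(ξ)` with `T_ξ(g) = ⊗_k T_{r_k}(g(x_k))` and `T_r(g) = T(g^r)`. -/
def actP0 {h : UnitVec E} (S : Parabolic0 d → E →ₗᵢ[𝕜] E) (g : X → Parabolic0 d)
    (F : Config X → TensorPow 𝕜 h) (ξ : Config X) : TensorPow 𝕜 h :=
  tensorOp h (fun k => S (autP0 (ξ k).1 (g (ξ k).2))) (F ξ)

variable (𝕜) in
/-- The action of the multiplicators: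
`(U(r) F)(ξ) = exp(½ ∫ log r(x) dm(x)) F(r ξ)`, where `r ξ = {r(x_k) r_k, x_k}`. -/
def actR {h : UnitVec E} (m : Measure X) (r : X → RPos) (F : Config X → TensorPow 𝕜 h)
    (ξ : Config X) : TensorPow 𝕜 h :=
  (Real.exp (1 / 2 * ∫ x, Real.log (r x) ∂m) : 𝕜) •
    evalAt 𝕜 F fun k => (r (ξ k).2 * (ξ k).1, (ξ k).2)

/-- The integral model `INT S` of the representation of `P^X` on sections: the element
`p = r g` of `P^X`, with `r` a multiplicator and `g ∈ P₀^X`, acts as `U(r) U(g)`. -/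
def intModel {h : UnitVec E} (S : Parabolic0 d → E →ₗᵢ[𝕜] E) (m : Measure X)
    (p : X → Parabolic d) (F : Config X → TensorPow 𝕜 h) : Config X → TensorPow 𝕜 h :=
  actR 𝕜 m (fun x => radial (p x)) (actP0 S (fun x => unip (p x)) F)

/-! ### The complex Lobachevsky space -/

/-- The complex Lobachevsky space `L = {(a, b) ∈ ℂ ⊕ ℂ^{n-1} | a + ā + b* b < 0}`. -/
def Lob (d : ℕ) : Set (ℂ × (Fin d → ℂ)) := {v | 2 * v.1.re + ∑ i, ‖v.2 i‖ ^ 2 < 0}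

/-- The action of `U(n,1)` on `L` by fractional linear transformations. -/
def lobAct (g : UGroup d) (v : ℂ × (Fin d → ℂ)) : ℂ × (Fin d → ℂ) :=
  ((b11 g + b12 g ⬝ᵥ v.2 + b13 g * v.1)⁻¹ * (b31 g + b32 g ⬝ᵥ v.2 + b33 g * v.1),
    (b11 g + b12 g ⬝ᵥ v.2 + b13 g * v.1)⁻¹ • (b21 g + b22 g *ᵥ v.2 + v.1 • b23 g))

/-- The kernel `c(v₁, v₂) = log(-a₁ - ā₂ - b₂* b₁)`. -/
def cKer (v w : ℂ × (Fin d → ℂ)) : ℂ := log (-v.1 - conj w.1 - star w.2 ⬝ᵥ v.2)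

/-- The point `v₀ = (-1, 0)` of `L`. -/
def basePt (d : ℕ) : ℂ × (Fin d → ℂ) := (-1, 0)

/-- The function `u^+(g, v)`, respectively `u^-(g, v)`, its complex conjugate. -/
def uFun (ε : Sgn) (g : UGroup d) (v : ℂ × (Fin d → ℂ)) : ℂ :=
  cj ε (cKer (lobAct g v) (lobAct g (basePt d)) - cKer v (basePt d) -
    1 / 2 * (cKer (lobAct g (basePt d)) (lobAct g (basePt d)) - cKer (basePt d) (basePt d)))

/-- The set `L^X` of bounded measurable mappings of `X` to `L`; bounded sets of `L` are those with
compact closure in `L`. -/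
def LobCurrents (d : ℕ) (X : Type*) [MeasurableSpace X] : Set (X → ℂ × (Fin d → ℂ)) :=
  {v | Measurable v ∧ ∃ K ⊆ Lob d, IsCompact K ∧ ∀ x, v x ∈ K}

/-- The pointwise action of mappings to `U(n,1)` on mappings to `L`. -/
def actX (g : X → UGroup d) (v : X → ℂ × (Fin d → ℂ)) : X → ℂ × (Fin d → ℂ) :=
  fun x => lobAct (g x) (v x)

/-- The section `F_v^±(ξ) = ⊗_k f_{v,r_k,x_k}`, where
`f_{v,r,x}(z) = exp(r² a(x) + r (z, b(x)))`, respectively its complex conjugate. -/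
def Fsec (ε : Sgn) (v : X → ℂ × (Fin d → ℂ)) (ξ : Config X) : TensorPow ℂ (vac ε d) :=
  tprod ℂ (vac ε d) fun k =>
    expVec ε (((ξ k).1 : ℂ) ^ 2 * (v (ξ k).2).1) (((ξ k).1 : ℂ) • (v (ξ k).2).2)

/-- The section `F_v^0(ξ) = ⊗_k (2^{-1/2} f_{v,r_k,x_k}, 2^{-1/2} f̄_{v,r_k,x_k})`. -/
def Fsec0 (v : X → ℂ × (Fin d → ℂ)) (ξ : Config X) : TensorPow ℝ (vac0 d) :=
  tprod ℝ (vac0 d) fun k =>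
    expVec0 (((ξ k).1 : ℂ) ^ 2 * (v (ξ k).2).1) (((ξ k).1 : ℂ) • (v (ξ k).2).2)

open scoped Classical in
/-- The class of a square integrable section in `INT (E, h)` (zero for other sections). -/
def toINT {h : UnitVec E} (m : Measure X) (F : Config X → TensorPow 𝕜 h) : INT 𝕜 h m :=
  if hF : MemLp F 2 (lebesgueInf m) then hF.toLp F else 0

end Integral

end CurrentGroups

end

open CurrentGroups MeasureTheory

/-!
All three cases are treated at once. In each of the spaces `H^+`, `H^-` and `H^0` there is a total
family of exponential vectors `e(α, β)` with inner products `ρ(exp(ᾱ + α' + β* β'))`, where `ρ` is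
the identity, the complex conjugation or the real part, and the operators `T(g)`, `g ∈ P₀`, permute
this family in the way in which `P₀` acts on `L` (`ExpSystem`, `complexSystem`, `realSystem`).
Totality of the exponential vectors is the reproducing property of the Fock space
(`integral_reproducing`, `dense_span_expVec_plus`).

*The Gram kernel.* The inner product of `F_v(ξ)` and `F_w(ξ)` is `∏ ρ(exp(-r_k² f(x_k)))`, where
`f = -a_w - ā_v - b_v* b_w` has positive real part. By Campbell's formula for the gamma process
(`IsMult.integral_prod`, proved with a martingale along the arrival times of the atoms) and a Frullani
integral (`expoInt_eq`), its integral over `𝓛` is the exponential of `ρ(∫ (C - ½ c(w, v)) dm)` with a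
constant `C` (`laplace`, `ExpSystem.inner_vec`). The factor `½` is due to the squares of the weights.
With `v = w` this gives the square integrability of `F_v`.

*The operators.* The kernel `c` satisfies `c(gv, gw) = c(v, w) + u(g, v) + conj (u(g, w))`
(`cKer_lobAct`): modulo `2πi` this is the automorphy of `lobKer`, and `L` is convex, so there is no
ambiguity in the logarithms. Hence `F_v ↦ exp(½ ∫ u(g, v) dm) F_{gv}` preserves the Gram kernel, and
extends to an isometry of the closed linear hulls (`ExpSystem.op`). The same identity shows that
`u(gk, v) - u(k, v) - u(g, kv)` is an imaginary constant (`uFun_mul`). It produces the multiplier of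
the projective representation, and disappears from the real part.

*Totality.* Let `Φ` be orthogonal to all `F_v`. Replacing `(a, b)` by `(a - f, b)` with `f ≥ 0`
multiplies `F_v(ξ)` by `exp(-∑ r_k² f(x_k))`, and these functions determine finite measures on the
space of configurations (`ae_eq_zero_of_integral_exp`); therefore `⟪F_v(ξ), Φ(ξ)⟫ = 0` for almost
all `ξ`, for each `v`. A countable family of step functions `v` suffices to approximate, at almost
every `ξ`, all products of finitely many exponential vectors (`ExpSystem.eq_zero_of_inner_stepCurrent`),
and so `Φ(ξ) = 0`.

*The integral model.* For `p ∈ P^X` the number `u(p, v)` is the logarithm of the multiplicator of `p`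
(`uFun_parabolic`), and the integral model takes `F_v` to the same multiple of `F_{pv}` at each
configuration (`ExpSystem.intModel_F`). To pass from the vectors `F_v` to the whole space one needs
that the substitution `ξ ↦ r ξ` preserves null sets (`ae_sorted_scaleConfig`), which again follows
from the Laplace transform (`map_coords_scaleConfig`).
-/

noncomputable section

set_option linter.unusedSectionVars false

open MeasureTheory Filter Topology Complex ComplexConjugate Matrix
open scoped InnerProductSpace ENNReal

namespace CurrentGroups

/-! ### The action of `U(n,1)` on the Lobachevsky space -/

section Lobachevsky

variable {d : ℕ}

/-- The kernel `-a₁ - ā₂ - b₂* b₁` on `L`, whose logarithm is `cKer`. -/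
def lobKer (v w : ℂ × (Fin d → ℂ)) : ℂ := -v.1 - conj w.1 - star w.2 ⬝ᵥ v.2

/-- The automorphy factor `j(g, v) = g₁₁ + g₁₂ b + g₁₃ a`. -/
def lobFac (g : UGroup d) (v : ℂ × (Fin d → ℂ)) : ℂ := b11 g + b12 g ⬝ᵥ v.2 + b13 g * v.1

/-- The homogeneous coordinates `(1, b, a)` of the point `(a, b)`. -/
def lobVec (v : ℂ × (Fin d → ℂ)) : Idx d → ℂ := Sum.elim (fun _ => 1) (Sum.elim v.2 fun _ => v.1)

theorem star_lobVec_form (v w : ℂ × (Fin d → ℂ)) :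
    star (lobVec w) ⬝ᵥ (formMatrix d *ᵥ lobVec v) = -lobKer v w := by
  simp [lobVec, lobKer, dotProduct, mulVec, formMatrix, Fintype.sum_sum_type]
  ring

theorem mat_mulVec_lobVec (g : UGroup d) (v : ℂ × (Fin d → ℂ)) : mat g *ᵥ lobVec v =
    Sum.elim (fun _ => lobFac g v) (Sum.elim (b21 g + b22 g *ᵥ v.2 + v.1 • b23 g)
      fun _ => b31 g + b32 g ⬝ᵥ v.2 + b33 g * v.1) := by
  funext i
  rcases i with i | i | i <;>
    simp [lobVec, lobFac, mulVec, dotProduct, Fintype.sum_sum_type, b11, b12, b13, b21, b22, b23,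
      b31, b32, b33, mul_comm v.1, add_assoc]

theorem mat_mulVec_lobVec_eq_smul {g : UGroup d} {v : ℂ × (Fin d → ℂ)} (h : lobFac g v ≠ 0) :
    mat g *ᵥ lobVec v = lobFac g v • lobVec (lobAct g v) := by
  rw [mat_mulVec_lobVec]
  funext i
  change lobFac g v ≠ 0 at h
  rcases i with i | i | i
  · simp [lobVec]
  · change _ = lobFac g v * ((lobFac g v)⁻¹ * _)
    rw [mul_inv_cancel_left₀ h]; rfl
  · change _ = lobFac g v * ((lobFac g v)⁻¹ * _)
    rw [mul_inv_cancel_left₀ h]; rfl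

theorem form_mat_mulVec (g : UGroup d) (x y : Idx d → ℂ) :
    star (mat g *ᵥ x) ⬝ᵥ (formMatrix d *ᵥ (mat g *ᵥ y)) = star x ⬝ᵥ (formMatrix d *ᵥ y) := by
  have hg : (mat g)ᴴ * formMatrix d * mat g = formMatrix d := g.2
  conv_rhs => rw [← hg]
  rw [star_mulVec, ← dotProduct_mulVec, mulVec_mulVec, mulVec_mulVec]

theorem lobKer_lobAct {g : UGroup d} {v w : ℂ × (Fin d → ℂ)} (hv : lobFac g v ≠ 0)
    (hw : lobFac g w ≠ 0) :
    lobKer (lobAct g v) (lobAct g w) * (lobFac g v * conj (lobFac g w)) = lobKer v w := by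
  have h := form_mat_mulVec g (lobVec w) (lobVec v)
  rw [mat_mulVec_lobVec_eq_smul hv, mat_mulVec_lobVec_eq_smul hw, mulVec_smul, star_smul,
    smul_dotProduct, dotProduct_smul, star_lobVec_form, star_lobVec_form] at h
  simp only [smul_eq_mul, RCLike.star_def] at h
  linear_combination -h

theorem lobKer_conj (v w : ℂ × (Fin d → ℂ)) : conj (lobKer w v) = lobKer v w := by
  simp only [lobKer, dotProduct, map_sub, map_neg, map_sum, map_mul, Pi.star_apply, RCLike.star_def,
    Complex.conj_conj]
  simp only [mul_comm ((starRingEnd ℂ) _)]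
  ring

/-- The height `-a - ā - b* b`, positive exactly on `L`. -/
def lobHeight (v : ℂ × (Fin d → ℂ)) : ℝ := -2 * v.1.re - ∑ i, ‖v.2 i‖ ^ 2

theorem lobHeight_pos_iff {v : ℂ × (Fin d → ℂ)} : 0 < lobHeight v ↔ v ∈ Lob d := by
  change _ ↔ 2 * v.1.re + ∑ i, ‖v.2 i‖ ^ 2 < 0
  unfold lobHeight
  constructor <;> intro h <;> linarith

theorem lobKer_self (v : ℂ × (Fin d → ℂ)) : lobKer v v = lobHeight v := by
  have h := sum_norm_sq v.2
  rw [dotProduct_comm] at h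
  simp only [lobKer, lobHeight, ofReal_sub, ofReal_mul, h]
  rw [Complex.re_eq_add_conj]
  push_cast
  ring

theorem lobKer_re_ge (v w : ℂ × (Fin d → ℂ)) :
    (lobHeight v + lobHeight w) / 2 ≤ (lobKer v w).re := by
  have h : (star w.2 ⬝ᵥ v.2).re ≤ ∑ i, (‖w.2 i‖ ^ 2 + ‖v.2 i‖ ^ 2) / 2 := by
    simp only [dotProduct, Complex.re_sum]
    refine Finset.sum_le_sum fun i _ => ?_
    have h1 := (Complex.re_le_norm (star w.2 i * v.2 i))
    rw [norm_mul, Pi.star_apply, norm_star] at h1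
    rw [Pi.star_apply]
    nlinarith [sq_nonneg (‖w.2 i‖ - ‖v.2 i‖)]
  rw [← Finset.sum_div, Finset.sum_add_distrib] at h
  simp only [lobHeight, lobKer, sub_re, neg_re, conj_re]
  linarith

theorem lobKer_re_pos {v w : ℂ × (Fin d → ℂ)} (hv : v ∈ Lob d) (hw : w ∈ Lob d) :
    0 < (lobKer v w).re := by
  have h1 := lobHeight_pos_iff.2 hv
  have h2 := lobHeight_pos_iff.2 hw
  linarith [lobKer_re_ge v w]

theorem norm_lobKer_le {v w : ℂ × (Fin d → ℂ)} {C : ℝ} (hv : ‖v‖ ≤ C) (hw : ‖w‖ ≤ C) :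
    ‖lobKer v w‖ ≤ 2 * C + d * C ^ 2 := by
  have h0 : 0 ≤ C := (norm_nonneg _).trans hv
  have h1 : ‖star w.2 ⬝ᵥ v.2‖ ≤ d * C ^ 2 := by
    refine (norm_sum_le _ _).trans ((Finset.sum_le_sum (g := fun _ => C ^ 2) fun i _ => ?_).trans ?_)
    · rw [norm_mul, Pi.star_apply, norm_star, pow_two]
      exact mul_le_mul (((norm_le_pi_norm w.2 i).trans (norm_snd_le w)).trans hw)
        (((norm_le_pi_norm v.2 i).trans (norm_snd_le v)).trans hv) (norm_nonneg _) h0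
    · simp
  have h2 : ‖v.1‖ ≤ C := (norm_fst_le v).trans hv
  have h3 : ‖conj w.1‖ ≤ C := by
    rw [RCLike.norm_conj]
    exact (norm_fst_le w).trans hw
  calc ‖lobKer v w‖ ≤ ‖-v.1 - conj w.1‖ + ‖star w.2 ⬝ᵥ v.2‖ := norm_sub_le _ _
    _ ≤ ‖-v.1‖ + ‖conj w.1‖ + ‖star w.2 ⬝ᵥ v.2‖ := by gcongr; exact norm_sub_le _ _
    _ ≤ 2 * C + d * C ^ 2 := by rw [norm_neg]; linarith

/-- As the form of `mat g (1, b, a)` is that of `(1, b, a)`, its first coordinate cannot be small. -/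
theorem lobHeight_le (g : UGroup d) (v : ℂ × (Fin d → ℂ)) :
    lobHeight v ≤ 2 * ‖lobFac g v‖ * ‖b31 g + b32 g ⬝ᵥ v.2 + b33 g * v.1‖ := by
  have h := form_mat_mulVec g (lobVec v) (lobVec v)
  rw [star_lobVec_form, lobKer_self, mat_mulVec_lobVec] at h
  set p := lobFac g v
  set q := b31 g + b32 g ⬝ᵥ v.2 + b33 g * v.1
  set y := b21 g + b22 g *ᵥ v.2 + v.1 • b23 g
  have h2 : star (Sum.elim (fun _ => p) (Sum.elim y fun _ => q) : Idx d → ℂ) ⬝ᵥ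
      (formMatrix d *ᵥ (Sum.elim (fun _ => p) (Sum.elim y fun _ => q) : Idx d → ℂ)) =
      conj p * q + conj q * p + ((∑ i, ‖y i‖ ^ 2 : ℝ) : ℂ) := by
    rw [sum_norm_sq, dotProduct_comm y]
    simp [dotProduct, mulVec, formMatrix, Fintype.sum_sum_type]
    ring
  rw [h2] at h
  have h3 := congrArg Complex.re h
  have h4 : 0 ≤ ∑ i, ‖y i‖ ^ 2 := Finset.sum_nonneg fun i _ => by positivity
  have h5 := Complex.abs_re_le_norm (conj p * q)
  have h6 := Complex.abs_re_le_norm (conj q * p)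
  rw [norm_mul, RCLike.norm_conj] at h5 h6
  simp only [add_re, ofReal_re, neg_re] at h3
  have h7 := neg_le_of_abs_le h5
  have h8 := neg_le_of_abs_le h6
  nlinarith

theorem lobFac_ne_zero (g : UGroup d) {v : ℂ × (Fin d → ℂ)} (hv : v ∈ Lob d) : lobFac g v ≠ 0 := by
  intro h0
  have h := lobHeight_le g v
  rw [h0, norm_zero, mul_zero, zero_mul] at h
  exact absurd (lobHeight_pos_iff.2 hv) (not_lt.2 h)

theorem lobHeight_lobAct (g : UGroup d) {v : ℂ × (Fin d → ℂ)} (hv : v ∈ Lob d) :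
    lobHeight (lobAct g v) * ‖lobFac g v‖ ^ 2 = lobHeight v := by
  have h := lobKer_lobAct (lobFac_ne_zero g hv) (lobFac_ne_zero g hv)
  rw [lobKer_self, lobKer_self, Complex.mul_conj'] at h
  exact_mod_cast h

theorem lobAct_mem (g : UGroup d) {v : ℂ × (Fin d → ℂ)} (hv : v ∈ Lob d) : lobAct g v ∈ Lob d := by
  have h := lobHeight_lobAct g hv
  have h1 := lobHeight_pos_iff.2 hv
  rw [← h] at h1
  exact lobHeight_pos_iff.1 (pos_of_mul_pos_left h1 (by positivity))

theorem lobVec_injective : Function.Injective (lobVec (d := d)) := by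
  intro v w h
  refine Prod.ext ?_ (funext fun i => ?_)
  · exact congrFun h (.inr (.inr ()))
  · exact congrFun h (.inr (.inl i))

theorem lobAct_mul (g k : UGroup d) {v : ℂ × (Fin d → ℂ)} (hv : v ∈ Lob d) :
    lobAct (g * k) v = lobAct g (lobAct k v) := by
  have h1 := mat_mulVec_lobVec_eq_smul (lobFac_ne_zero k hv)
  have h2 := mat_mulVec_lobVec_eq_smul (lobFac_ne_zero g (lobAct_mem k hv))
  have h3 := mat_mulVec_lobVec_eq_smul (lobFac_ne_zero (g * k) hv)
  rw [mat_mul, ← mulVec_mulVec, h1, mulVec_smul, h2, smul_smul] at h3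
  have h4 : lobFac k v * lobFac g (lobAct k v) = lobFac (g * k) v := by
    have := congrFun h3 (.inl ())
    simpa [lobVec] using this
  rw [h4] at h3
  refine lobVec_injective ?_
  exact ((smul_right_injective _ (lobFac_ne_zero (g * k) hv)) h3).symm

theorem lobAct_one (v : ℂ × (Fin d → ℂ)) : lobAct (1 : UGroup d) v = v := by
  have h : lobFac (1 : UGroup d) v = 1 := by
    simp [lobFac, b11, b12, b13, mat, dotProduct]
  have h1 := mat_mulVec_lobVec_eq_smul (g := 1) (v := v) (by rw [h]; exact one_ne_zero)
  have h2 : mat (1 : UGroup d) = 1 := rfl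
  rw [h, one_smul, h2, one_mulVec] at h1
  exact (lobVec_injective h1).symm

theorem basePt_mem : basePt d ∈ Lob d := by
  change 2 * ((-1 : ℂ)).re + ∑ i, ‖(0 : Fin d → ℂ) i‖ ^ 2 < 0
  simp

/-! ### The cocycle -/

theorem cKer_eq (v w : ℂ × (Fin d → ℂ)) : cKer v w = log (lobKer v w) := rfl

theorem cKer_conj {v w : ℂ × (Fin d → ℂ)} (hv : v ∈ Lob d) (hw : w ∈ Lob d) :
    conj (cKer v w) = cKer w v := by
  rw [cKer_eq, cKer_eq, ← lobKer_conj w v, Complex.log_conj]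
  intro h
  have := lobKer_re_pos hv hw
  rw [Complex.arg_eq_pi_iff] at h
  linarith [h.1]

theorem cKer_self_conj {v : ℂ × (Fin d → ℂ)} (hv : v ∈ Lob d) : conj (cKer v v) = cKer v v :=
  cKer_conj hv hv

theorem exp_cKer {v w : ℂ × (Fin d → ℂ)} (hv : v ∈ Lob d) (hw : w ∈ Lob d) :
    exp (cKer v w) = lobKer v w := by
  refine Complex.exp_log fun h => ?_
  have := lobKer_re_pos hv hw
  rw [show lobKer v w = 0 from h, zero_re] at this
  exact lt_irrefl _ this

theorem continuous_lobKer : Continuous fun p : (ℂ × (Fin d → ℂ)) × (ℂ × (Fin d → ℂ)) =>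
    lobKer p.1 p.2 := by
  unfold lobKer dotProduct
  simp only [Pi.star_apply, RCLike.star_def]
  fun_prop

theorem continuousOn_lobAct (g : UGroup d) : ContinuousOn (lobAct g) (Lob d) := by
  have hj : ContinuousOn (fun v : ℂ × (Fin d → ℂ) => (lobFac g v)⁻¹) (Lob d) := by
    refine ContinuousOn.inv₀ ?_ fun v hv => lobFac_ne_zero g hv
    unfold lobFac dotProduct
    fun_prop
  refine ContinuousOn.prodMk (hj.mul ?_) (hj.smul ?_)
  · unfold dotProduct
    fun_prop
  · fun_prop

theorem continuousOn_cKer_left {w : ℂ × (Fin d → ℂ)} (hw : w ∈ Lob d) :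
    ContinuousOn (fun v => cKer v w) (Lob d) := by
  refine ContinuousOn.clog ?_ fun v hv => Or.inl (lobKer_re_pos hv hw)
  exact (continuous_lobKer.comp (by fun_prop : Continuous fun v => (v, w))).continuousOn

theorem convex_lob : Convex ℝ (Lob d) := by
  have h : ConvexOn ℝ Set.univ fun v : ℂ × (Fin d → ℂ) => 2 * v.1.re + ∑ i, ‖v.2 i‖ ^ 2 := by
    refine ConvexOn.add (LinearMap.convexOn
      ((2 : ℝ) • (Complex.reLm.comp (LinearMap.fst ℝ ℂ (Fin d → ℂ)))) convex_univ) ?_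
    have h1 : ∀ i : Fin d, ConvexOn ℝ Set.univ fun v : ℂ × (Fin d → ℂ) => ‖v.2 i‖ ^ 2 := by
      intro i
      have h2 : ConvexOn ℝ Set.univ fun v : ℂ × (Fin d → ℂ) => ‖v.2 i‖ :=
        (convexOn_norm (E := ℂ) convex_univ).comp_linearMap
          ((LinearMap.proj i).comp (LinearMap.snd ℝ ℂ (Fin d → ℂ)))
      exact h2.pow (fun v _ => norm_nonneg _) 2
    have : ∀ s : Finset (Fin d), ConvexOn ℝ Set.univ
        fun v : ℂ × (Fin d → ℂ) => ∑ i ∈ s, ‖v.2 i‖ ^ 2 := by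
      intro s
      classical
      induction s using Finset.induction_on with
      | empty => simpa using convexOn_const (0 : ℝ) convex_univ
      | insert a s ha ih =>
        simp only [Finset.sum_insert ha]
        exact (h1 a).add ih
    exact this _
  have := h.convex_lt 0
  simpa [Lob] using this

/-- The defect of the cocycle identity for `cKer` is continuous on the convex set `L`, takes values
in `2πiℤ`, and vanishes at the base point. -/
theorem cKer_four_point (g : UGroup d) {v w : ℂ × (Fin d → ℂ)} (hv : v ∈ Lob d) (hw : w ∈ Lob d) :
    cKer (lobAct g v) (lobAct g w) - cKer v w =
      cKer (lobAct g v) (lobAct g (basePt d)) - cKer v (basePt d) +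
      (cKer (lobAct g (basePt d)) (lobAct g w) - cKer (basePt d) w) -
      (cKer (lobAct g (basePt d)) (lobAct g (basePt d)) - cKer (basePt d) (basePt d)) := by
  have h0 := basePt_mem (d := d)
  set D : ℂ × (Fin d → ℂ) → ℂ := fun v => (cKer (lobAct g v) (lobAct g w) - cKer v w) -
    (cKer (lobAct g v) (lobAct g (basePt d)) - cKer v (basePt d)) -
    (cKer (lobAct g (basePt d)) (lobAct g w) - cKer (basePt d) w) +
    (cKer (lobAct g (basePt d)) (lobAct g (basePt d)) - cKer (basePt d) (basePt d)) with hD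
  -- continuity holds because `lobKer` has positive real part, where the principal branch is continuous
  have hcg : ∀ w ∈ Lob d, ContinuousOn (fun v => cKer (lobAct g v) (lobAct g w)) (Lob d) :=
    fun w hw => (continuousOn_cKer_left (lobAct_mem g hw)).comp (continuousOn_lobAct g)
      fun v hv => lobAct_mem g hv
  have hc : ContinuousOn D (Lob d) := by
    refine ContinuousOn.add (ContinuousOn.sub (ContinuousOn.sub ?_ ?_) continuousOn_const)
      continuousOn_const
    · exact (hcg w hw).sub (continuousOn_cKer_left hw)
    · exact (hcg _ h0).sub (continuousOn_cKer_left h0)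
  have hK : ∀ v ∈ Lob d, ∀ w ∈ Lob d, exp (cKer (lobAct g v) (lobAct g w) - cKer v w) =
      (lobFac g v * conj (lobFac g w))⁻¹ := by
    intro v hv w hw
    have h1 := exp_cKer (lobAct_mem g hv) (lobAct_mem g hw)
    have h2 := exp_cKer hv hw
    have h3 : lobFac g v * conj (lobFac g w) ≠ 0 := mul_ne_zero (lobFac_ne_zero g hv)
      ((map_ne_zero _).2 (lobFac_ne_zero g hw))
    have h4 : lobKer (lobAct g v) (lobAct g w) ≠ 0 := h1 ▸ Complex.exp_ne_zero _
    rw [Complex.exp_sub, h1, h2, ← lobKer_lobAct (lobFac_ne_zero g hv) (lobFac_ne_zero g hw)]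
    field_simp
  have hexp : ∀ v ∈ Lob d, exp (D v) = 1 := by
    intro v hv
    rw [hD]
    simp only []
    rw [Complex.exp_add, Complex.exp_sub (_ - _), Complex.exp_sub (cKer (lobAct g v) (lobAct g w) - _),
      hK v hv w hw, hK v hv _ h0, hK _ h0 w hw, hK _ h0 _ h0]
    have e1 := lobFac_ne_zero g hv
    have e2 := (map_ne_zero (starRingEnd ℂ)).2 (lobFac_ne_zero g hw)
    have e3 := lobFac_ne_zero g h0
    have e4 := (map_ne_zero (starRingEnd ℂ)).2 e3
    field_simp
  have hD0 : D (basePt d) = 0 := by rw [hD]; ring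
  have hzero : D v = 0 := by
    by_contra hne
    have himc : ContinuousOn (fun v => (D v).im / (2 * Real.pi)) (Lob d) :=
      (Complex.continuous_im.comp_continuousOn hc).div_const _
    have hint : ∀ v ∈ Lob d, ∃ n : ℤ, D v = n * (2 * Real.pi * I) :=
      fun v hv => Complex.exp_eq_one_iff.1 (hexp v hv)
    have hpre := (convex_lob (d := d)).isPreconnected
    have hmaps : Set.MapsTo (fun v => (D v).im / (2 * Real.pi)) (Lob d)
        (Set.range ((↑) : ℤ → ℝ)) := by
      intro v hv
      obtain ⟨n, hn⟩ := hint v hv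
      refine ⟨n, ?_⟩
      have := Real.pi_ne_zero
      simp only [hn]
      simp [this]
    have key := hpre.constant_of_mapsTo
      Int.isClosedEmbedding_coe_real.isEmbedding.isInducing.isDiscrete_range himc hmaps hv h0
    obtain ⟨n, hn⟩ := hint v hv
    simp only [hD0, hn] at key
    have hpi := Real.pi_ne_zero
    simp [hpi] at key
    rw [hn, key] at hne
    simp at hne
  rw [hD] at hzero
  linear_combination hzero

/-- `c(gv, gw) - c(v, w)` is the sum of `u(g, v)` and of the conjugate of `u(g, w)`: this is what
makes the operators `U(g)` isometric. -/
theorem cKer_lobAct (g : UGroup d) {v w : ℂ × (Fin d → ℂ)} (hv : v ∈ Lob d) (hw : w ∈ Lob d) :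
    cKer (lobAct g v) (lobAct g w) = cKer v w + uFun .plus g v + conj (uFun .plus g w) := by
  have h0 := basePt_mem (d := d)
  have h := cKer_four_point g hv hw
  have e : ∀ z, cj .plus z = z := fun _ => rfl
  simp only [uFun, e, map_sub, map_mul, map_div₀, map_one, map_ofNat,
    cKer_conj (lobAct_mem g hw) (lobAct_mem g h0), cKer_conj hw h0,
    cKer_self_conj (lobAct_mem g h0), cKer_self_conj h0]
  linear_combination h

/-- The failure of the cocycle identity for `u` is a purely imaginary constant. -/
theorem uFun_mul (g k : UGroup d) {v : ℂ × (Fin d → ℂ)} (hv : v ∈ Lob d) :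
    uFun .plus (g * k) v - uFun .plus k v - uFun .plus g (lobAct k v) =
      ((uFun .plus (g * k) (basePt d) - uFun .plus k (basePt d) -
        uFun .plus g (lobAct k (basePt d))).im : ℂ) * I := by
  have key : ∀ v ∈ Lob d, ∀ w ∈ Lob d,
      uFun .plus (g * k) v - uFun .plus k v - uFun .plus g (lobAct k v) +
      conj (uFun .plus (g * k) w - uFun .plus k w - uFun .plus g (lobAct k w)) = 0 := by
    intro v hv w hw
    have h1 := cKer_lobAct (g * k) hv hw
    have h2 := cKer_lobAct g (lobAct_mem k hv) (lobAct_mem k hw)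
    have h3 := cKer_lobAct k hv hw
    rw [lobAct_mul g k hv, lobAct_mul g k hw] at h1
    simp only [map_sub]
    linear_combination h2 + h3 - h1
  have h0 := basePt_mem (d := d)
  have h1 := key v hv _ h0
  have h2 := key _ h0 _ h0
  set z := uFun .plus (g * k) (basePt d) - uFun .plus k (basePt d) -
        uFun .plus g (lobAct k (basePt d))
  rw [Complex.add_conj] at h2
  have h3 : z.re = 0 := by
    have := congrArg Complex.re h2
    simpa using this
  rw [eq_neg_of_add_eq_zero_left h1]
  apply Complex.ext <;> simp [h3]

/-! ### Currents with values in the Lobachevsky space -/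

section Currents

variable {X : Type*} [MeasurableSpace X]

/-- A measurable map to `L` has its image in a compact subset of `L` exactly if it is bounded and its
height is bounded away from zero. -/
theorem mem_LobCurrents_iff {v : X → ℂ × (Fin d → ℂ)} : v ∈ LobCurrents d X ↔
    Measurable v ∧ ∃ C δ : ℝ, 0 < δ ∧ ∀ x, ‖v x‖ ≤ C ∧ δ ≤ lobHeight (v x) := by
  have hcont : Continuous (lobHeight (d := d)) := by
    unfold lobHeight
    fun_prop
  constructor
  · rintro ⟨hm, K, hK, hc, hv⟩
    refine ⟨hm, ?_⟩
    rcases K.eq_empty_or_nonempty with rfl | hne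
    · exact ⟨0, 1, one_pos, fun x => (hv x).elim⟩
    obtain ⟨C, hC⟩ := hc.isBounded.exists_norm_le
    obtain ⟨y, hy, hmin⟩ := hc.exists_isMinOn hne hcont.continuousOn
    exact ⟨C, lobHeight y, lobHeight_pos_iff.2 (hK hy), fun x => ⟨hC _ (hv x), hmin (hv x)⟩⟩
  · rintro ⟨hm, C, δ, hδ, hv⟩
    refine ⟨hm, Metric.closedBall 0 C ∩ {v | δ ≤ lobHeight v}, ?_, ?_, fun x => ⟨?_, (hv x).2⟩⟩
    · rintro v ⟨-, h⟩
      exact lobHeight_pos_iff.1 (hδ.trans_le h)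
    · exact (isCompact_closedBall _ _).inter_right (isClosed_le continuous_const hcont)
    · simpa using (hv x).1

theorem LobCurrents.mem_lob {v : X → ℂ × (Fin d → ℂ)} (hv : v ∈ LobCurrents d X) (x : X) :
    v x ∈ Lob d := by
  obtain ⟨-, K, hK, -, h⟩ := hv
  exact hK (h x)

theorem basePt_mem_LobCurrents : (fun _ : X => basePt d) ∈ LobCurrents d X :=
  mem_LobCurrents_iff.2 ⟨measurable_const, ‖basePt d‖, lobHeight (basePt d),
    lobHeight_pos_iff.2 basePt_mem, fun _ => ⟨le_rfl, le_rfl⟩⟩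

theorem LobCurrents.exists_lobKer_bounds {v w : X → ℂ × (Fin d → ℂ)} (hv : v ∈ LobCurrents d X)
    (hw : w ∈ LobCurrents d X) : ∃ C δ : ℝ, 0 < δ ∧ ∀ x, ‖lobKer (v x) (w x)‖ ≤ C ∧
      δ ≤ (lobKer (v x) (w x)).re := by
  obtain ⟨-, C, δ, hδ, h⟩ := mem_LobCurrents_iff.1 hv
  obtain ⟨-, C', δ', hδ', h'⟩ := mem_LobCurrents_iff.1 hw
  refine ⟨2 * max C C' + d * (max C C') ^ 2, (δ + δ') / 2, by linarith, fun x => ⟨?_, ?_⟩⟩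
  · exact norm_lobKer_le ((h x).1.trans (le_max_left _ _)) ((h' x).1.trans (le_max_right _ _))
  · linarith [lobKer_re_ge (v x) (w x), (h x).2, (h' x).2]

theorem measurable_lobKer {v w : X → ℂ × (Fin d → ℂ)} (hv : Measurable v) (hw : Measurable w) :
    Measurable fun x => lobKer (v x) (w x) :=
  continuous_lobKer.measurable.comp (hv.prodMk hw)

/-- A bound of the logarithm on the bounded part of a half-plane. -/
theorem norm_log_le {z : ℂ} {C δ : ℝ} (hδ : 0 < δ) (h1 : ‖z‖ ≤ C) (h2 : δ ≤ z.re) :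
    ‖log z‖ ≤ |Real.log C| + |Real.log δ| + Real.pi := by
  have h3 : δ ≤ ‖z‖ := h2.trans (Complex.re_le_norm z)
  have h4 : |Real.log ‖z‖| ≤ |Real.log C| + |Real.log δ| := by
    have h5 := Real.log_le_log hδ h3
    have h6 := Real.log_le_log (hδ.trans_le h3) h1
    rw [abs_le]
    constructor
    · linarith [neg_abs_le (Real.log δ), abs_nonneg (Real.log C)]
    · linarith [le_abs_self (Real.log C), abs_nonneg (Real.log δ)]
  refine (Complex.norm_le_abs_re_add_abs_im _).trans ?_
  rw [Complex.log_re, Complex.log_im]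
  exact add_le_add h4 (Complex.abs_arg_le_pi z)

theorem LobCurrents.integrable_cKer (m : Measure X) [IsProbabilityMeasure m]
    {v w : X → ℂ × (Fin d → ℂ)} (hv : v ∈ LobCurrents d X) (hw : w ∈ LobCurrents d X) :
    Integrable (fun x => cKer (v x) (w x)) m := by
  obtain ⟨C, δ, hδ, h⟩ := LobCurrents.exists_lobKer_bounds hv hw
  exact Integrable.of_bound (measurable_lobKer hv.1 hw.1).clog.aestronglyMeasurable _
    (Eventually.of_forall fun x => norm_log_le hδ (h x).1 (h x).2)

/-- For bounded `g` the homogeneous coordinates of `g v` are bounded; by `lobHeight_le` the automorphy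
factor is then bounded away from zero. Hence `g v` is bounded, and its height is bounded away from
zero. -/
theorem actX_mem (g : CurrentGroup d X) {v : X → ℂ × (Fin d → ℂ)} (hv : v ∈ LobCurrents d X) :
    actX (g : X → UGroup d) v ∈ LobCurrents d X := by
  obtain ⟨g, hgm, M, hM⟩ := g
  obtain ⟨hm, C, δ, hδ, h⟩ := mem_LobCurrents_iff.1 hv
  have hL := LobCurrents.mem_lob hv
  have hv1 : Measurable fun x => (v x).1 := measurable_fst.comp hm
  have hv2 : ∀ i, Measurable fun x => (v x).2 i := fun i =>
    (measurable_pi_apply i).comp (measurable_snd.comp hm)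
  rcases isEmpty_or_nonempty X with hX | ⟨⟨x0⟩⟩
  · exact mem_LobCurrents_iff.2 ⟨measurable_of_empty _, 0, 1, one_pos, fun x => isEmptyElim x⟩
  have hM0 : 0 ≤ M := (norm_nonneg _).trans (hM x0 (.inl ()) (.inl ()))
  have hC0 : 0 ≤ C := (norm_nonneg _).trans (h x0).1
  have hb : ∀ x i, ‖(v x).2 i‖ ≤ C := fun x i =>
    ((norm_le_pi_norm _ i).trans (norm_snd_le _)).trans (h x).1
  have ha : ∀ x, ‖(v x).1‖ ≤ C := fun x => (norm_fst_le _).trans (h x).1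
  -- a common bound for the homogeneous coordinates of `g v`
  set B := M + d * (M * C) + M * C with hB
  have hB0 : 0 ≤ B := by positivity
  have hlin : ∀ (p q : ℂ) (r : Fin d → ℂ) (x : X), ‖p‖ ≤ M → ‖q‖ ≤ M → (∀ i, ‖r i‖ ≤ M) →
      ‖p + r ⬝ᵥ (v x).2 + q * (v x).1‖ ≤ B := by
    intro p q r x hp hq hr
    refine (norm_add_le _ _).trans (add_le_add ((norm_add_le _ _).trans (add_le_add hp ?_)) ?_)
    · refine (norm_sum_le _ _).trans ((Finset.sum_le_sum (g := fun _ => M * C) fun i _ => ?_).trans ?_)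
      · rw [norm_mul]
        exact mul_le_mul (hr i) (hb x i) (norm_nonneg _) hM0
      · simp
    · rw [norm_mul]
      exact mul_le_mul hq (ha x) (norm_nonneg _) hM0
  have hn1 : ∀ x, ‖lobFac (g x) (v x)‖ ≤ B := fun x =>
    hlin _ _ _ x (hM x _ _) (hM x _ _) fun i => hM x _ _
  have hn3 : ∀ x, ‖b31 (g x) + b32 (g x) ⬝ᵥ (v x).2 + b33 (g x) * (v x).1‖ ≤ B := fun x =>
    hlin _ _ _ x (hM x _ _) (hM x _ _) fun i => hM x _ _
  have hn2 : ∀ x i, ‖(b21 (g x) + b22 (g x) *ᵥ (v x).2 + (v x).1 • b23 (g x)) i‖ ≤ B := by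
    intro x i
    have := hlin (b21 (g x) i) (b23 (g x) i) (fun j => b22 (g x) i j) x (hM x _ _) (hM x _ _)
      fun j => hM x _ _
    simpa [mulVec, mul_comm] using this
  have hBpos : 0 < B := (norm_pos_iff.2 (lobFac_ne_zero (g x0) (hL x0))).trans_le (hn1 x0)
  have hj : ∀ x, ‖(lobFac (g x) (v x))⁻¹‖ ≤ 2 * B / δ := by
    intro x
    have h1 := (h x).2.trans (lobHeight_le (g x) (v x))
    have h2 := norm_pos_iff.2 (lobFac_ne_zero (g x) (hL x))
    rw [norm_inv, inv_le_comm₀ h2 (by positivity), inv_div, div_le_iff₀ (by positivity)]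
    have h3 := mul_le_mul_of_nonneg_left (hn3 x) (by positivity : 0 ≤ 2 * ‖lobFac (g x) (v x)‖)
    linarith
  refine mem_LobCurrents_iff.2 ⟨?_, 2 * B / δ * B, δ / B ^ 2, by positivity, fun x => ⟨?_, ?_⟩⟩
  · have hd : ∀ r : X → Fin d → ℂ, (∀ i, Measurable fun x => r x i) →
        Measurable fun x => r x ⬝ᵥ (v x).2 := fun r hr =>
      Finset.measurable_sum _ fun i _ => (hr i).mul (hv2 i)
    have hj : Measurable fun x => (lobFac (g x) (v x))⁻¹ :=
      (((hgm _ _).add (hd _ fun i => hgm _ _)).add ((hgm _ _).mul hv1)).inv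
    refine Measurable.prodMk (hj.mul (((hgm _ _).add (hd _ fun i => hgm _ _)).add
      ((hgm _ _).mul hv1))) (measurable_pi_lambda _ fun i => hj.mul (((hgm _ _).add
        (hd (fun x j => b22 (g x) i j) fun j => hgm _ _)).add (hv1.mul (hgm _ _))))
  · refine max_le ?_ ((pi_norm_le_iff_of_nonneg (by positivity)).2 fun i => ?_)
    · exact (norm_mul _ _).trans_le (mul_le_mul (hj x) (hn3 x) (norm_nonneg _) (by positivity))
    · exact (norm_mul _ _).trans_le (mul_le_mul (hj x) (hn2 x i) (norm_nonneg _) (by positivity))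
  · have h1 := lobHeight_lobAct (g x) (hL x)
    have h2 := norm_pos_iff.2 (lobFac_ne_zero (g x) (hL x))
    have h3 := lobHeight_pos_iff.2 (lobAct_mem (g x) (hL x))
    rw [div_le_iff₀ (by positivity)]
    calc δ ≤ lobHeight (v x) := (h x).2
      _ = lobHeight (lobAct (g x) (v x)) * ‖lobFac (g x) (v x)‖ ^ 2 := h1.symm
      _ ≤ lobHeight (lobAct (g x) (v x)) * B ^ 2 := by gcongr; exact hn1 x

theorem integrable_uFun (m : Measure X) [IsProbabilityMeasure m] (g : CurrentGroup d X)
    {v : X → ℂ × (Fin d → ℂ)} (hv : v ∈ LobCurrents d X) :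
    Integrable (fun x => uFun .plus ((g : X → UGroup d) x) (v x)) m := by
  have h0 := basePt_mem_LobCurrents (d := d) (X := X)
  exact ((LobCurrents.integrable_cKer m (actX_mem g hv) (actX_mem g h0)).sub
    (LobCurrents.integrable_cKer m hv h0)).sub
    (((LobCurrents.integrable_cKer m (actX_mem g h0) (actX_mem g h0)).sub
      (LobCurrents.integrable_cKer m h0 h0)).const_mul _)

theorem actX_mul (g k : CurrentGroup d X) {v : X → ℂ × (Fin d → ℂ)} (hv : v ∈ LobCurrents d X) :
    actX ((g * k : CurrentGroup d X) : X → UGroup d) v =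
      actX (g : X → UGroup d) (actX (k : X → UGroup d) v) :=
  funext fun x => lobAct_mul _ _ (LobCurrents.mem_lob hv x)

theorem actX_one (v : X → ℂ × (Fin d → ℂ)) :
    actX ((1 : CurrentGroup d X) : X → UGroup d) v = v :=
  funext fun x => lobAct_one (v x)

end Currents

end Lobachevsky

/-! ### The tail of the Lévy measure and its inverse -/

section LevyTail

theorem integrableOn_levyDensity {r : ℝ} (hr : 0 < r) :
    IntegrableOn (fun s : ℝ => s⁻¹ * Real.exp (-s)) (Set.Ioi r) := by
  refine Integrable.mono' ((integrableOn_exp_neg_Ioi r).const_mul r⁻¹)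
    (by fun_prop) ?_
  refine (ae_restrict_iff' measurableSet_Ioi).2 (Eventually.of_forall fun s hs => ?_)
  have hs' : r < s := hs
  rw [norm_mul, Real.norm_of_nonneg (Real.exp_pos _).le, norm_inv,
    Real.norm_of_nonneg (hr.trans hs').le]
  gcongr

theorem levyTail_eq_add {r a : ℝ} (hr : 0 < r) (ha : 0 < a) :
    levyTail r = (∫ s in r..a, s⁻¹ * Real.exp (-s)) + levyTail a := by
  refine (intervalIntegral.integral_interval_add_Ioi' ?_ (integrableOn_levyDensity ha)).symm
  refine (ContinuousOn.intervalIntegrable fun s hs => ?_)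
  have : 0 < s := (lt_min hr ha).trans_le hs.1
  exact ContinuousAt.continuousWithinAt (by fun_prop (disch := exact this.ne'))

theorem hasStrictDerivAt_levyTail {r : ℝ} (hr : 0 < r) :
    HasStrictDerivAt levyTail (-(r⁻¹ * Real.exp (-r))) r := by
  have hc : ContinuousAt (fun s : ℝ => s⁻¹ * Real.exp (-s)) r := by
    fun_prop (disch := exact hr.ne')
  have h1 : HasStrictDerivAt (fun u => ∫ s in u..r, s⁻¹ * Real.exp (-s))
      (-(r⁻¹ * Real.exp (-r))) r := by
    refine intervalIntegral.integral_hasStrictDerivAt_left (by simp) ?_ hc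
    exact (by fun_prop : Measurable fun s : ℝ => s⁻¹ * Real.exp (-s))
      |>.stronglyMeasurable.stronglyMeasurableAtFilter
  refine (h1.add_const (levyTail r)).congr_of_eventuallyEq ?_
  filter_upwards [lt_mem_nhds hr] with u hu
  exact (levyTail_eq_add hu hr).symm

theorem levyTail_strictAnti : StrictAntiOn levyTail (Set.Ioi 0) := by
  refine strictAntiOn_of_deriv_neg (convex_Ioi 0)
    (fun r hr => (hasStrictDerivAt_levyTail hr).hasDerivAt.continuousAt.continuousWithinAt) fun r hr => ?_
  rw [interior_Ioi] at hr
  have hr' : 0 < r := hr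
  rw [(hasStrictDerivAt_levyTail hr).hasDerivAt.deriv]
  have := Real.exp_pos (-r)
  simp only [neg_lt_zero]
  positivity

theorem levyTail_le {r : ℝ} (hr : 1 ≤ r) : levyTail r ≤ Real.exp (-r) := by
  rw [← integral_exp_neg_Ioi]
  refine setIntegral_mono_on (integrableOn_levyDensity (one_pos.trans_le hr))
    (integrableOn_exp_neg_Ioi r) measurableSet_Ioi fun s hs => ?_
  have hs' : r < s := hs
  exact mul_le_of_le_one_left (Real.exp_pos _).le (inv_le_one_of_one_le₀ (hr.trans hs'.le))

theorem levyTail_nonneg (r : ℝ) (hr : 0 < r) : 0 ≤ levyTail r :=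
  setIntegral_nonneg measurableSet_Ioi fun s hs => by
    have : 0 < s := hr.trans hs
    positivity

theorem levyTail_pos {r : ℝ} (hr : 0 < r) : 0 < levyTail r :=
  (levyTail_nonneg (r + 1) (by linarith)).trans_lt
    (levyTail_strictAnti hr (show (0 : ℝ) < r + 1 by linarith) (by linarith))

theorem le_levyTail {r : ℝ} (hr : 0 < r) (h1 : r ≤ 1) :
    Real.exp (-1) * -Real.log r ≤ levyTail r := by
  rw [levyTail_eq_add hr one_pos]
  have h2 : ∫ s in r..1, s⁻¹ = -Real.log r := by
    rw [integral_inv_of_pos hr one_pos]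
    simp
  rw [← h2, ← intervalIntegral.integral_const_mul]
  have hpos : ∀ s ∈ Set.uIcc r 1, 0 < s := fun s hs => (lt_min hr one_pos).trans_le hs.1
  have h3 : ∫ s in r..1, Real.exp (-1) * s⁻¹ ≤ ∫ s in r..1, s⁻¹ * Real.exp (-s) := by
    refine intervalIntegral.integral_mono_on h1 ?_ ?_ fun s hs => ?_
    · exact ContinuousOn.intervalIntegrable fun s hs => ContinuousAt.continuousWithinAt
        (by fun_prop (disch := exact (hpos s hs).ne'))
    · exact ContinuousOn.intervalIntegrable fun s hs => ContinuousAt.continuousWithinAt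
        (by fun_prop (disch := exact (hpos s hs).ne'))
    · have : 0 < s := hr.trans_le hs.1
      rw [mul_comm]
      have := hs.2
      gcongr
  linarith [levyTail_nonneg 1 one_pos]

theorem exists_levyTail_eq {t : ℝ} (ht : 0 < t) : ∃ r, 0 < r ∧ levyTail r = t := by
  obtain ⟨b, hb1, hb⟩ : ∃ b, 1 ≤ b ∧ levyTail b < t := by
    have h1 : Tendsto (fun b : ℝ => Real.exp (-b)) atTop (𝓝 0) :=
      Real.tendsto_exp_neg_atTop_nhds_zero
    obtain ⟨b, h2, h3⟩ := ((h1.eventually_lt_const ht).and (eventually_ge_atTop 1)).exists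
    exact ⟨b, h3, (levyTail_le h3).trans_lt h2⟩
  -- the point where the lower bound `le_levyTail` is equal to `t`
  set a := Real.exp (-(t * Real.exp 1)) with ha
  have ha0 : 0 < a := Real.exp_pos _
  have ha1 : a ≤ 1 := Real.exp_le_one_iff.2 (by have := Real.exp_pos 1; nlinarith)
  have ha2 : t ≤ levyTail a := by
    have := le_levyTail ha0 ha1
    have h2 : Real.exp (-1) * -Real.log a = t := by
      rw [ha, Real.log_exp, neg_neg, mul_comm t, ← mul_assoc, ← Real.exp_add]
      simp
    rwa [h2] at this
  obtain ⟨r, hr, hrt⟩ := intermediate_value_Icc' (ha1.trans hb1) (f := levyTail)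
    (fun s hs => (hasStrictDerivAt_levyTail (ha0.trans_le hs.1)).hasDerivAt.continuousAt.continuousWithinAt)
    ⟨hb.le, ha2⟩
  exact ⟨r, ha0.trans_le hr.1, hrt⟩

theorem levyTailInv_levyTail {r : ℝ} (hr : 0 < r) : (levyTailInv (levyTail r) : ℝ) = r := by
  have h : {s : ℝ | 0 < s ∧ levyTail s ≤ levyTail r} = Set.Ici r := by
    ext s
    constructor
    · rintro ⟨h1, h2⟩
      exact (levyTail_strictAnti.le_iff_ge h1 hr).1 h2
    · intro h
      have hs : 0 < s := hr.trans_le h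
      exact ⟨hs, (levyTail_strictAnti.le_iff_ge hs hr).2 h⟩
  have h2 : sInf {s : ℝ | 0 < s ∧ levyTail s ≤ levyTail r} = r := by rw [h, csInf_Ici]
  rw [levyTailInv, dif_pos (by rw [h2]; exact hr)]
  exact h2

theorem levyTail_levyTailInv {t : ℝ} (ht : 0 < t) : levyTail (levyTailInv t) = t := by
  obtain ⟨r, hr, rfl⟩ := exists_levyTail_eq ht
  rw [levyTailInv_levyTail hr]

/-- For `t ≤ 0` the set in the definition of `levyTailInv` is empty, and its infimum is zero. -/
theorem levyTailInv_of_nonpos {t : ℝ} (ht : t ≤ 0) : levyTailInv t = 1 := by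
  have h : {s : ℝ | 0 < s ∧ levyTail s ≤ t} = ∅ := by
    ext s
    simp only [Set.mem_ofPred_eq, Set.mem_empty_iff_false, iff_false, not_and, not_le]
    intro hs
    exact ht.trans_lt (levyTail_pos hs)
  rw [levyTailInv, dif_neg]
  rw [h, Real.sInf_empty]
  exact lt_irrefl _

theorem levyTailInv_strictAnti {s t : ℝ} (hs : 0 < s) (hst : s < t) :
    levyTailInv t < levyTailInv s := by
  have ht := hs.trans hst
  refine (levyTail_strictAnti.lt_iff_gt (levyTailInv s).2 (levyTailInv t).2).1 ?_
  rwa [levyTail_levyTailInv hs, levyTail_levyTailInv ht]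

theorem hasDerivAt_levyTailInv {t : ℝ} (ht : 0 < t) :
    HasDerivAt (fun t => (levyTailInv t : ℝ))
      (-((levyTailInv t : ℝ)⁻¹ * Real.exp (-(levyTailInv t : ℝ))))⁻¹ t := by
  have h := hasStrictDerivAt_levyTail (levyTailInv t).2
  have hne : -((levyTailInv t : ℝ)⁻¹ * Real.exp (-(levyTailInv t : ℝ))) ≠ 0 := by
    have := (levyTailInv t).2
    have := Real.exp_pos (-(levyTailInv t : ℝ))
    simp only [ne_eq, neg_eq_zero]
    positivity
  have := h.to_local_left_inverse hne (g := fun t => (levyTailInv t : ℝ))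
    (by filter_upwards [lt_mem_nhds (levyTailInv t).2] with s hs using levyTailInv_levyTail hs)
  rw [levyTail_levyTailInv ht] at this
  exact this.hasDerivAt

theorem continuousOn_levyTailInv :
    ContinuousOn (fun t => (levyTailInv t : ℝ)) (Set.Ioi 0) :=
  fun _ ht => (hasDerivAt_levyTailInv ht).continuousAt.continuousWithinAt

theorem measurable_levyTailInv : Measurable levyTailInv := by
  refine Measurable.subtype_mk (f := fun t => (levyTailInv t : ℝ)) (h := fun t => (levyTailInv t).2) ?_
  have h : (fun t => (levyTailInv t : ℝ)) =
      (Set.Ioi (0 : ℝ)).piecewise (fun t => (levyTailInv t : ℝ)) fun _ => 1 := by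
    funext t
    by_cases ht : 0 < t
    · rw [Set.piecewise_eq_of_mem _ _ _ (show t ∈ Set.Ioi (0 : ℝ) from ht)]
    · rw [Set.piecewise_eq_of_notMem _ _ _ (show t ∉ Set.Ioi (0 : ℝ) from ht),
        levyTailInv_of_nonpos (not_lt.1 ht)]
      rfl
  rw [h]
  exact continuousOn_levyTailInv.measurable_piecewise continuousOn_const measurableSet_Ioi

theorem tendsto_levyTailInv_atTop : Tendsto (fun t => (levyTailInv t : ℝ)) atTop (𝓝[>] 0) := by
  refine tendsto_nhdsWithin_iff.2 ⟨?_, Eventually.of_forall fun t => (levyTailInv t).2⟩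
  refine tendsto_order.2 ⟨fun a ha => Eventually.of_forall fun t => ha.trans (levyTailInv t).2,
    fun a ha => ?_⟩
  filter_upwards [eventually_gt_atTop (levyTail a)] with t ht
  have := levyTailInv_strictAnti (levyTail_pos ha) ht
  rw [← levyTailInv_levyTail ha]
  exact this

theorem tendsto_levyTailInv_zero : Tendsto (fun t => (levyTailInv t : ℝ)) (𝓝[>] 0) atTop := by
  refine tendsto_atTop.2 fun b => ?_
  have hb : 0 < max b 1 := lt_max_of_lt_right one_pos
  filter_upwards [Ioo_mem_nhdsGT (levyTail_pos hb)] with t ht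
  have := levyTailInv_strictAnti ht.1 ht.2
  have h2 : max b 1 < (levyTailInv t : ℝ) := by
    rw [← levyTailInv_levyTail hb]
    exact this
  exact (le_max_left _ _).trans h2.le

end LevyTail

/-! ### Exponential variables and infinite products -/

section Product

open ProbabilityTheory

instance : IsProbabilityMeasure (expMeasure 1) := isProbabilityMeasure_expMeasure one_pos

theorem expMeasure_one_eq : expMeasure 1 =
    (volume.restrict (Set.Ioi 0)).withDensity fun t => ENNReal.ofReal (Real.exp (-t)) := by
  rw [← withDensity_indicator measurableSet_Ioi, expMeasure, gammaMeasure]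
  refine withDensity_congr_ae ?_
  have : ∀ᵐ t : ℝ, t ≠ 0 := by simp [ae_iff]
  filter_upwards [this] with t ht
  rcases lt_or_gt_of_ne ht with h | h
  · rw [gammaPDF_of_neg h, Set.indicator_of_notMem]
    exact not_lt.2 h.le
  · rw [gammaPDF_of_nonneg h.le, Set.indicator_of_mem (show t ∈ Set.Ioi (0 : ℝ) from h)]
    simp

theorem integral_expMeasure {F : Type*} [NormedAddCommGroup F] [NormedSpace ℝ F] (f : ℝ → F) :
    ∫ t, f t ∂expMeasure 1 = ∫ t in Set.Ioi 0, Real.exp (-t) • f t := by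
  rw [expMeasure_one_eq, integral_withDensity_eq_integral_toReal_smul (by fun_prop)
    (Eventually.of_forall fun t => ENNReal.ofReal_lt_top)]
  refine integral_congr_ae (Eventually.of_forall fun t => ?_)
  simp only [ENNReal.toReal_ofReal (Real.exp_pos _).le]

theorem expMeasure_pos : ∀ᵐ t ∂expMeasure 1, 0 < t := by
  rw [expMeasure_one_eq]
  exact (withDensity_absolutelyContinuous _ _).ae_le
    ((ae_restrict_iff' measurableSet_Ioi).2 (Eventually.of_forall fun t ht => ht))

instance : NullSingletonClass (expMeasure 1) := by
  rw [expMeasure_one_eq]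
  infer_instance

variable {α : Type*} [MeasurableSpace α]

theorem measurable_update_pair (N : ℕ) :
    Measurable fun p : (ℕ → α) × α => Function.update p.1 N p.2 := by
  refine measurable_pi_lambda _ fun i => ?_
  by_cases h : i = N
  · subst h; simpa using measurable_snd
  · simp only [Function.update_of_ne h]
    exact (measurable_pi_apply i).comp measurable_fst

/-- Resampling one coordinate of an independent sequence does not change its law. -/
theorem map_update_infinitePi (ν : Measure α) [IsProbabilityMeasure ν] (N : ℕ) :
    ((Measure.infinitePi fun _ : ℕ => ν).prod ν).map (fun p => Function.update p.1 N p.2) =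
      Measure.infinitePi fun _ : ℕ => ν := by
  refine Measure.eq_infinitePi _ fun s t ht => ?_
  classical
  rw [Measure.map_apply (measurable_update_pair N) (MeasurableSet.pi s.countable_toSet fun i _ => ht i)]
  have hset : (fun p : (ℕ → α) × α => Function.update p.1 N p.2) ⁻¹' Set.pi s t =
      (Set.pi (s.erase N : Finset ℕ) t) ×ˢ (if N ∈ s then t N else Set.univ) := by
    ext ⟨ω, y⟩
    simp only [Set.mem_preimage, Set.mem_pi, Set.mem_prod, Finset.mem_coe, Finset.mem_erase]
    constructor
    · intro h
      refine ⟨fun i hi => by simpa [Function.update_of_ne hi.1] using h i hi.2, ?_⟩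
      split_ifs with hN
      · simpa using h N hN
      · trivial
    · rintro ⟨h1, h2⟩ i hi
      by_cases hiN : i = N
      · subst hiN
        rw [if_pos hi] at h2
        simpa using h2
      · simpa [Function.update_of_ne hiN] using h1 i ⟨hiN, hi⟩
  rw [hset, Measure.prod_prod, Measure.infinitePi_pi _ fun i _ => ht i]
  split_ifs with hN
  · rw [Finset.prod_erase_mul _ _ hN]
  · rw [Finset.erase_eq_of_notMem hN, measure_univ, mul_one]

end Product

/-! ### Multiplicative functionals of the gamma process -/

section Martingale

open ProbabilityTheory

variable {𝕜 : Type*} [RCLike 𝕜] {X : Type*} [MeasurableSpace X]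

/-- Functions `φ(r, x)` for which the product `∏ φ(r_k, x_k)` over the atoms of the gamma process
converges and is integrable. -/
structure IsMult (φ : ℝ → X → 𝕜) (B K : ℝ) : Prop where
  meas : Measurable fun p : ℝ × X => φ p.1 p.2
  cont : ∀ x, ContinuousOn (fun r => φ r x) (Set.Ioi 0)
  bound : ∀ r, 0 < r → ∀ x, ‖φ r x‖ ≤ B
  near : ∀ r, 0 < r → ∀ x, ‖φ r x - 1‖ ≤ K * r

/-- The mean `∫ φ(r, x) dm(x)`. -/
def multMean (m : Measure X) (φ : ℝ → X → 𝕜) (r : ℝ) : 𝕜 := ∫ x, φ r x ∂m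

/-- The density `(φ(r) - 1) r⁻¹ e^{-r}` of the exponent in Campbell's formula. -/
def multDensity (m : Measure X) (φ : ℝ → X → 𝕜) (r : ℝ) : 𝕜 :=
  (r⁻¹ * Real.exp (-r)) • (multMean m φ r - 1)

/-- The expectation of the product over those atoms which arrive after the time `t`; their weights
are less than `levyTailInv t`, or arbitrary if `t ≤ 0`. -/
def multTail (m : Measure X) (φ : ℝ → X → 𝕜) (t : ℝ) : 𝕜 :=
  NormedSpace.exp (if t ≤ 0 then ∫ r in Set.Ioi 0, multDensity m φ r
    else ∫ r in (0 : ℝ)..levyTailInv t, multDensity m φ r)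

variable {m : Measure X} [IsProbabilityMeasure m] {φ : ℝ → X → 𝕜} {B K : ℝ}

namespace IsMult

theorem meas_section (h : IsMult φ B K) (r : ℝ) : Measurable (φ r) :=
  h.meas.comp (measurable_const.prodMk measurable_id)

theorem integrable_section (h : IsMult φ B K) {r : ℝ} (hr : 0 < r) : Integrable (φ r) m :=
  Integrable.of_bound (h.meas_section r).aestronglyMeasurable B
    (Eventually.of_forall fun x => h.bound r hr x)

theorem norm_mean_le (h : IsMult φ B K) {r : ℝ} (hr : 0 < r) : ‖multMean m φ r‖ ≤ B := by
  simpa [multMean] using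
    norm_integral_le_of_norm_le_const (μ := m) (Eventually.of_forall (h.bound r hr))

theorem norm_mean_sub_one_le (h : IsMult φ B K) {r : ℝ} (hr : 0 < r) :
    ‖multMean m φ r - 1‖ ≤ K * r := by
  have h1 : multMean m φ r - 1 = ∫ x, (φ r x - 1) ∂m := by
    rw [integral_sub (h.integrable_section hr) (integrable_const _)]
    simp [multMean]
  rw [h1]
  simpa using norm_integral_le_of_norm_le_const (μ := m) (Eventually.of_forall (h.near r hr))

theorem continuousOn_mean (h : IsMult φ B K) : ContinuousOn (multMean m φ) (Set.Ioi 0) :=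
  continuousOn_of_dominated (bound := fun _ => B)
    (fun r _ => (h.meas_section r).aestronglyMeasurable)
    (fun r hr => Eventually.of_forall (h.bound r hr)) (integrable_const _)
    (Eventually.of_forall h.cont)

theorem continuousOn_density (h : IsMult φ B K) : ContinuousOn (multDensity m φ) (Set.Ioi 0) := by
  refine ContinuousOn.smul (fun r hr => ContinuousAt.continuousWithinAt ?_)
    (h.continuousOn_mean.sub continuousOn_const)
  have : r ≠ 0 := ne_of_gt hr
  fun_prop (disch := exact this)

theorem norm_density_le (h : IsMult φ B K) {r : ℝ} (hr : 0 < r) :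
    ‖multDensity m φ r‖ ≤ K * Real.exp (-r) := by
  rw [multDensity, norm_smul, norm_mul, norm_inv, Real.norm_of_nonneg hr.le,
    Real.norm_of_nonneg (Real.exp_pos _).le]
  calc _ ≤ r⁻¹ * Real.exp (-r) * (K * r) := by gcongr; exact h.norm_mean_sub_one_le hr
    _ = K * Real.exp (-r) := by field_simp

theorem integrableOn_density (h : IsMult φ B K) : IntegrableOn (multDensity m φ) (Set.Ioi 0) := by
  refine Integrable.mono' ((integrableOn_exp_neg_Ioi 0).const_mul K)
    (h.continuousOn_density.aestronglyMeasurable measurableSet_Ioi) ?_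
  exact (ae_restrict_iff' measurableSet_Ioi).2 (Eventually.of_forall fun r hr =>
    h.norm_density_le hr)

theorem intervalIntegrable_density (h : IsMult φ B K) {r : ℝ} (hr : 0 ≤ r) :
    IntervalIntegrable (multDensity m φ) volume 0 r :=
  (intervalIntegrable_iff_integrableOn_Ioc_of_le hr).2
    (h.integrableOn_density.mono_set Set.Ioc_subset_Ioi_self)

theorem norm_exponent_le (h : IsMult φ B K) (t : ℝ) :
    ‖(if t ≤ 0 then ∫ r in Set.Ioi 0, multDensity m φ r
    else ∫ r in (0 : ℝ)..levyTailInv t, multDensity m φ r)‖ ≤ |K| := by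
  have h1 : ∀ S ⊆ Set.Ioi (0 : ℝ), MeasurableSet S → ‖∫ r in S, multDensity m φ r‖ ≤ |K| := by
    intro S hS hSm
    calc ‖∫ r in S, multDensity m φ r‖ ≤ ∫ r in S, |K| * Real.exp (-r) := by
          refine norm_integral_le_of_norm_le
            (((integrableOn_exp_neg_Ioi 0).mono_set hS).const_mul _) ?_
          refine (ae_restrict_iff' hSm).2 (Eventually.of_forall fun r hr => ?_)
          exact (h.norm_density_le (hS hr)).trans (by gcongr; exact le_abs_self K)
      _ ≤ ∫ r in Set.Ioi 0, |K| * Real.exp (-r) :=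
          setIntegral_mono_set ((integrableOn_exp_neg_Ioi 0).const_mul _)
            (Eventually.of_forall fun r => by positivity) (LE.le.eventuallyLE hS)
      _ = |K| := by rw [integral_const_mul, integral_exp_neg_Ioi_zero, mul_one]
  split_ifs with ht
  · exact h1 _ subset_rfl measurableSet_Ioi
  · rw [intervalIntegral.integral_of_le (levyTailInv t).2.le]
    exact h1 _ Set.Ioc_subset_Ioi_self measurableSet_Ioc

variable (m) in
theorem exists_tail_bound (h : IsMult φ B K) : ∃ C, ∀ t, ‖multTail m φ t‖ ≤ C := by
  obtain ⟨C, hC⟩ := (isCompact_closedBall (0 : 𝕜) |K|).exists_bound_of_continuousOn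
    (NormedSpace.exp_continuous (𝔸 := 𝕜)).continuousOn
  exact ⟨C, fun t => hC _ (by simpa using h.norm_exponent_le t)⟩

theorem hasDerivAt_tail (h : IsMult φ B K) {t : ℝ} (ht : 0 < t) :
    HasDerivAt (multTail m φ) (-(multMean m φ (levyTailInv t) - 1) * multTail m φ t) t := by
  have hR := (levyTailInv t).2
  have h1 : HasDerivAt (fun r => ∫ q in (0 : ℝ)..r, multDensity m φ q)
      (multDensity m φ (levyTailInv t)) (levyTailInv t) :=
    intervalIntegral.integral_hasDerivAt_right (h.intervalIntegrable_density hR.le)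
      (h.continuousOn_density.stronglyMeasurableAtFilter isOpen_Ioi _ hR)
      (h.continuousOn_density.continuousAt (Ioi_mem_nhds hR))
  have h2 := h1.scomp t (hasDerivAt_levyTailInv ht)
  have h3 := HasDerivAt.comp t (hasDerivAt_exp (𝕂 := 𝕜)) h2
  have h4 : multTail m φ =ᶠ[𝓝 t] fun t =>
      NormedSpace.exp (∫ q in (0 : ℝ)..levyTailInv t, multDensity m φ q) := by
    filter_upwards [lt_mem_nhds ht] with s hs
    rw [multTail, if_neg (not_le.2 hs)]
  refine (h3.congr_of_eventuallyEq h4).congr_deriv ?_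
  rw [h4.eq_of_nhds, mul_comm]
  congr 1
  have := Real.exp_pos (-(levyTailInv t : ℝ))
  rw [multDensity, smul_smul, inv_neg, neg_mul, inv_mul_cancel₀ (by positivity), neg_smul, one_smul]

theorem continuousWithinAt_tail_zero (h : IsMult φ B K) :
    ContinuousWithinAt (multTail m φ) (Set.Ici 0) 0 := by
  rw [← continuousWithinAt_Ioi_iff_Ici]
  have h1 := intervalIntegral_tendsto_integral_Ioi 0 (h.integrableOn_density (m := m))
    tendsto_levyTailInv_zero
  have h2 := ((NormedSpace.exp_continuous (𝔸 := 𝕜)).tendsto _).comp h1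
  unfold ContinuousWithinAt
  have h0 : multTail m φ 0 = NormedSpace.exp (∫ r in Set.Ioi 0, multDensity m φ r) := by
    rw [multTail, if_pos le_rfl]
  rw [h0]
  refine h2.congr' ?_
  filter_upwards [self_mem_nhdsWithin] with s hs
  rw [multTail, if_neg (not_le.2 hs)]
  rfl

theorem tendsto_tail (h : IsMult φ B K) : Tendsto (multTail m φ) atTop (𝓝 1) := by
  have h1 : Tendsto (fun r : ℝ => ∫ q in (0 : ℝ)..r, multDensity m φ q) (𝓝[>] 0) (𝓝 0) := by
    refine squeeze_zero_norm' (a := fun r => |K| * r) ?_ ?_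
    · filter_upwards [self_mem_nhdsWithin] with r hr
      have hr' : 0 < r := hr
      have := intervalIntegral.norm_integral_le_of_norm_le_const (a := 0) (b := r)
        (f := multDensity m φ) (C := |K|) fun q hq => by
          rw [Set.uIoc_of_le hr'.le] at hq
          refine (h.norm_density_le hq.1).trans ((mul_le_mul_of_nonneg_right (le_abs_self K)
            (Real.exp_pos _).le).trans (mul_le_of_le_one_right (abs_nonneg _) ?_))
          exact Real.exp_le_one_iff.2 (by linarith [hq.1])
      simpa [abs_of_pos hr'] using this
    · have : Tendsto (fun r : ℝ => |K| * r) (𝓝 0) (𝓝 (|K| * 0)) :=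
        (continuous_const_mul _).tendsto 0
      rw [mul_zero] at this
      exact this.mono_left nhdsWithin_le_nhds
  have h2 := ((NormedSpace.exp_continuous (𝔸 := 𝕜)).tendsto _).comp
    (h1.comp tendsto_levyTailInv_atTop)
  rw [NormedSpace.exp_zero] at h2
  refine h2.congr' ?_
  filter_upwards [eventually_gt_atTop 0] with s hs
  rw [multTail, if_neg (not_le.2 hs)]
  rfl

theorem measurable_tail (h : IsMult φ B K) : Measurable (multTail m φ) := by
  have h1 : multTail m φ = (Set.Ioi (0 : ℝ)).piecewise (multTail m φ)
      fun _ => multTail m φ 0 := by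
    funext t
    by_cases ht : 0 < t
    · rw [Set.piecewise_eq_of_mem _ _ _ (show t ∈ Set.Ioi (0 : ℝ) from ht)]
    · rw [Set.piecewise_eq_of_notMem _ _ _ (show t ∉ Set.Ioi (0 : ℝ) from ht), multTail, multTail,
        if_pos (not_lt.1 ht), if_pos le_rfl]
  rw [h1]
  exact ContinuousOn.measurable_piecewise
    (fun t ht => (h.hasDerivAt_tail ht).continuousAt.continuousWithinAt)
    continuousOn_const measurableSet_Ioi

/-- The renewal equation for the tail: condition on the first arrival after the time `s`. -/
theorem renewal (h : IsMult φ B K) {s : ℝ} (hs : 0 ≤ s) :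
    ∫ t in Set.Ioi (0 : ℝ), Real.exp (-t) •
      (multMean m φ (levyTailInv (s + t)) * multTail m φ (s + t)) = multTail m φ s := by
  obtain ⟨C, hC⟩ := h.exists_tail_bound m
  have hpos : ∀ t ∈ Set.Ioi (0 : ℝ), 0 < s + t := fun t ht => by
    have : 0 < t := ht
    linarith
  -- the integrand is the derivative of `-e^{-t} multTail (s + t)`
  have hder : ∀ t ∈ Set.Ioi (0 : ℝ), HasDerivAt (fun t => -(Real.exp (-t) • multTail m φ (s + t)))
      (Real.exp (-t) • (multMean m φ (levyTailInv (s + t)) * multTail m φ (s + t))) t := by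
    intro t ht
    have h1 := (h.hasDerivAt_tail (m := m) (hpos t ht)).comp_const_add s t
    have h2 := ((hasDerivAt_neg t).exp.smul h1).neg
    refine h2.congr_deriv ?_
    simp only [RCLike.real_smul_eq_coe_mul]
    push_cast
    ring
  have hcont : ContinuousWithinAt (fun t => -(Real.exp (-t) • multTail m φ (s + t)))
      (Set.Ici 0) 0 := by
    refine ContinuousWithinAt.neg (ContinuousWithinAt.smul (by fun_prop) ?_)
    have h3 : ContinuousWithinAt (multTail m φ) (Set.Ici s) (s + 0) := by
      rw [add_zero]
      rcases hs.eq_or_lt with rfl | hs'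
      · exact h.continuousWithinAt_tail_zero
      · exact (h.hasDerivAt_tail hs').continuousAt.continuousWithinAt
    refine h3.comp (f := fun t => s + t) (by fun_prop) fun t ht => ?_
    have : 0 ≤ t := ht
    change s ≤ s + t
    linarith
  have hlim : Tendsto (fun t => -(Real.exp (-t) • multTail m φ (s + t))) atTop (𝓝 0) := by
    have h4 := (Real.tendsto_exp_neg_atTop_nhds_zero.smul
      ((h.tendsto_tail (m := m)).comp (tendsto_atTop_add_const_left atTop s tendsto_id))).neg
    simpa using h4
  have hint : IntegrableOn (fun t => Real.exp (-t) •
      (multMean m φ (levyTailInv (s + t)) * multTail m φ (s + t))) (Set.Ioi 0) := by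
    refine Integrable.mono' ((integrableOn_exp_neg_Ioi 0).const_mul (B * C)) ?_ ?_
    · refine ContinuousOn.aestronglyMeasurable (fun t ht => ?_) measurableSet_Ioi
      have h5 : ContinuousAt (fun t => multTail m φ (s + t)) t :=
        ((h.hasDerivAt_tail (m := m) (hpos t ht)).comp_const_add s t).continuousAt
      have h6 : ContinuousAt (fun t => (levyTailInv (s + t) : ℝ)) t :=
        ((hasDerivAt_levyTailInv (hpos t ht)).comp_const_add s t).continuousAt
      have h7 : ContinuousAt (multMean m φ) (levyTailInv (s + t) : ℝ) :=
        h.continuousOn_mean.continuousAt (Ioi_mem_nhds (levyTailInv (s + t)).2)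
      have h8 : ContinuousAt (fun t => multMean m φ (levyTailInv (s + t))) t :=
        ContinuousAt.comp (f := fun t => (levyTailInv (s + t) : ℝ)) h7 h6
      exact (ContinuousAt.smul (by fun_prop) (h8.mul h5)).continuousWithinAt
    · refine (ae_restrict_iff' measurableSet_Ioi).2 (Eventually.of_forall fun t ht => ?_)
      rw [norm_smul, Real.norm_of_nonneg (Real.exp_pos _).le, norm_mul, mul_comm]
      have h9 := h.norm_mean_le (m := m) (levyTailInv (s + t)).2
      have h10 := (norm_nonneg _).trans h9
      gcongr
      exact hC _
  rw [integral_Ioi_of_hasDerivAt_of_tendsto hcont hder hint hlim]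
  simp

end IsMult

end Martingale

/-! ### Campbell's formula -/

section Campbell

open ProbabilityTheory

variable {𝕜 : Type*} [RCLike 𝕜] {X : Type*} [MeasurableSpace X]

/-- The law of the sequences of waiting times and marks. -/
abbrev seqLaw (m : Measure X) : Measure (ℕ → ℝ × X) :=
  Measure.infinitePi fun _ : ℕ => (expMeasure 1).prod m

/-- The sum of the first `N` waiting times. -/
def arrival (ω : ℕ → ℝ × X) (N : ℕ) : ℝ := ∑ j ∈ Finset.range N, (ω j).1

theorem arrival_succ (ω : ℕ → ℝ × X) (N : ℕ) : arrival ω (N + 1) = arrival ω N + (ω N).1 :=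
  Finset.sum_range_succ _ _

@[fun_prop]
theorem measurable_arrival (N : ℕ) : Measurable fun ω : ℕ → ℝ × X => arrival ω N :=
  Finset.measurable_sum _ fun j _ => measurable_fst.comp (measurable_pi_apply j)

theorem measurable_gammaConfig : Measurable (gammaConfig (X := X)) :=
  measurable_pi_lambda _ fun k => (measurable_levyTailInv.comp (measurable_arrival (k + 1))).prodMk
    (measurable_snd.comp (measurable_pi_apply k))

theorem arrival_update {ω : ℕ → ℝ × X} {N k : ℕ} (h : k ≤ N) (y : ℝ × X) :
    arrival (Function.update ω N y) k = arrival ω k :=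
  Finset.sum_congr rfl fun j hj => by
    rw [Function.update_of_ne ((Finset.mem_range.1 hj).trans_le h).ne]

variable (m : Measure X) [IsProbabilityMeasure m]

/-- The integral over sequences can be computed by first integrating over the coordinate `N`. -/
theorem lintegral_seqLaw_update (N : ℕ) {f : (ℕ → ℝ × X) → ℝ≥0∞} (hf : Measurable f) :
    ∫⁻ ω, f ω ∂seqLaw m =
      ∫⁻ ω, ∫⁻ y, f (Function.update ω N y) ∂((expMeasure 1).prod m) ∂seqLaw m := by
  conv_lhs => rw [seqLaw, ← map_update_infinitePi _ N]
  rw [lintegral_map hf (measurable_update_pair N)]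
  exact lintegral_prod _ (hf.comp (measurable_update_pair N)).aemeasurable

theorem integral_seqLaw_update (N : ℕ) {f : (ℕ → ℝ × X) → 𝕜} (hf : Measurable f)
    (hi : Integrable f (seqLaw m)) :
    ∫ ω, f ω ∂seqLaw m =
      ∫ ω, ∫ y, f (Function.update ω N y) ∂((expMeasure 1).prod m) ∂seqLaw m := by
  have h1 := map_update_infinitePi ((expMeasure 1).prod m) N
  conv_lhs => rw [seqLaw, ← h1]
  rw [integral_map (measurable_update_pair N).aemeasurable hf.aestronglyMeasurable]
  refine integral_prod (fun p : (ℕ → ℝ × X) × (ℝ × X) => f (Function.update p.1 N p.2)) ?_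
  rw [seqLaw, ← h1] at hi
  exact (integrable_map_measure hf.aestronglyMeasurable
    (measurable_update_pair N).aemeasurable).1 hi

theorem ae_seqLaw_of_update (N : ℕ) {p : (ℕ → ℝ × X) → Prop} (hp : MeasurableSet {ω | p ω})
    (h : ∀ᵐ ω ∂seqLaw m, ∀ᵐ y ∂((expMeasure 1).prod m), p (Function.update ω N y)) :
    ∀ᵐ ω ∂seqLaw m, p ω := by
  have h1 := map_update_infinitePi ((expMeasure 1).prod m) N
  rw [seqLaw, ← h1, ae_map_iff (measurable_update_pair N).aemeasurable hp]
  exact (Measure.ae_prod_iff_ae_ae (hp.preimage (measurable_update_pair N))).2 h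

theorem ae_waiting_pos : ∀ᵐ ω ∂seqLaw m, ∀ k, 0 < (ω k).1 := by
  refine ae_all_iff.2 fun k => ?_
  have h1 := (measurePreserving_eval_infinitePi
    (fun _ : ℕ => (expMeasure 1).prod m) k).quasiMeasurePreserving
  have h2 : ∀ᵐ y ∂((expMeasure 1).prod m), 0 < y.1 :=
    Measure.quasiMeasurePreserving_fst.ae expMeasure_pos
  exact h1.ae h2

theorem arrival_nonneg {ω : ℕ → ℝ × X} (h : ∀ k, 0 < (ω k).1) (N : ℕ) : 0 ≤ arrival ω N :=
  Finset.sum_nonneg fun j _ => (h j).le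

theorem arrival_strictMono {ω : ℕ → ℝ × X} (h : ∀ k, 0 < (ω k).1) : StrictMono (arrival ω) :=
  strictMono_nat_of_lt_succ fun k => by rw [arrival_succ]; linarith [h k]

theorem arrival_succ_pos {ω : ℕ → ℝ × X} (h : ∀ k, 0 < (ω k).1) (k : ℕ) :
    0 < arrival ω (k + 1) := by
  simpa [arrival] using arrival_strictMono h (Nat.succ_pos k)

/-- The arrival times tend to infinity. -/
theorem ae_arrival_tendsto : ∀ᵐ ω ∂seqLaw m, Tendsto (arrival ω) atTop atTop := by
  -- the expectations of `exp(-(e_0 + ⋯ + e_{N-1}))` are `2^{-N}`, so their sum is finite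
  have hE : ∫⁻ t, ENNReal.ofReal (Real.exp (-t)) ∂expMeasure 1 = 2⁻¹ := by
    rw [← ofReal_integral_eq_lintegral_ofReal _ (Eventually.of_forall fun t => (Real.exp_pos _).le)]
    · rw [integral_expMeasure]
      have h1 : ∀ t : ℝ, Real.exp (-t) • Real.exp (-t) = Real.exp (-2 * t) := fun t => by
        rw [smul_eq_mul, ← Real.exp_add]; ring_nf
      simp_rw [h1]
      rw [integral_exp_mul_Ioi (by norm_num)]
      simp
    · refine Integrable.of_bound (by fun_prop) 1 ?_
      filter_upwards [expMeasure_pos] with t ht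
      rw [Real.norm_of_nonneg (Real.exp_pos _).le]
      exact Real.exp_le_one_iff.2 (by linarith)
  have hI : ∀ N, ∫⁻ ω, ENNReal.ofReal (Real.exp (-arrival ω N)) ∂seqLaw m = 2⁻¹ ^ N := by
    intro N
    induction N with
    | zero => simp [arrival]
    | succ N ih =>
      rw [lintegral_seqLaw_update m N (by fun_prop)]
      have h2 : ∀ ω : ℕ → ℝ × X, ∀ y : ℝ × X,
          ENNReal.ofReal (Real.exp (-arrival (Function.update ω N y) (N + 1))) =
          ENNReal.ofReal (Real.exp (-arrival ω N)) * ENNReal.ofReal (Real.exp (-y.1)) := by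
        intro ω y
        rw [arrival_succ, arrival_update le_rfl, Function.update_self, neg_add, Real.exp_add,
          ENNReal.ofReal_mul (Real.exp_pos _).le]
      simp_rw [h2]
      have h3 : ∫⁻ y, ENNReal.ofReal (Real.exp (-y.1)) ∂((expMeasure 1).prod m) = 2⁻¹ := by
        rw [lintegral_prod _ (by fun_prop)]
        simp [hE]
      have h4 : ∀ ω : ℕ → ℝ × X, ∫⁻ y, ENNReal.ofReal (Real.exp (-arrival ω N)) *
          ENNReal.ofReal (Real.exp (-y.1)) ∂((expMeasure 1).prod m) =
          ENNReal.ofReal (Real.exp (-arrival ω N)) * 2⁻¹ := by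
        intro ω
        rw [lintegral_const_mul _ (by fun_prop), h3]
      simp_rw [h4]
      rw [lintegral_mul_const _ (by fun_prop), ih, pow_succ]
  have hS : ∫⁻ ω, ∑' N, ENNReal.ofReal (Real.exp (-arrival ω N)) ∂seqLaw m ≠ ∞ := by
    rw [lintegral_tsum fun N => by fun_prop]
    simp_rw [hI]
    rw [ENNReal.tsum_geometric]
    simp
  have h5 := ae_lt_top' (by fun_prop) hS
  filter_upwards [h5] with ω hω
  have h6 := ENNReal.tendsto_atTop_zero_of_tsum_ne_top hω.ne
  have h7 : Tendsto (fun N => Real.exp (-arrival ω N)) atTop (𝓝 0) := by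
    have := (ENNReal.tendsto_toReal ENNReal.zero_ne_top).comp h6
    simpa [Function.comp_def, ENNReal.toReal_ofReal (Real.exp_pos _).le] using this
  have h8 := (Real.tendsto_exp_comp_nhds_zero).1 h7
  simpa [Function.comp_def] using tendsto_neg_atBot_atTop.comp h8

variable {m} {φ : ℝ → X → 𝕜} {B K : ℝ}

/-- The product of `φ` over the first `N` atoms. -/
def multPart (φ : ℝ → X → 𝕜) (ω : ℕ → ℝ × X) (N : ℕ) : 𝕜 :=
  ∏ k ∈ Finset.range N, φ (levyTailInv (arrival ω (k + 1))) (ω k).2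

theorem multPart_update {ω : ℕ → ℝ × X} (N : ℕ) (y : ℝ × X) :
    multPart φ (Function.update ω N y) N = multPart φ ω N :=
  Finset.prod_congr rfl fun k hk => by
    have hk' := Finset.mem_range.1 hk
    rw [arrival_update hk', Function.update_of_ne hk'.ne]

namespace IsMult

theorem measurable_part (h : IsMult φ B K) (N : ℕ) :
    Measurable fun ω : ℕ → ℝ × X => multPart φ ω N :=
  Finset.measurable_prod _ fun k _ => h.meas.comp
    ((measurable_subtype_coe.comp (measurable_levyTailInv.comp (measurable_arrival (k + 1)))).prodMk
      (measurable_snd.comp (measurable_pi_apply k)))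

theorem norm_part_le (h : IsMult φ B K) (ω : ℕ → ℝ × X) (N : ℕ) : ‖multPart φ ω N‖ ≤ B ^ N := by
  rw [multPart, norm_prod]
  refine (Finset.prod_le_prod (fun _ _ => norm_nonneg _)
    fun k _ => h.bound _ (levyTailInv _).2 _).trans ?_
  simp

theorem integrable_mart (h : IsMult φ B K) (N : ℕ) :
    Integrable (fun ω => multPart φ ω N * multTail m φ (arrival ω N)) (seqLaw m) := by
  obtain ⟨C, hC⟩ := h.exists_tail_bound m
  refine Integrable.of_bound ((h.measurable_part N).mul
    (h.measurable_tail.comp (measurable_arrival N))).aestronglyMeasurable (B ^ N * C)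
    (Eventually.of_forall fun ω => ?_)
  rw [norm_mul]
  exact mul_le_mul (h.norm_part_le ω N) (hC _) (norm_nonneg _)
    ((norm_nonneg _).trans (h.norm_part_le ω N))

/-- The products `φ(r_0, x_0) ⋯ φ(r_{N-1}, x_{N-1})`, completed by the expectation of the remaining
factors, have constant expectation. -/
theorem integral_mart (h : IsMult φ B K) (N : ℕ) :
    ∫ ω, multPart φ ω N * multTail m φ (arrival ω N) ∂seqLaw m = multTail m φ 0 := by
  induction N with
  | zero => simp [multPart, arrival]
  | succ N ih =>
    refine (integral_seqLaw_update m N ((h.measurable_part (N + 1)).mul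
      (h.measurable_tail.comp (measurable_arrival (N + 1)))) (h.integrable_mart (N + 1))).trans ?_
    rw [← ih]
    refine integral_congr_ae ?_
    filter_upwards [ae_waiting_pos m] with ω hω
    have h1 : ∀ y : ℝ × X, multPart φ (Function.update ω N y) (N + 1) *
        multTail m φ (arrival (Function.update ω N y) (N + 1)) =
        multPart φ ω N * (φ (levyTailInv (arrival ω N + y.1)) y.2 *
          multTail m φ (arrival ω N + y.1)) := by
      intro y
      have h2 : arrival (Function.update ω N y) (N + 1) = arrival ω N + y.1 := by
        rw [arrival_succ, arrival_update le_rfl, Function.update_self]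
      rw [multPart, Finset.prod_range_succ, h2, Function.update_self, mul_assoc]
      congr 1
      exact multPart_update N y
    refine (integral_congr_ae (Eventually.of_forall h1)).trans ?_
    rw [integral_const_mul]
    congr 1
    obtain ⟨C, hC⟩ := h.exists_tail_bound m
    have hint : Integrable (fun y : ℝ × X => φ (levyTailInv (arrival ω N + y.1)) y.2 *
        multTail m φ (arrival ω N + y.1)) ((expMeasure 1).prod m) := by
      refine Integrable.of_bound (Measurable.aestronglyMeasurable ?_) (B * C)
        (Eventually.of_forall fun y => ?_)
      · have h3 : Measurable fun y : ℝ × X => ((levyTailInv (arrival ω N + y.1) : ℝ), y.2) :=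
          (measurable_subtype_coe.comp (measurable_levyTailInv.comp (by fun_prop))).prodMk
            measurable_snd
        exact (h.meas.comp h3).mul (h.measurable_tail.comp (by fun_prop))
      · rw [norm_mul]
        have h3 := h.bound _ (levyTailInv (arrival ω N + y.1)).2 y.2
        exact mul_le_mul h3 (hC _) (norm_nonneg _) ((norm_nonneg _).trans h3)
    rw [integral_prod _ hint, integral_expMeasure, ← h.renewal (arrival_nonneg hω N)]
    refine integral_congr_ae (Eventually.of_forall fun t => ?_)
    simp only []
    rw [integral_mul_const]
    rfl

end IsMult

/-- For `φ ≥ 1` the partial products stay bounded, as their expectations do. -/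
theorem IsMult.ae_bounded_of_one_le {φ : ℝ → X → ℝ} (h : IsMult φ B K)
    (h1 : ∀ r, 0 < r → ∀ x, 1 ≤ φ r x) :
    ∃ W : (ℕ → ℝ × X) → ℝ, Integrable W (seqLaw m) ∧
      ∀ᵐ ω ∂seqLaw m, ∀ N, multPart φ ω N ≤ W ω := by
  have hden : ∀ r, 0 < r → 0 ≤ multDensity m φ r := by
    intro r hr
    refine smul_nonneg (by positivity) (sub_nonneg.2 ?_)
    have := integral_mono (μ := m) (integrable_const (1 : ℝ)) (h.integrable_section hr) (h1 r hr)
    simpa [multMean] using this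
  have htail : ∀ t, 1 ≤ multTail m φ t := by
    intro t
    rw [multTail, ← Real.exp_eq_exp_ℝ]
    refine Real.one_le_exp ?_
    split_ifs with ht
    · exact setIntegral_nonneg measurableSet_Ioi hden
    · refine intervalIntegral.integral_nonneg_of_ae_restrict (levyTailInv t).2.le ?_
      refine (ae_restrict_iff' measurableSet_Icc).2 ?_
      have : ∀ᵐ r : ℝ, r ≠ 0 := by simp [ae_iff]
      filter_upwards [this] with r hr hr2
      exact hden r (lt_of_le_of_ne hr2.1 hr.symm)
  have hfac : ∀ ω : ℕ → ℝ × X, ∀ k, 1 ≤ φ (levyTailInv (arrival ω (k + 1))) (ω k).2 :=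
    fun ω k => h1 _ (levyTailInv _).2 _
  have hpart : ∀ ω N, 1 ≤ multPart φ ω N := fun ω N =>
    Finset.one_le_prod fun k _ => hfac ω k
  have hmono : ∀ ω, Monotone (multPart φ ω) := by
    intro ω
    refine monotone_nat_of_le_succ fun N => ?_
    rw [multPart, multPart, Finset.prod_range_succ]
    exact le_mul_of_one_le_right (zero_le_one.trans (hpart ω N)) (hfac ω N)
  have hbd : ∀ N, ∫⁻ ω, ENNReal.ofReal (multPart φ ω N) ∂seqLaw m ≤
      ENNReal.ofReal (multTail m φ 0) := by
    intro N
    rw [← h.integral_mart N, ofReal_integral_eq_lintegral_ofReal (h.integrable_mart N)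
      (Eventually.of_forall fun ω => mul_nonneg (zero_le_one.trans (hpart ω N))
        (zero_le_one.trans (htail _)))]
    refine lintegral_mono fun ω => ENNReal.ofReal_le_ofReal ?_
    exact le_mul_of_one_le_right (zero_le_one.trans (hpart ω N)) (htail _)
  have hm : ∀ N, Measurable fun ω : ℕ → ℝ × X => ENNReal.ofReal (multPart φ ω N) := fun N =>
    ENNReal.measurable_ofReal.comp (h.measurable_part N)
  have hsup : ∫⁻ ω, ⨆ N, ENNReal.ofReal (multPart φ ω N) ∂seqLaw m ≠ ∞ := by
    rw [lintegral_iSup hm fun N M hNM ω => ENNReal.ofReal_le_ofReal (hmono ω hNM)]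
    exact ((iSup_le hbd).trans_lt ENNReal.ofReal_lt_top).ne
  refine ⟨fun ω => (⨆ N, ENNReal.ofReal (multPart φ ω N)).toReal,
    integrable_toReal_of_lintegral_ne_top (Measurable.iSup hm).aemeasurable hsup, ?_⟩
  filter_upwards [ae_lt_top (Measurable.iSup hm) hsup] with ω hω N
  refine (ENNReal.ofReal_le_iff_le_toReal hω.ne).1 ?_
  exact le_iSup (fun N => ENNReal.ofReal (multPart φ ω N)) N

/-- Campbell's formula: the expectation of `∏ φ(r_k, x_k)` over the atoms of the gamma process. The
partial products are dominated by those of `max 1 ‖φ‖`, which increase, so that the limit can be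
taken in `IsMult.integral_mart`. -/
theorem IsMult.integral_prod (h : IsMult φ B K) {Q : (ℕ → ℝ × X) → 𝕜}
    (hQ : ∀ᵐ ω ∂seqLaw m, Tendsto (multPart φ ω) atTop (𝓝 (Q ω))) :
    Integrable Q (seqLaw m) ∧
      ∫ ω, Q ω ∂seqLaw m = NormedSpace.exp (∫ r in Set.Ioi 0, multDensity m φ r) := by
  have h1 : IsMult (fun r x => max 1 ‖φ r x‖) (max 1 B) K := by
    refine ⟨measurable_const.max h.meas.norm, fun x => continuousOn_const.sup (h.cont x).norm,
      fun r hr x => ?_, fun r hr x => ?_⟩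
    · rw [Real.norm_of_nonneg (zero_le_one.trans (le_max_left _ _))]
      exact max_le_max le_rfl (h.bound r hr x)
    · refine le_trans ?_ (h.near r hr x)
      rw [Real.norm_of_nonneg (sub_nonneg.2 (le_max_left _ _)), sub_le_iff_le_add]
      refine max_le (by linarith [norm_nonneg (φ r x - 1)]) ?_
      calc ‖φ r x‖ = ‖(φ r x - 1) + 1‖ := by rw [sub_add_cancel]
        _ ≤ ‖φ r x - 1‖ + ‖(1 : 𝕜)‖ := norm_add_le _ _
        _ = ‖φ r x - 1‖ + 1 := by rw [norm_one]
  obtain ⟨W, hW, hbd⟩ := h1.ae_bounded_of_one_le (m := m) fun r _ x => le_max_left _ _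
  have hbd' : ∀ᵐ ω ∂seqLaw m, ∀ N, ‖multPart φ ω N‖ ≤ W ω := by
    filter_upwards [hbd] with ω hω N
    refine le_trans ?_ (hω N)
    rw [multPart, norm_prod]
    exact Finset.prod_le_prod (fun _ _ => norm_nonneg _) fun k _ => le_max_right _ _
  obtain ⟨C, hC⟩ := h.exists_tail_bound m
  have hmeas : AEStronglyMeasurable Q (seqLaw m) :=
    aestronglyMeasurable_of_tendsto_ae atTop
      (fun N => (h.measurable_part N).aestronglyMeasurable) hQ
  refine ⟨hW.mono' hmeas ?_, ?_⟩
  · filter_upwards [hbd', hQ] with ω h2 h3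
    exact le_of_tendsto h3.norm (Eventually.of_forall h2)
  · have hlim := tendsto_integral_of_dominated_convergence
      (F := fun N ω => multPart φ ω N * multTail m φ (arrival ω N)) (f := Q) (μ := seqLaw m)
      (fun ω => W ω * C) (fun N => (h.integrable_mart N).aestronglyMeasurable) (hW.mul_const C) ?_ ?_
    · simp_rw [h.integral_mart] at hlim
      rw [← tendsto_nhds_unique tendsto_const_nhds hlim, multTail, if_pos le_rfl]
    · intro N
      filter_upwards [hbd'] with ω h2
      rw [norm_mul]
      exact mul_le_mul (h2 N) (hC _) (norm_nonneg _) ((norm_nonneg _).trans (h2 N))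
    · filter_upwards [hQ, ae_arrival_tendsto m] with ω h2 h3
      simpa using h2.mul ((h.tendsto_tail (m := m)).comp h3)

variable (m) in
/-- The partial products of `1 + min(r_k, 1)` are bounded and dominate the partial sums of
`min(r_k, 1)`. -/
theorem ae_summable_weights :
    ∀ᵐ ω ∂seqLaw m, Summable fun k => (levyTailInv (arrival ω (k + 1)) : ℝ) := by
  have h : IsMult (fun (r : ℝ) (_ : X) => 1 + min |r| 1) 2 1 := by
    refine ⟨by fun_prop, fun x => by fun_prop, fun r hr x => ?_, fun r hr x => ?_⟩
    · rw [Real.norm_of_nonneg (by positivity)]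
      linarith [min_le_right |r| 1]
    · rw [add_sub_cancel_left, Real.norm_of_nonneg (by positivity), one_mul, abs_of_pos hr]
      exact min_le_left _ _
  obtain ⟨W, -, hW⟩ := h.ae_bounded_of_one_le (m := m) fun r hr x => by
    have : 0 ≤ min |r| 1 := by positivity
    linarith
  filter_upwards [hW] with ω hω
  have hs : Summable fun k => min (levyTailInv (arrival ω (k + 1)) : ℝ) 1 := by
    refine summable_of_sum_range_le (c := W ω) (fun k => le_min (levyTailInv _).2.le zero_le_one)
      fun N => le_trans ?_ (hω N)
    have h1 : multPart (fun (r : ℝ) (_ : X) => 1 + min |r| 1) ω N =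
        ∏ k ∈ Finset.range N, (1 + min (levyTailInv (arrival ω (k + 1)) : ℝ) 1) :=
      Finset.prod_congr rfl fun k _ => by
        simp only [abs_of_pos (levyTailInv (arrival ω (k + 1))).2]
    rw [h1]
    have h2 : ∀ N, 1 + ∑ k ∈ Finset.range N, min (levyTailInv (arrival ω (k + 1)) : ℝ) 1 ≤
        ∏ k ∈ Finset.range N, (1 + min (levyTailInv (arrival ω (k + 1)) : ℝ) 1) := by
      intro N
      induction N with
      | zero => simp
      | succ N ih =>
        rw [Finset.sum_range_succ, Finset.prod_range_succ]
        have h3 : 0 ≤ min (levyTailInv (arrival ω (N + 1)) : ℝ) 1 :=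
          le_min (levyTailInv _).2.le zero_le_one
        have h4 : 0 ≤ ∑ k ∈ Finset.range N, min (levyTailInv (arrival ω (k + 1)) : ℝ) 1 :=
          Finset.sum_nonneg fun k _ => le_min (levyTailInv _).2.le zero_le_one
        nlinarith
    linarith [h2 N]
  refine hs.congr_atTop ?_
  filter_upwards [hs.tendsto_atTop_zero.eventually_lt_const one_pos] with k hk
  exact min_eq_left (by
    by_contra h2
    rw [min_eq_right (not_le.1 h2).le] at hk
    exact lt_irrefl _ hk)

end Campbell

/-! ### The exponent of the Laplace functional -/

section Exponent

theorem norm_exp_sub_one_le_of_re_nonpos {w : ℂ} (hw : w.re ≤ 0) : ‖exp w - 1‖ ≤ ‖w‖ := by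
  have hconv : Convex ℝ {z : ℂ | z.re ≤ 0} := convex_halfSpace_re_le 0
  have := hconv.norm_image_sub_le_of_norm_hasDerivWithin_le (f := exp) (f' := exp) (C := 1)
    (fun z _ => (Complex.hasDerivAt_exp z).hasDerivWithinAt) (fun z hz => by
      rw [Complex.norm_exp]
      exact Real.exp_le_one_iff.2 hz) (x := 0) (y := w) (by simp) hw
  simpa using this

/-- The integrand of `expoInt`. -/
def expoFun (z : ℂ) (r : ℝ) : ℂ := (r : ℂ)⁻¹ * (exp (-(r : ℂ) ^ 2 * z) - exp (-r))

/-- The Frullani integral `∫₀^∞ (e^{-r² z} - e^{-r}) r⁻¹ dr`. -/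
def expoInt (z : ℂ) : ℂ := ∫ r in Set.Ioi (0 : ℝ), expoFun z r

/-- A majorant of `expoFun`, uniform for `‖z‖ ≤ M` and `Re z ≥ δ`. -/
def expoBound (M δ r : ℝ) : ℝ :=
  (Set.Ioc (0 : ℝ) 1).indicator (fun _ => M + 1) r +
    (Set.Ioi (1 : ℝ)).indicator (fun r => Real.exp (-δ * r) + Real.exp (-r)) r

theorem integrable_expoBound (M : ℝ) {δ : ℝ} (hδ : 0 < δ) : Integrable (expoBound M δ) := by
  refine Integrable.add ?_ ?_
  · refine (integrable_indicator_iff measurableSet_Ioc).2 (integrableOn_const ?_)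
    simp
  · exact (integrable_indicator_iff measurableSet_Ioi).2
      ((exp_neg_integrableOn_Ioi 1 hδ).add (integrableOn_exp_neg_Ioi 1))

theorem norm_exp_sub_exp_le {z : ℂ} (hz : 0 < z.re) {r : ℝ} (hr : 0 < r) :
    ‖exp (-(r : ℂ) ^ 2 * z) - exp (-r)‖ ≤ r ^ 2 * ‖z‖ + r := by
  have h1 : (-(r : ℂ) ^ 2 * z).re = -(r ^ 2 * z.re) := by
    rw [← ofReal_pow, ← ofReal_neg, re_ofReal_mul]; ring
  have h2 := norm_exp_sub_one_le_of_re_nonpos (w := -(r : ℂ) ^ 2 * z)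
    (by rw [h1]; simp only [neg_nonpos]; positivity)
  have h3 := norm_exp_sub_one_le_of_re_nonpos (w := -(r : ℂ)) (by simpa using hr.le)
  rw [norm_mul, norm_neg, norm_pow, norm_real, Real.norm_of_nonneg hr.le] at h2
  rw [norm_neg, norm_real, Real.norm_of_nonneg hr.le] at h3
  calc _ = ‖(exp (-(r : ℂ) ^ 2 * z) - 1) - (exp (-r) - 1)‖ := by congr 1; ring
    _ ≤ _ := (norm_sub_le _ _).trans (add_le_add h2 h3)

theorem norm_expoFun_le {z : ℂ} {M δ : ℝ} (hδ : 0 < δ) (hM : ‖z‖ ≤ M) (hz : δ ≤ z.re) {r : ℝ}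
    (hr : 0 < r) : ‖expoFun z r‖ ≤ expoBound M δ r := by
  have h0 : (-(r : ℂ) ^ 2 * z).re = -(r ^ 2 * z.re) := by
    rw [← ofReal_pow, ← ofReal_neg, re_ofReal_mul]; ring
  rw [expoFun, norm_mul, norm_inv, norm_real, Real.norm_of_nonneg hr.le, expoBound]
  rcases le_or_gt r 1 with h1 | h1
  · rw [Set.indicator_of_mem (show r ∈ Set.Ioc (0 : ℝ) 1 from ⟨hr, h1⟩),
      Set.indicator_of_notMem (show r ∉ Set.Ioi (1 : ℝ) from not_lt.2 h1), add_zero]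
    rw [inv_mul_le_iff₀ hr]
    refine (norm_exp_sub_exp_le (hδ.trans_le hz) hr).trans ?_
    have h2 : r ^ 2 * ‖z‖ ≤ r * M := mul_le_mul (by nlinarith) hM (norm_nonneg z) hr.le
    linarith
  · rw [Set.indicator_of_notMem (show r ∉ Set.Ioc (0 : ℝ) 1 from fun h => not_le.2 h1 h.2),
      Set.indicator_of_mem (show r ∈ Set.Ioi (1 : ℝ) from h1), zero_add]
    refine (mul_le_of_le_one_left (norm_nonneg _) (inv_le_one_of_one_le₀ h1.le)).trans ?_
    refine (norm_sub_le _ _).trans (add_le_add ?_ ?_)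
    · rw [Complex.norm_exp, h0]
      refine Real.exp_le_exp.2 ?_
      have h2 : r ≤ r ^ 2 := by nlinarith
      have h3 : r * δ ≤ r ^ 2 * z.re := mul_le_mul h2 hz hδ.le (by positivity)
      linarith
    · rw [Complex.norm_exp]
      simp

theorem continuousOn_expoFun (z : ℂ) : ContinuousOn (expoFun z) (Set.Ioi 0) := by
  intro r hr
  have hr' : (r : ℂ) ≠ 0 := ofReal_ne_zero.2 (ne_of_gt hr)
  unfold expoFun
  exact ContinuousAt.continuousWithinAt (by fun_prop (disch := exact hr'))

theorem integrableOn_expoFun {z : ℂ} (hz : 0 < z.re) : IntegrableOn (expoFun z) (Set.Ioi 0) := by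
  refine Integrable.mono' (integrable_expoBound ‖z‖ hz).integrableOn
    ((continuousOn_expoFun z).aestronglyMeasurable measurableSet_Ioi) ?_
  exact (ae_restrict_iff' measurableSet_Ioi).2 (Eventually.of_forall fun r hr =>
    norm_expoFun_le hz le_rfl le_rfl hr)

theorem hasDerivAt_expoInt {z : ℂ} (hz : 0 < z.re) : HasDerivAt expoInt (-(2 * z)⁻¹) z := by
  have hc : 0 < z.re / 2 := by positivity
  have hball : ∀ w ∈ Metric.ball z (z.re / 2), z.re / 2 ≤ w.re := by
    intro w hw
    have h1 := (Complex.abs_re_le_norm (w - z)).trans_lt (mem_ball_iff_norm.1 hw)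
    rw [sub_re] at h1
    linarith [neg_lt_of_abs_lt h1]
  have key := hasDerivAt_integral_of_dominated_loc_of_deriv_le
    (μ := volume.restrict (Set.Ioi (0 : ℝ))) (F := expoFun)
    (F' := fun w r => -((r : ℂ) * exp (-w * (r : ℂ) ^ 2))) (x₀ := z)
    (bound := fun r => |r * Real.exp (-(z.re / 2) * r ^ 2)|) (s := Metric.ball z (z.re / 2))
    (Metric.ball_mem_nhds z hc)
    (Eventually.of_forall fun w =>
      (continuousOn_expoFun w).aestronglyMeasurable measurableSet_Ioi)
    (integrableOn_expoFun hz) (by fun_prop) ?_ ?_ ?_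
  · have h2 : ∫ r in Set.Ioi (0 : ℝ), -((r : ℂ) * exp (-z * (r : ℂ) ^ 2)) = -(2 * z)⁻¹ := by
      rw [integral_neg, integral_mul_cexp_neg_mul_sq hz]
    rw [← h2]
    exact key.2
  · refine Eventually.of_forall fun r w hw => ?_
    rw [norm_neg, norm_mul, norm_real, Complex.norm_exp, abs_mul, Real.abs_exp]
    have h0 : (-w * (r : ℂ) ^ 2).re = -(r ^ 2 * w.re) := by
      rw [← ofReal_pow, re_mul_ofReal, neg_re]; ring
    rw [h0, Real.norm_eq_abs]
    refine mul_le_mul_of_nonneg_left (Real.exp_le_exp.2 ?_) (abs_nonneg r)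
    nlinarith [hball w hw, sq_nonneg r]
  · exact (integrable_mul_exp_neg_mul_sq hc).abs.integrableOn
  · refine (ae_restrict_iff' measurableSet_Ioi).2 (Eventually.of_forall fun r hr w hw => ?_)
    have hr' : (r : ℂ) ≠ 0 := ofReal_ne_zero.2 (ne_of_gt hr)
    have h3 : HasDerivAt (fun w : ℂ => exp (-(r : ℂ) ^ 2 * w)) _ w :=
      ((hasDerivAt_id w).const_mul (-(r : ℂ) ^ 2)).cexp
    refine ((h3.sub_const (exp (-r))).const_mul (r : ℂ)⁻¹).congr_deriv ?_
    simp only [id]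
    rw [show -w * (r : ℂ) ^ 2 = -(r : ℂ) ^ 2 * w by ring]
    field_simp

/-- The integral is evaluated by differentiation in `z`; the factor `1/2` comes from `r²`. -/
theorem expoInt_eq {z : ℂ} (hz : 0 < z.re) : expoInt z = expoInt 1 - 1 / 2 * log z := by
  have hopen : IsOpen {z : ℂ | 0 < z.re} := isOpen_lt continuous_const Complex.continuous_re
  have hconv : Convex ℝ {z : ℂ | 0 < z.re} := convex_halfSpace_re_gt 0
  have hd : ∀ w ∈ {z : ℂ | 0 < z.re}, HasDerivAt (fun w => expoInt w + 1 / 2 * log w) 0 w := by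
    intro w hw
    have hw' : 0 < w.re := hw
    have h1 := (hasDerivAt_expoInt hw').add
      ((Complex.hasDerivAt_log (Or.inl hw')).const_mul (1 / 2))
    refine h1.congr_deriv ?_
    have hne : w ≠ 0 := fun h => by simp [h] at hw'
    field_simp
    ring
  have h2 := hopen.is_const_of_deriv_eq_zero hconv.isPreconnected
    (fun w hw => (hd w hw).differentiableAt.differentiableWithinAt)
    (fun w hw => (hd w hw).deriv) (show z ∈ {z : ℂ | 0 < z.re} from hz)
    (show (1 : ℂ) ∈ {z : ℂ | 0 < z.re} by simp)
  simp only [Complex.log_one, mul_zero, add_zero] at h2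
  linear_combination h2

end Exponent

/-! ### Configurations in general position -/

section Good

variable {X : Type*} [MeasurableSpace X]

/-- Configurations with decreasing summable weights at distinct points. -/
def goodConfig (X : Type*) : Set (Config X) :=
  {ξ | StrictAnti (fun k => (ξ k).1) ∧ Summable (fun k => ((ξ k).1 : ℝ)) ∧
    Function.Injective fun k => (ξ k).2}

/-- The configuration `{r(x_k) r_k, x_k}`, enumerated like `ξ`. -/
def scaleConfig (r : X → RPos) (ξ : Config X) : Config X :=
  fun k => (r (ξ k).2 * (ξ k).1, (ξ k).2)

theorem measurable_weight (k : ℕ) : Measurable fun ξ : Config X => ((ξ k).1 : ℝ) :=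
  measurable_subtype_coe.comp (measurable_fst.comp (measurable_pi_apply k))

theorem measurable_point (k : ℕ) : Measurable fun ξ : Config X => (ξ k).2 :=
  measurable_snd.comp (measurable_pi_apply k)

theorem measurable_scaleConfig {r : X → RPos} (hr : Measurable r) : Measurable (scaleConfig r) := by
  refine measurable_pi_lambda _ fun k => Measurable.prodMk ?_ (measurable_point k)
  exact Measurable.subtype_mk ((measurable_subtype_coe.comp (hr.comp (measurable_point k))).mul
    (measurable_weight k))

theorem measurableSet_summable_weights :
    MeasurableSet {ξ : Config X | Summable fun k => ((ξ k).1 : ℝ)} := by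
  have h : {ξ : Config X | Summable fun k => ((ξ k).1 : ℝ)} =
      {ξ | ∑' k, ENNReal.ofReal ((ξ k).1 : ℝ) ≠ ∞} := by
    ext ξ
    refine ⟨fun h => h.tsum_ofReal_ne_top, fun h => ?_⟩
    have h1 := ENNReal.summable_toReal h
    simpa [ENNReal.toReal_ofReal (ξ _).1.2.le] using h1
  rw [h]
  exact (measurableSet_eq_fun (Measurable.tsum fun k => (measurable_weight k).ennreal_ofReal)
    measurable_const).compl

instance : StandardBorelSpace RPos := (measurableSet_Ioi (a := (0 : ℝ))).standardBorel

theorem measurableSet_goodConfig [StandardBorelSpace X] : MeasurableSet (goodConfig X) := by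
  have h1 : MeasurableSet {ξ : Config X | StrictAnti fun k => (ξ k).1} := by
    have : {ξ : Config X | StrictAnti fun k => (ξ k).1} =
        ⋂ k, {ξ | ((ξ (k + 1)).1 : ℝ) < (ξ k).1} := by
      ext ξ
      simp only [Set.mem_iInter, Set.mem_ofPred_eq]
      exact ⟨fun h k => h (Nat.lt_succ_self k), fun h => strictAnti_nat_of_succ_lt h⟩
    rw [this]
    exact MeasurableSet.iInter fun k => measurableSet_lt (measurable_weight _) (measurable_weight _)
  have h2 : MeasurableSet {ξ : Config X | Function.Injective fun k => (ξ k).2} := by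
    have : {ξ : Config X | Function.Injective fun k => (ξ k).2} =
        ⋂ (j : ℕ) (k : ℕ), {ξ | (ξ j).2 = (ξ k).2 → j = k} := by
      ext ξ
      simp only [Set.mem_iInter]
      rfl
    rw [this]
    refine MeasurableSet.iInter fun j => MeasurableSet.iInter fun k => ?_
    by_cases hjk : j = k
    · simp [hjk]
    · simp only [hjk, imp_false]
      exact (measurableSet_eq_fun (measurable_point j) (measurable_point k)).compl
  exact h1.inter (measurableSet_summable_weights.inter h2)

variable (m : Measure X) [IsProbabilityMeasure m]

/-- The weight of the atom with arrival time `s + t` is injective as a function of `t`, and the law of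
`t` has no atoms. -/
theorem ae_update_weight_ne {r : X → RPos} (hr : Measurable r) (c : ℝ) {s : ℝ} (hs : 0 ≤ s) :
    ∀ᵐ y ∂((ProbabilityTheory.expMeasure 1).prod m), c ≠ r y.2 * levyTailInv (s + y.1) := by
  have hm : MeasurableSet {y : ℝ × X | c = r y.2 * levyTailInv (s + y.1)} :=
    measurableSet_eq_fun measurable_const
      ((measurable_subtype_coe.comp (hr.comp measurable_snd)).mul
        (measurable_subtype_coe.comp (measurable_levyTailInv.comp
          (measurable_const.add measurable_fst))))
  rw [ae_iff]
  simp only [ne_eq, not_not]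
  rw [Measure.prod_apply_symm hm, lintegral_eq_zero_iff (measurable_measure_prodMk_right hm)]
  refine Eventually.of_forall fun x => ?_
  change ProbabilityTheory.expMeasure 1 {t : ℝ | c = r x * levyTailInv (s + t)} = 0
  have h1 : ({t : ℝ | c = r x * levyTailInv (s + t)} ∩ Set.Ioi 0).Subsingleton := by
    rintro t ⟨ht, ht0⟩ t' ⟨ht', ht0'⟩
    have h2 : (levyTailInv (s + t) : ℝ) = levyTailInv (s + t') :=
      mul_left_cancel₀ (r x).2.ne' (ht.symm.trans ht')
    have h0 : 0 < t := ht0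
    have h0' : 0 < t' := ht0'
    have h3 := congrArg levyTail h2
    rw [levyTail_levyTailInv (by linarith), levyTail_levyTailInv (by linarith)] at h3
    linarith
  refine measure_mono_null (t := ({t : ℝ | c = r x * levyTailInv (s + t)} ∩ Set.Ioi 0) ∪
    {t : ℝ | ¬ 0 < t}) (fun t ht => ?_) (measure_union_null (h1.measure_zero _)
      (ae_iff.1 expMeasure_pos))
  by_cases h0 : 0 < t
  · exact Or.inl ⟨ht, h0⟩
  · exact Or.inr h0

/-- The weights of a scaled configuration are almost surely distinct: given the other variables, the
waiting time before the later of two atoms is continuously distributed. -/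
theorem ae_scaled_weight_ne {r : X → RPos} (hr : Measurable r) :
    ∀ᵐ ω ∂seqLaw m, ∀ j k, j < k →
      (r (ω j).2 * levyTailInv (arrival ω (j + 1)) : ℝ) ≠
        r (ω k).2 * levyTailInv (arrival ω (k + 1)) := by
  have hw : ∀ k, Measurable fun ω : ℕ → ℝ × X =>
      (r (ω k).2 * levyTailInv (arrival ω (k + 1)) : ℝ) := fun k =>
    (measurable_subtype_coe.comp (hr.comp (measurable_snd.comp (measurable_pi_apply k)))).mul
      (measurable_subtype_coe.comp (measurable_levyTailInv.comp (measurable_arrival (k + 1))))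
  refine ae_all_iff.2 fun j => ae_all_iff.2 fun k => ?_
  by_cases hjk : j < k
  · simp only [hjk, true_imp_iff]
    refine ae_seqLaw_of_update m k (measurableSet_eq_fun (hw j) (hw k)).compl ?_
    filter_upwards [ae_waiting_pos m] with ω hω
    filter_upwards [ae_update_weight_ne m hr (r (ω j).2 * levyTailInv (arrival ω (j + 1)))
      (arrival_nonneg hω k)] with y hy
    rw [Function.update_of_ne hjk.ne, Function.update_self, arrival_update (Nat.succ_le_of_lt hjk),
      arrival_succ _ k, arrival_update le_rfl, Function.update_self]
    exact hy
  · simp [hjk]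

/-- The atoms lie at distinct points, because `m` has no atoms. -/
theorem ae_point_ne [StandardBorelSpace X] [NullSingletonClass m] :
    ∀ᵐ ω ∂seqLaw m, ∀ j k, j < k → (ω j).2 ≠ (ω k).2 := by
  have hp : ∀ k, Measurable fun ω : ℕ → ℝ × X => (ω k).2 := fun k =>
    measurable_snd.comp (measurable_pi_apply k)
  refine ae_all_iff.2 fun j => ae_all_iff.2 fun k => ?_
  by_cases hjk : j < k
  · simp only [hjk, true_imp_iff]
    refine ae_seqLaw_of_update m k (measurableSet_eq_fun (hp j) (hp k)).compl ?_
    refine Eventually.of_forall fun ω => ?_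
    have h1 : ∀ᵐ x ∂m, (ω j).2 ≠ x := by
      rw [ae_iff]
      simp only [ne_eq, not_not]
      exact measure_mono_null (fun x hx => Set.mem_singleton_iff.2 (Eq.symm hx))
        (measure_singleton (ω j).2)
    have h2 : ∀ᵐ y ∂((ProbabilityTheory.expMeasure 1).prod m), (ω j).2 ≠ y.2 :=
      Measure.quasiMeasurePreserving_snd.ae h1
    filter_upwards [h2] with y hy
    rwa [Function.update_of_ne hjk.ne, Function.update_self]
  · simp [hjk]

theorem lebesgueInf_ac : lebesgueInf m ≪ gammaLaw m := withDensity_absolutelyContinuous _ _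

theorem ae_lebesgueInf_of_seqLaw {p : Config X → Prop} (hp : MeasurableSet {ξ | p ξ})
    (h : ∀ᵐ ω ∂seqLaw m, p (gammaConfig ω)) : ∀ᵐ ξ ∂lebesgueInf m, p ξ :=
  (lebesgueInf_ac m).ae_le ((ae_map_iff measurable_gammaConfig.aemeasurable hp).2 h)

theorem ae_goodConfig [StandardBorelSpace X] [NullSingletonClass m] :
    ∀ᵐ ξ ∂lebesgueInf m, ξ ∈ goodConfig X := by
  refine ae_lebesgueInf_of_seqLaw m measurableSet_goodConfig ?_
  filter_upwards [ae_waiting_pos m, ae_summable_weights m, ae_point_ne m] with ω h1 h2 h3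
  refine ⟨strictAnti_nat_of_succ_lt fun k => ?_, h2, ?_⟩
  · exact levyTailInv_strictAnti (arrival_succ_pos h1 k)
      (arrival_strictMono h1 (Nat.lt_succ_self (k + 1)))
  · intro j k hjk
    by_contra hne
    rcases lt_or_gt_of_ne hne with h | h
    · exact h3 j k h hjk
    · exact h3 k j h hjk.symm

theorem ae_scaled_injective {r : X → RPos} (hr : Measurable r) :
    ∀ᵐ ξ ∂lebesgueInf m, Function.Injective fun k => (scaleConfig r ξ k).1 := by
  have hm : MeasurableSet {ξ : Config X | ∀ j k, j < k →
      ((scaleConfig r ξ j).1 : ℝ) ≠ (scaleConfig r ξ k).1} := by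
    have : {ξ : Config X | ∀ j k, j < k →
      ((scaleConfig r ξ j).1 : ℝ) ≠ (scaleConfig r ξ k).1} = ⋂ (j : ℕ) (k : ℕ) (_ : j < k),
        {ξ | ((scaleConfig r ξ j).1 : ℝ) = (scaleConfig r ξ k).1}ᶜ := by
      ext ξ
      simp
    rw [this]
    exact MeasurableSet.iInter fun j => MeasurableSet.iInter fun k => MeasurableSet.iInter fun _ =>
      (measurableSet_eq_fun ((measurable_weight j).comp (measurable_scaleConfig hr))
        ((measurable_weight k).comp (measurable_scaleConfig hr))).compl
  have h := ae_lebesgueInf_of_seqLaw m hm (ae_scaled_weight_ne m hr)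
  filter_upwards [h] with ξ h3 j k hjk
  by_contra hne
  rcases lt_or_gt_of_ne hne with h | h
  · exact h3 j k h (congrArg Subtype.val hjk)
  · exact h3 k j h (congrArg Subtype.val hjk.symm)

end Good

/-! ### The Laplace functional of the measure `𝓛` -/

section Laplace

variable {𝕜 : Type*} [RCLike 𝕜]

/-- The real linear maps `id`, `conj : ℂ → ℂ` and `Re : ℂ → ℝ` through which the inner products in
`H^+`, `H^-` and `H^0` depend on those in `H^+`. -/
structure IsScalarMap (ρ : ℂ →L[ℝ] 𝕜) : Prop where
  one : ρ 1 = 1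
  norm_le : ∀ z, ‖ρ z‖ ≤ ‖z‖
  re : ∀ z, RCLike.re (ρ z) = z.re

variable {ρ : ℂ →L[ℝ] 𝕜}

theorem realLinear_ofReal_mul (ρ : ℂ →L[ℝ] 𝕜) (t : ℝ) (z : ℂ) : ρ (t * z) = t * ρ z := by
  rw [← real_smul, map_smul, RCLike.real_smul_eq_coe_mul]

theorem IsScalarMap.norm_sub_one_le (h : IsScalarMap ρ) (z : ℂ) : ‖ρ z - 1‖ ≤ ‖z - 1‖ := by
  rw [← h.one, ← map_sub]
  exact h.norm_le _

variable {X : Type*} [MeasurableSpace X]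

/-- The factor at the atom `(r, x)` in the Laplace functional at `f`, including the density `e^r` of
`𝓛` with respect to the law of the gamma process. -/
def laplaceFactor (ρ : ℂ →L[ℝ] 𝕜) (f : X → ℂ) (r : ℝ) (x : X) : 𝕜 :=
  ρ (exp (r - (r : ℂ) ^ 2 * f x))

theorem laplaceFactor_eq (f : X → ℂ) (r : ℝ) (x : X) : laplaceFactor ρ f r x =
    (Real.exp r : 𝕜) * ρ (exp (-(r : ℂ) ^ 2 * f x)) := by
  rw [laplaceFactor, ← realLinear_ofReal_mul, ofReal_exp, ← Complex.exp_add]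
  ring_nf

theorem isMult_laplaceFactor (hρ : IsScalarMap ρ) {f : X → ℂ} (hf : Measurable f) {M δ : ℝ}
    (hδ : 0 < δ) (hM : ∀ x, ‖f x‖ ≤ M) (hre : ∀ x, δ ≤ (f x).re) :
    ∃ B K, IsMult (laplaceFactor ρ f) B K := by
  -- `1 / (4 δ)` is the maximum of `r - r² δ`
  have hB : ∀ r x, ‖laplaceFactor ρ f r x‖ ≤ Real.exp ((4 * δ)⁻¹) := by
    intro r x
    refine (hρ.norm_le _).trans ?_
    rw [Complex.norm_exp]
    refine Real.exp_le_exp.2 ?_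
    have h1 : ((r : ℂ) - (r : ℂ) ^ 2 * f x).re = r - r ^ 2 * (f x).re := by
      rw [← ofReal_pow, sub_re, re_ofReal_mul, ofReal_re]
    have h2 : r ^ 2 * δ ≤ r ^ 2 * (f x).re := mul_le_mul_of_nonneg_left (hre x) (sq_nonneg r)
    have h3 : (4 * δ)⁻¹ - (r - r ^ 2 * δ) = δ * (r - (2 * δ)⁻¹) ^ 2 := by field_simp; ring
    have h4 : 0 ≤ δ * (r - (2 * δ)⁻¹) ^ 2 := by positivity
    rw [h1]
    linarith
  refine ⟨Real.exp ((4 * δ)⁻¹), max (Real.exp 1 * (M + 1)) (Real.exp ((4 * δ)⁻¹) + 1),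
    ?_, fun x => ?_, fun r _ x => hB r x, fun r hr x => ?_⟩
  · unfold laplaceFactor
    exact ρ.continuous.measurable.comp (by fun_prop)
  · unfold laplaceFactor
    exact Continuous.continuousOn (by fun_prop)
  · rcases le_or_gt r 1 with h1 | h1
    · have h2 : exp ((r : ℂ) - (r : ℂ) ^ 2 * f x) - 1 =
          exp r * (exp (-(r : ℂ) ^ 2 * f x) - exp (-r)) := by
        rw [mul_sub, ← Complex.exp_add, ← Complex.exp_add, add_neg_cancel, Complex.exp_zero]
        ring_nf
      refine (hρ.norm_sub_one_le _).trans ?_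
      rw [h2, norm_mul, Complex.norm_exp, ofReal_re]
      have h3 := norm_exp_sub_exp_le (hδ.trans_le (hre x)) hr
      have h4 : r ^ 2 * ‖f x‖ ≤ r * M := mul_le_mul (by nlinarith) (hM x) (norm_nonneg _) hr.le
      have h5 : ‖exp (-(r : ℂ) ^ 2 * f x) - exp (-r)‖ ≤ (M + 1) * r := by linarith
      calc _ ≤ Real.exp 1 * ((M + 1) * r) := by gcongr
        _ = Real.exp 1 * (M + 1) * r := by ring
        _ ≤ _ := by gcongr; exact le_max_left _ _
    · calc _ ≤ Real.exp ((4 * δ)⁻¹) + 1 := by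
            refine (norm_sub_le _ _).trans (add_le_add (hB r x) ?_)
            rw [norm_one]
        _ ≤ max (Real.exp 1 * (M + 1)) (Real.exp ((4 * δ)⁻¹) + 1) * 1 := by
            rw [mul_one]; exact le_max_right _ _
        _ ≤ _ := by
            refine mul_le_mul_of_nonneg_left h1.le ?_
            exact le_max_of_le_right (by positivity)

variable (m : Measure X) [IsProbabilityMeasure m]

/-- The exponent in Campbell's formula for the Laplace functional: the density `e^r` of `𝓛` cancels
the factor `e^{-r}` of the Lévy measure, and the integral over `r` becomes `expoInt`. -/
theorem integral_laplaceFactor (hρ : IsScalarMap ρ) {f : X → ℂ} (hf : Measurable f) {M δ : ℝ}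
    (hδ : 0 < δ) (hM : ∀ x, ‖f x‖ ≤ M) (hre : ∀ x, δ ≤ (f x).re) :
    ∫ r in Set.Ioi 0, multDensity m (laplaceFactor ρ f) r =
      ρ (∫ x, (expoInt 1 - 1 / 2 * log (f x)) ∂m) := by
  have hmeas : Measurable fun p : ℝ × X => expoFun (f p.2) p.1 := by
    unfold expoFun
    fun_prop
  have hint : Integrable (fun p : ℝ × X => expoFun (f p.2) p.1)
      ((volume.restrict (Set.Ioi 0)).prod m) := by
    refine Integrable.mono' (((integrable_expoBound M hδ).integrableOn
      (s := Set.Ioi 0)).mul_prod (integrable_const (1 : ℝ))) hmeas.aestronglyMeasurable ?_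
    have h1 : ∀ᵐ p ∂((volume.restrict (Set.Ioi (0 : ℝ))).prod m), p.1 ∈ Set.Ioi (0 : ℝ) :=
      Measure.quasiMeasurePreserving_fst.ae (ae_restrict_mem measurableSet_Ioi)
    filter_upwards [h1] with p hp
    rw [mul_one]
    exact norm_expoFun_le hδ (hM _) (hre _) hp
  have h2 : ∀ r ∈ Set.Ioi (0 : ℝ), multDensity m (laplaceFactor ρ f) r =
      ρ (∫ x, expoFun (f x) r ∂m) := by
    intro r hr
    have hr' : 0 < r := hr
    obtain ⟨B, K, hmult⟩ := isMult_laplaceFactor hρ hf hδ hM hre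
    have h3 : ∀ x, ‖expoFun (f x) r‖ ≤ expoBound M δ r := fun x =>
      norm_expoFun_le hδ (hM x) (hre x) hr
    have h4 : Integrable (fun x => expoFun (f x) r) m :=
      Integrable.of_bound (hmeas.comp (measurable_const.prodMk measurable_id)).aestronglyMeasurable
        _ (Eventually.of_forall h3)
    rw [← ContinuousLinearMap.integral_comp_comm _ h4, multDensity]
    have h5 : multMean m (laplaceFactor ρ f) r - 1 = ∫ x, (laplaceFactor ρ f r x - 1) ∂m := by
      rw [integral_sub (hmult.integrable_section hr') (integrable_const _)]
      simp [multMean]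
    rw [h5, ← integral_smul]
    refine integral_congr_ae (Eventually.of_forall fun x => ?_)
    simp only []
    rw [← hρ.one, laplaceFactor, ← map_sub, ← map_smul]
    congr 1
    rw [expoFun, real_smul, ofReal_mul, ofReal_inv, ofReal_exp, mul_assoc, mul_sub, mul_one,
      ← Complex.exp_add]
    push_cast
    ring_nf
  rw [setIntegral_congr_fun measurableSet_Ioi h2,
    ContinuousLinearMap.integral_comp_comm _ hint.integral_prod_left]
  congr 1
  rw [integral_integral_swap hint]
  refine integral_congr_ae (Eventually.of_forall fun x => ?_)
  exact expoInt_eq (hδ.trans_le (hre x))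

/-- The product `∏ ρ(exp(-r_k² f(x_k)))`. -/
def laplaceProd (ρ : ℂ →L[ℝ] 𝕜) (f : X → ℂ) (ξ : Config X) : 𝕜 :=
  ∏' k, ρ (exp (-((ξ k).1 : ℂ) ^ 2 * f (ξ k).2))

theorem summable_sq {u : ℕ → ℝ} (h0 : ∀ k, 0 ≤ u k) (hu : Summable u) :
    Summable fun k => u k ^ 2 := by
  refine Summable.of_nonneg_of_le (fun k => sq_nonneg _) (fun k => ?_)
    (hu.mul_right (∑' k, u k))
  rw [pow_two]
  exact mul_le_mul_of_nonneg_left (hu.le_tsum k fun j _ => h0 j) (h0 k)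

theorem laplaceProd_tendsto (hρ : IsScalarMap ρ) {f : X → ℂ} {M : ℝ} (hM : ∀ x, ‖f x‖ ≤ M)
    (hre : ∀ x, 0 ≤ (f x).re) {ξ : Config X} (hξ : Summable fun k => ((ξ k).1 : ℝ)) :
    Tendsto (fun N => ∏ k ∈ Finset.range N, ρ (exp (-((ξ k).1 : ℂ) ^ 2 * f (ξ k).2))) atTop
      (𝓝 (laplaceProd ρ f ξ)) := by
  have hs : Summable fun k => ‖ρ (exp (-((ξ k).1 : ℂ) ^ 2 * f (ξ k).2)) - 1‖ := by
    refine Summable.of_nonneg_of_le (fun _ => norm_nonneg _) (fun k => ?_)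
      ((summable_sq (fun k => (ξ k).1.2.le) hξ).mul_right M)
    refine (hρ.norm_sub_one_le _).trans ((norm_exp_sub_one_le_of_re_nonpos ?_).trans ?_)
    · rw [← ofReal_pow, ← ofReal_neg, re_ofReal_mul]
      nlinarith [hre (ξ k).2, sq_nonneg ((ξ k).1 : ℝ)]
    · rw [norm_mul, norm_neg, norm_pow, norm_real, Real.norm_of_nonneg (ξ k).1.2.le]
      gcongr
      exact hM _
  have hm := multipliable_one_add_of_summable hs
  simp only [add_sub_cancel] at hm
  exact hm.hasProd.tendsto_prod_nat

theorem measurable_sum_weights : Measurable fun ξ : Config X => ∑' k, ((ξ k).1 : ℝ) :=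
  Measurable.tsum fun k => measurable_weight k

theorem measurable_laplaceProd (ρ : ℂ →L[ℝ] 𝕜) {f : X → ℂ} (hf : Measurable f) :
    Measurable (laplaceProd ρ f) := by
  refine Measurable.tprod fun k => ρ.continuous.measurable.comp (Measurable.cexp ?_)
  exact (((Complex.measurable_ofReal.comp (measurable_weight k)).pow_const 2).neg).mul
    (hf.comp (measurable_point k))

/-- The Laplace functional of `𝓛`: the integral of `∏ ρ(exp(-r_k² f(x_k)))` is the exponential of
`ρ(∫ (C - ½ log f) dm)` for a constant `C`. -/
theorem laplace (hρ : IsScalarMap ρ) {f : X → ℂ}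
    (hf : Measurable f) {M δ : ℝ} (hδ : 0 < δ) (hM : ∀ x, ‖f x‖ ≤ M) (hre : ∀ x, δ ≤ (f x).re) :
    Integrable (laplaceProd ρ f) (lebesgueInf m) ∧ ∫ ξ, laplaceProd ρ f ξ ∂lebesgueInf m =
      NormedSpace.exp (ρ (∫ x, (expoInt 1 - 1 / 2 * log (f x)) ∂m)) := by
  obtain ⟨B, K, hmult⟩ := isMult_laplaceFactor hρ hf hδ hM hre
  have hlim : ∀ᵐ ω ∂seqLaw m, Tendsto (multPart (laplaceFactor ρ f) ω) atTop
      (𝓝 (Real.exp (∑' k, ((gammaConfig ω k).1 : ℝ)) • laplaceProd ρ f (gammaConfig ω))) := by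
    filter_upwards [ae_summable_weights m] with ω hω
    have h1 := laplaceProd_tendsto (ξ := gammaConfig ω) hρ hM (fun x => hδ.le.trans (hre x)) hω
    have h2 : Tendsto (fun N => Real.exp (∑ k ∈ Finset.range N, ((gammaConfig ω k).1 : ℝ))) atTop
        (𝓝 (Real.exp (∑' k, ((gammaConfig ω k).1 : ℝ)))) :=
      (Real.continuous_exp.tendsto _).comp hω.hasSum.tendsto_sum_nat
    refine (h2.smul h1).congr fun N => ?_
    rw [multPart, RCLike.real_smul_eq_coe_mul, Real.exp_sum]
    push_cast
    rw [← Finset.prod_mul_distrib]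
    exact Finset.prod_congr rfl fun k _ => (laplaceFactor_eq _ _ _).symm
  obtain ⟨h1, h2⟩ := hmult.integral_prod hlim
  have hm : Measurable (laplaceProd ρ f) := measurable_laplaceProd ρ hf
  have hd : Measurable fun ξ : Config X => ENNReal.ofReal (Real.exp (∑' k, ((ξ k).1 : ℝ))) :=
    (Real.measurable_exp.comp measurable_sum_weights).ennreal_ofReal
  have hd' : Measurable fun ξ : Config X =>
      (ENNReal.ofReal (Real.exp (∑' k, ((ξ k).1 : ℝ)))).toReal • laplaceProd ρ f ξ :=
    hd.ennreal_toReal.smul hm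
  have he : ∀ ξ : Config X, (ENNReal.ofReal (Real.exp (∑' k, ((ξ k).1 : ℝ)))).toReal =
      Real.exp (∑' k, ((ξ k).1 : ℝ)) := fun ξ => ENNReal.toReal_ofReal (Real.exp_pos _).le
  constructor
  · rw [lebesgueInf, integrable_withDensity_iff_integrable_smul' hd
      (Eventually.of_forall fun _ => ENNReal.ofReal_lt_top), gammaLaw,
      integrable_map_measure hd'.aestronglyMeasurable measurable_gammaConfig.aemeasurable]
    refine h1.congr (Eventually.of_forall fun ω => ?_)
    simp only [Function.comp_apply, he]
  · rw [← integral_laplaceFactor m hρ hf hδ hM hre, ← h2, lebesgueInf,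
      integral_withDensity_eq_integral_toReal_smul hd
        (Eventually.of_forall fun _ => ENNReal.ofReal_lt_top), gammaLaw,
      integral_map measurable_gammaConfig.aemeasurable hd'.aestronglyMeasurable]
    refine integral_congr_ae (Eventually.of_forall fun ω => ?_)
    simp only [he]

end Laplace

/-! ### Decomposable vectors of the countable tensor product -/

section TensorLemmas

variable {𝕜 : Type*} [RCLike 𝕜] {E : Type*} [NormedAddCommGroup E] [InnerProductSpace 𝕜 E]
  {h : UnitVec E}

theorem inner_vac (h : UnitVec E) : ⟪(h : E), h⟫_𝕜 = 1 := by
  rw [inner_self_eq_norm_sq_to_K, h.2]; simp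

theorem norm_inner_sub_one_le {x y : E} : ‖⟪x, y⟫_𝕜 - 1‖ ≤
    ‖x - h‖ * ‖y - h‖ + ‖x - h‖ + ‖y - h‖ := by
  have e : ⟪x, y⟫_𝕜 - 1 = ⟪x - h, y - h⟫_𝕜 + ⟪x - h, (h : E)⟫_𝕜 + ⟪(h : E), y - h⟫_𝕜 := by
    simp only [inner_sub_left, inner_sub_right, inner_vac]; ring
  rw [e]
  refine (norm_add_le _ _).trans (add_le_add ((norm_add_le _ _).trans (add_le_add ?_ ?_)) ?_)
  · exact norm_inner_le_norm _ _
  · simpa [h.2] using norm_inner_le_norm (𝕜 := 𝕜) (x - h) (h : E)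
  · simpa [h.2] using norm_inner_le_norm (𝕜 := 𝕜) (h : E) (y - h)

theorem tprod_of_summable {f : ℕ → E} (hf : Summable fun k => ‖f k - h‖) :
    tprod 𝕜 h f = admTprod 𝕜 (⟨f, hf⟩ : Adm h) := dif_pos hf

theorem inner_tprod {f g : ℕ → E} (hf : Summable fun k => ‖f k - h‖)
    (hg : Summable fun k => ‖g k - h‖) : ⟪tprod 𝕜 h f, tprod 𝕜 h g⟫_𝕜 = ∏' k, ⟪f k, g k⟫_𝕜 := by
  rw [tprod_of_summable hf, tprod_of_summable hg, inner_admTprod]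

/-- Dominated convergence for the inner products of decomposable vectors. -/
theorem tendsto_inner_tprod {ι : Type*} {l : Filter ι} {f g : ι → ℕ → E} {f₀ g₀ : ℕ → E}
    {b : ℕ → ℝ} (hb : Summable b) (hf : ∀ i k, ‖f i k - h‖ ≤ b k) (hg : ∀ i k, ‖g i k - h‖ ≤ b k)
    (hf₀ : ∀ k, Tendsto (fun i => f i k) l (𝓝 (f₀ k)))
    (hg₀ : ∀ k, Tendsto (fun i => g i k) l (𝓝 (g₀ k))) :
    Tendsto (fun i => ∏' k, ⟪f i k, g i k⟫_𝕜) l (𝓝 (∏' k, ⟪f₀ k, g₀ k⟫_𝕜)) := by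
  rcases isEmpty_or_nonempty ι with hι | ⟨⟨i₀⟩⟩
  · rw [Subsingleton.elim l ⊥]
    exact tendsto_bot
  have hb0 : ∀ k, 0 ≤ b k := fun k => (norm_nonneg _).trans (hf i₀ k)
  have := tendsto_tprod_one_add_of_dominated_convergence (𝓕 := l)
    (f := fun i k => ⟪f i k, g i k⟫_𝕜 - 1) (g := fun k => ⟪f₀ k, g₀ k⟫_𝕜 - 1)
    (bound := fun k => b k * b k + b k + b k) ?_ (fun k => ?_) (Eventually.of_forall fun i k => ?_)
  · simpa only [add_sub_cancel] using this
  · have := summable_sq hb0 hb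
    simp only [pow_two] at this
    exact (this.add hb).add hb
  · exact ((hf₀ k).inner (hg₀ k)).sub_const 1
  · refine (norm_inner_sub_one_le (h := h)).trans ?_
    have := hf i k
    have := hg i k
    have := hb0 k
    gcongr

/-- Dominated convergence for decomposable vectors. -/
theorem tendsto_tprod_vec {ι : Type*} {l : Filter ι} {f : ι → ℕ → E} {f₀ : ℕ → E}
    {b : ℕ → ℝ} (hb : Summable b) (hf : ∀ i k, ‖f i k - h‖ ≤ b k)
    (hf₀' : ∀ k, ‖f₀ k - h‖ ≤ b k) (hf₀ : ∀ k, Tendsto (fun i => f i k) l (𝓝 (f₀ k))) :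
    Tendsto (fun i => tprod 𝕜 h (f i)) l (𝓝 (tprod 𝕜 h f₀)) := by
  have hs : ∀ i, Summable fun k => ‖f i k - h‖ := fun i =>
    hb.of_nonneg_of_le (fun _ => norm_nonneg _) (hf i)
  have hs₀ : Summable fun k => ‖f₀ k - h‖ := hb.of_nonneg_of_le (fun _ => norm_nonneg _) hf₀'
  rw [tendsto_iff_norm_sub_tendsto_zero]
  have h1 := tendsto_inner_tprod (𝕜 := 𝕜) hb hf hf hf₀ hf₀
  have h2 := tendsto_inner_tprod (𝕜 := 𝕜) (l := l) hb (fun _ => hf₀') hf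
    (fun k => tendsto_const_nhds) hf₀
  have h3 : Tendsto (fun i => ‖tprod 𝕜 h (f i) - tprod 𝕜 h f₀‖ ^ 2) l (𝓝 0) := by
    have h4 : Tendsto (fun i => RCLike.re (∏' k, ⟪f i k, f i k⟫_𝕜) -
        2 * RCLike.re (∏' k, ⟪f₀ k, f i k⟫_𝕜) + RCLike.re (∏' k, ⟪f₀ k, f₀ k⟫_𝕜)) l
        (𝓝 (RCLike.re (∏' k, ⟪f₀ k, f₀ k⟫_𝕜) -
        2 * RCLike.re (∏' k, ⟪f₀ k, f₀ k⟫_𝕜) + RCLike.re (∏' k, ⟪f₀ k, f₀ k⟫_𝕜))) :=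
      ((((RCLike.continuous_re.tendsto _).comp h1).sub
        (((RCLike.continuous_re.tendsto _).comp h2).const_mul 2))).add tendsto_const_nhds
    have h5 : RCLike.re (∏' k, ⟪f₀ k, f₀ k⟫_𝕜) - 2 * RCLike.re (∏' k, ⟪f₀ k, f₀ k⟫_𝕜) +
        RCLike.re (∏' k, ⟪f₀ k, f₀ k⟫_𝕜) = 0 := by ring
    rw [h5] at h4
    refine h4.congr fun i => ?_
    rw [@norm_sub_sq 𝕜, ← inner_tprod (hs i) (hs i), ← inner_tprod hs₀ (hs i),
      ← inner_tprod hs₀ hs₀, inner_self_eq_norm_sq, inner_self_eq_norm_sq, inner_re_symm]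
  have h6 := (Real.continuous_sqrt.tendsto 0).comp h3
  simpa [Function.comp_def, Real.sqrt_sq (norm_nonneg _)] using h6

/-- The truncation `(f_0, …, f_{N-1}, h, h, …)`. -/
def truncSeq (h : UnitVec E) (f : ℕ → E) (N k : ℕ) : E := if k < N then f k else h

theorem norm_truncSeq_sub_le (f : ℕ → E) (N k : ℕ) : ‖truncSeq h f N k - h‖ ≤ ‖f k - h‖ := by
  unfold truncSeq
  split_ifs
  · exact le_rfl
  · simp

theorem summable_truncSeq (f : ℕ → E) (N : ℕ) : Summable fun k => ‖truncSeq h f N k - h‖ := by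
  refine summable_of_hasFiniteSupport ((Set.finite_lt_nat N).subset fun k hk => ?_)
  by_contra h1
  have h2 : ¬ k < N := h1
  simp [truncSeq, h2] at hk

theorem tendsto_truncSeq {f : ℕ → E} (hf : Summable fun k => ‖f k - h‖) :
    Tendsto (fun N => tprod 𝕜 h (truncSeq h f N)) atTop (𝓝 (tprod 𝕜 h f)) := by
  refine tendsto_tprod_vec hf (fun N k => norm_truncSeq_sub_le f N k) (fun k => le_rfl) fun k => ?_
  refine tendsto_const_nhds.congr' ?_
  filter_upwards [eventually_gt_atTop k] with N hN
  simp [truncSeq, hN]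

variable (𝕜) in
theorem dense_span_admTprod (h : UnitVec E) :
    (Submodule.span 𝕜 (Set.range (admTprod 𝕜 (h := h)))).topologicalClosure = ⊤ := by
  rw [← Submodule.dense_iff_topologicalClosure_eq_top]
  refine (UniformSpace.Completion.denseRange_coe (α := PreTensor 𝕜 h)).mono ?_
  rintro _ ⟨x, rfl⟩
  induction x using Finsupp.induction_linear with
  | zero => exact Submodule.zero_mem _
  | add f g hf hg =>
    have := Submodule.add_mem _ hf hg
    exact (UniformSpace.Completion.coe_add (α := PreTensor 𝕜 h) f g).symm ▸ this
  | single f c =>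
    have h1 : (Finsupp.single f c : Adm h →₀ 𝕜) = c • (Finsupp.single f 1 : Adm h →₀ 𝕜) := by
      simp
    have h2 := Submodule.smul_mem (Submodule.span 𝕜 (Set.range (admTprod 𝕜 (h := h)))) c
      (Submodule.subset_span ⟨f, rfl⟩)
    rw [h1]
    exact (UniformSpace.Completion.coe_smul (X := PreTensor 𝕜 h) c (preTprod 𝕜 f)).symm ▸ h2

theorem summable_update {f : ℕ → E} (hf : Summable fun k => ‖f k - h‖) (j : ℕ) (g : E) :
    Summable fun k => ‖Function.update f j g k - h‖ := by
  refine hf.congr_cofinite ?_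
  refine (Set.finite_singleton j).subset fun k hk => ?_
  by_contra hne
  exact hk (by simp [Function.update_of_ne hne])

theorem multipliable_inner {f g : ℕ → E} (hf : Summable fun k => ‖f k - h‖)
    (hg : Summable fun k => ‖g k - h‖) : Multipliable fun k => ⟪f k, g k⟫_𝕜 := by
  have hs : Summable fun k => ‖⟪f k, g k⟫_𝕜 - 1‖ := by
    refine Summable.of_nonneg_of_le (fun _ => norm_nonneg _)
      (fun k => norm_inner_sub_one_le (h := h)) ((Summable.add ?_ hf).add hg)
    refine Summable.of_nonneg_of_le (fun _ => by positivity) (fun k => ?_)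
      (hf.mul_right (∑' k, ‖g k - h‖))
    exact mul_le_mul_of_nonneg_left (hg.le_tsum k fun _ _ => norm_nonneg _) (norm_nonneg _)
  simpa using multipliable_one_add_of_summable hs

theorem inner_tprod_update {f g : ℕ → E} (hf : Summable fun k => ‖f k - h‖)
    (hg : Summable fun k => ‖g k - h‖) (j : ℕ) (y : E) :
    ⟪tprod 𝕜 h f, tprod 𝕜 h (Function.update g j y)⟫_𝕜 =
      ⟪f j, y⟫_𝕜 * ∏' k, if k = j then 1 else ⟪f k, g k⟫_𝕜 := by
  rw [inner_tprod hf (summable_update hg j y), Multipliable.tprod_eq_mul_tprod_ite' j]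
  · rw [Function.update_self]
    congr 1
    refine tprod_congr fun k => ?_
    split_ifs with hk
    · rfl
    · rw [Function.update_of_ne hk]
  · refine (multipliable_inner (𝕜 := 𝕜) (summable_update hf j h) (summable_update hg j h)).congr
      fun k => ?_
    by_cases hk : k = j
    · subst hk
      simp only [Function.update_self, inner_vac]
    · simp only [Function.update_of_ne hk]

/-- Vectors of the tensor product with the same inner products with all decomposable vectors are
equal. -/
theorem TensorPow.ext_inner {x y : TensorPow 𝕜 h}
    (hxy : ∀ f : ℕ → E, Summable (fun k => ‖f k - h‖) →
      ⟪tprod 𝕜 h f, x⟫_𝕜 = ⟪tprod 𝕜 h f, y⟫_𝕜) : x = y := by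
  have h1 : ∀ z : TensorPow 𝕜 h, ⟪z, x - y⟫_𝕜 = 0 := by
    have h2 : Submodule.span 𝕜 (Set.range (admTprod 𝕜 (h := h))) ≤ (𝕜 ∙ (x - y))ᗮ := by
      refine Submodule.span_le.2 ?_
      rintro _ ⟨f, rfl⟩
      rw [SetLike.mem_coe, Submodule.mem_orthogonal_singleton_iff_inner_left, inner_sub_right,
        ← tprod_of_summable f.2, hxy _ f.2, sub_self]
    have h3 := Submodule.topologicalClosure_minimal _ h2 (Submodule.isClosed_orthogonal _)
    rw [dense_span_admTprod] at h3
    exact fun z => Submodule.mem_orthogonal_singleton_iff_inner_left.1 (h3 trivial)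
  exact sub_eq_zero.1 (inner_self_eq_zero.1 (h1 (x - y)))

variable (𝕜) in
/-- The map `y ↦ g_0 ⊗ ⋯ ⊗ g_{j-1} ⊗ y ⊗ g_{j+1} ⊗ ⋯`. -/
def slotMap {g : ℕ → E} (hg : Summable fun k => ‖g k - h‖) (j : ℕ) : E →L[𝕜] TensorPow 𝕜 h :=
  LinearMap.mkContinuous
    { toFun := fun y => tprod 𝕜 h (Function.update g j y)
      map_add' := fun y z => TensorPow.ext_inner fun f hf => by
        rw [inner_add_right, inner_tprod_update hf hg, inner_tprod_update hf hg,
          inner_tprod_update hf hg, inner_add_right, add_mul]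
      map_smul' := fun c y => TensorPow.ext_inner fun f hf => by
        rw [RingHom.id_apply, inner_smul_right, inner_tprod_update hf hg, inner_tprod_update hf hg,
          inner_smul_right, mul_assoc] }
    (√|RCLike.re (∏' k, if k = j then 1 else ⟪g k, g k⟫_𝕜)|) fun y => by
      refine (sq_le_sq₀ (norm_nonneg _) (by positivity)).1 ?_
      rw [mul_pow, Real.sq_sqrt (abs_nonneg _)]
      change ‖tprod 𝕜 h (Function.update g j y)‖ ^ 2 ≤ _
      rw [← inner_self_eq_norm_sq (𝕜 := 𝕜)]
      have h1 := inner_tprod_update (𝕜 := 𝕜) (summable_update hg j y) hg j y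
      have h2 : (∏' k, if k = j then (1 : 𝕜) else ⟪Function.update g j y k, g k⟫_𝕜) =
          ∏' k, if k = j then 1 else ⟪g k, g k⟫_𝕜 := tprod_congr fun k => by
        split_ifs with hk
        · rfl
        · rw [Function.update_of_ne hk]
      rw [h1, h2, Function.update_self, inner_self_eq_norm_sq_to_K, ← RCLike.ofReal_pow,
        RCLike.re_ofReal_mul, mul_comm]
      exact mul_le_mul_of_nonneg_right (le_abs_self _) (sq_nonneg _)

theorem slotMap_apply {g : ℕ → E} (hg : Summable fun k => ‖g k - h‖) (j : ℕ) (y : E) :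
    slotMap 𝕜 hg j y = tprod 𝕜 h (Function.update g j y) := rfl

/-- If a set of vectors is total in `E`, then the decomposable vectors with finitely many factors
from this set and all other factors equal to `h` are total in the tensor product. -/
theorem eq_top_of_trunc_mem {S : Set E} (hS : (Submodule.span 𝕜 S).topologicalClosure = ⊤)
    {D : Submodule 𝕜 (TensorPow 𝕜 h)} (hD : IsClosed (D : Set (TensorPow 𝕜 h)))
    (hmem : ∀ N, ∀ f : ℕ → E, (∀ k < N, f k ∈ S) → tprod 𝕜 h (truncSeq h f N) ∈ D) : D = ⊤ := by
  have key : ∀ N j, ∀ f : ℕ → E, (∀ k, j ≤ k → k < N → f k ∈ S) →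
      tprod 𝕜 h (truncSeq h f N) ∈ D := by
    intro N j
    induction j with
    | zero => exact fun f hf => hmem N f fun k hk => hf k (Nat.zero_le k) hk
    | succ j ih =>
      intro f hf
      rcases le_or_gt N j with hj | hj
      · exact ih f fun k h1 h2 => absurd (hj.trans h1) (not_le.2 h2)
      have hupd : ∀ y, Function.update (truncSeq h f N) j y =
          truncSeq h (Function.update f j y) N := by
        intro y
        funext k
        by_cases hk : k = j
        · subst hk
          simp [truncSeq, hj]
        · simp [truncSeq, Function.update_of_ne hk]
      have hle : Submodule.span 𝕜 S ≤ D.comap (slotMap 𝕜 (summable_truncSeq f N) j).toLinearMap := by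
        refine Submodule.span_le.2 fun y hy => ?_
        change slotMap 𝕜 (summable_truncSeq f N) j y ∈ D
        rw [slotMap_apply, hupd]
        refine ih _ fun k h1 h2 => ?_
        by_cases hk : k = j
        · subst hk
          simpa using hy
        · rw [Function.update_of_ne hk]
          exact hf k (lt_of_le_of_ne h1 (Ne.symm hk)) h2
      have hcl := Submodule.topologicalClosure_minimal _ hle
        (hD.preimage (slotMap 𝕜 (summable_truncSeq f N) j).continuous)
      rw [hS] at hcl
      have := hcl (show f j ∈ (⊤ : Submodule 𝕜 E) from trivial)
      change slotMap 𝕜 (summable_truncSeq f N) j (f j) ∈ D at this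
      rwa [slotMap_apply, hupd, Function.update_eq_self] at this
  have hall : Submodule.span 𝕜 (Set.range (admTprod 𝕜 (h := h))) ≤ D := by
    refine Submodule.span_le.2 ?_
    rintro _ ⟨f, rfl⟩
    rw [SetLike.mem_coe, ← tprod_of_summable f.2]
    exact hD.mem_of_tendsto (tendsto_truncSeq f.2)
      (Eventually.of_forall fun N => key N N _ fun k h1 h2 => absurd h1 (not_le.2 h2))
  have := Submodule.topologicalClosure_minimal _ hall hD
  rw [dense_span_admTprod] at this
  exact top_le_iff.1 this

theorem tensorOp_tprod {A : ℕ → E →ₗᵢ[𝕜] E} (hA : Summable fun k => ‖A k h - h‖) {f : ℕ → E}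
    (hf : Summable fun k => ‖f k - h‖) :
    tensorOp h A (tprod 𝕜 h f) = tprod 𝕜 h fun k => A k (f k) := by
  rw [tprod_of_summable hf, tensorOp, dif_pos hA]
  refine (inducedOp_admTprod 𝕜 _ _ _).trans ?_
  exact (tprod_of_summable (admMap A hA ⟨f, hf⟩).2).symm

theorem permOp_tprod (σ : Equiv.Perm ℕ) {f : ℕ → E} (hf : Summable fun k => ‖f k - h‖) :
    permOp 𝕜 h σ (tprod 𝕜 h f) = tprod 𝕜 h fun k => f (σ.symm k) := by
  have hs : Summable fun k => ‖f (σ.symm k) - h‖ := hf.comp_injective σ.symm.injective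
  rw [tprod_of_summable hf, tprod_of_summable (f := fun k => f (σ.symm k)) hs]
  exact inducedOp_admTprod 𝕜 _ _ _

end TensorLemmas

/-! ### Exponential vectors in the Fock spaces -/

section Fock

variable {d : ℕ}

theorem integral_gauss (F : (Fin d → ℂ) → ℂ) :
    ∫ z, F z ∂gauss d = ∫ z, (gaussDensity d z : ℂ) * F z := by
  rw [gauss, integral_withDensity_eq_integral_toReal_smul₀
    (f := fun z => ENNReal.ofReal (gaussDensity d z))
    (ENNReal.measurable_ofReal.comp (continuous_gaussDensity d).measurable).aemeasurable
    (Eventually.of_forall fun z => ENNReal.ofReal_lt_top)]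
  refine integral_congr_ae (Eventually.of_forall fun z => ?_)
  change (ENNReal.ofReal (gaussDensity d z)).toReal • F z = _
  rw [ENNReal.toReal_ofReal (gaussDensity_pos d z).le, Complex.real_smul]

theorem integrable_gauss_iff (F : (Fin d → ℂ) → ℂ) :
    Integrable F (gauss d) ↔ Integrable fun z => (gaussDensity d z : ℂ) * F z := by
  rw [gauss, integrable_withDensity_iff_integrable_smul'
    (f := fun z => ENNReal.ofReal (gaussDensity d z))
    (ENNReal.measurable_ofReal.comp (continuous_gaussDensity d).measurable)
    (Eventually.of_forall fun z => ENNReal.ofReal_lt_top)]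
  refine integrable_congr (Eventually.of_forall fun z => ?_)
  change (ENNReal.ofReal (gaussDensity d z)).toReal • F z = _
  rw [ENNReal.toReal_ofReal (gaussDensity_pos d z).le, Complex.real_smul]

theorem volume_preserving_rotation (c : Circle) :
    MeasurePreserving (fun z : Fin d → ℂ => (c : ℂ) • z) volume volume :=
  volume_preserving_pi (fun _ : Fin d => (rotation c).measurePreserving)

theorem gauss_preserving_rotation (c : Circle) :
    MeasurePreserving (fun z : Fin d → ℂ => (c : ℂ) • z) (gauss d) (gauss d) := by
  have hm : Measurable fun z : Fin d → ℂ => (c : ℂ) • z := measurable_const_smul _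
  refine ⟨hm, ?_⟩
  ext s hs
  have hd : Measurable fun z => ENNReal.ofReal (gaussDensity d z) :=
    ENNReal.measurable_ofReal.comp (continuous_gaussDensity d).measurable
  rw [Measure.map_apply hm hs, gauss, withDensity_apply _ (hm hs), withDensity_apply _ hs,
    ← (volume_preserving_rotation c).setLIntegral_comp_preimage hs hd]
  have hn : ∀ a : Fin d → ℂ, ∑ i, ‖((c : ℂ) • a) i‖ ^ 2 = ∑ i, ‖a i‖ ^ 2 := fun a => by
    refine Finset.sum_congr rfl fun i _ => ?_
    rw [Pi.smul_apply, norm_smul, Circle.norm_coe, one_mul]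
  simp only [gaussDensity, hn]

/-- The mean value property of entire functions, averaged over the Gaussian measure, which is
invariant under `z ↦ e^{iθ} z`. -/
theorem integral_gauss_entire {g : (Fin d → ℂ) → ℂ} (hg : Differentiable ℂ g)
    (hi : Integrable g (gauss d)) : ∫ z, g z ∂gauss d = g 0 := by
  have hrot : ∀ θ : ℝ, ∫ z, g (circleMap 0 1 θ • z) ∂gauss d = ∫ z, g z ∂gauss d := by
    intro θ
    have h1 := gauss_preserving_rotation (d := d) (Circle.exp θ)
    have h2 := integral_map h1.measurable.aemeasurable (μ := gauss d)
      (hg.continuous.aestronglyMeasurable (μ := Measure.map _ (gauss d)))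
    rw [h1.map_eq] at h2
    rw [h2]
    simp [circleMap]
  have hmean : ∀ z, ∫ θ in (0 : ℝ)..2 * Real.pi, g (circleMap 0 1 θ • z) = (2 * Real.pi) • g 0 := by
    intro z
    have h1 : Differentiable ℂ fun w : ℂ => g (w • z) :=
      hg.comp (differentiable_id.smul_const z)
    have h2 := (h1.diffContOnCl (s := Metric.ball 0 |1|)).circleAverage
    rw [Real.circleAverage_def] at h2
    have h3 : (2 * Real.pi) ≠ 0 := by positivity
    rw [inv_smul_eq_iff₀ h3] at h2
    rw [h2, zero_smul]
  have hnorm : ∀ θ : ℝ, ∫ z, ‖g (circleMap 0 1 θ • z)‖ ∂gauss d = ∫ z, ‖g z‖ ∂gauss d := by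
    intro θ
    have h1 := gauss_preserving_rotation (d := d) (Circle.exp θ)
    have h2 := integral_map h1.measurable.aemeasurable (μ := gauss d)
      (hg.continuous.norm.aestronglyMeasurable (μ := Measure.map _ (gauss d)))
    rw [h1.map_eq] at h2
    rw [h2]
    simp [circleMap]
  have hcont : Continuous (Function.uncurry fun (θ : ℝ) (z : Fin d → ℂ) =>
      g (circleMap 0 1 θ • z)) :=
    hg.continuous.comp (((continuous_circleMap 0 1).comp continuous_fst).smul continuous_snd)
  have : IsFiniteMeasure (volume.restrict (Set.uIoc 0 (2 * Real.pi))) := ⟨by simp [Set.uIoc]⟩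
  have hint : Integrable (Function.uncurry fun (θ : ℝ) (z : Fin d → ℂ) =>
      g (circleMap 0 1 θ • z)) ((volume.restrict (Set.uIoc 0 (2 * Real.pi))).prod (gauss d)) := by
    rw [integrable_prod_iff hcont.aestronglyMeasurable]
    refine ⟨Eventually.of_forall fun θ => ?_, ?_⟩
    · have h1 := (gauss_preserving_rotation (d := d) (Circle.exp θ)).integrable_comp_of_integrable hi
      refine h1.congr (Eventually.of_forall fun z => ?_)
      simp [circleMap]
    · simp only [Function.uncurry, hnorm]
      exact integrable_const _
  have h1 := intervalIntegral_integral_swap hint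
  simp only [hrot, hmean, intervalIntegral.integral_const, integral_const, sub_zero] at h1
  simpa [Real.pi_ne_zero] using h1

/-- A translation of the Gaussian density produces an exponential function. -/
theorem gaussDensity_translate (w y : Fin d → ℂ) : (gaussDensity d (w + y) : ℂ) *
    conj (exp ((w + y) ⬝ᵥ star y)) = gaussDensity d w * exp (-(w ⬝ᵥ star y)) := by
  unfold gaussDensity
  push_cast
  rw [← Complex.exp_conj, mul_assoc, mul_assoc, ← Complex.exp_add, ← Complex.exp_add]
  congr 2
  have h1 : ∀ z : Fin d → ℂ, (∑ i, (‖z i‖ : ℂ) ^ 2) = z ⬝ᵥ star z := fun z => by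
    rw [← sum_norm_sq]; push_cast; rfl
  rw [h1, h1]
  have h2 : conj ((w + y) ⬝ᵥ star y) = star (w + y) ⬝ᵥ y := by
    simp [dotProduct, mul_comm]
  rw [h2]
  simp only [star_add, add_dotProduct, dotProduct_add, dotProduct_comm (star y),
    dotProduct_comm (star w)]
  ring

/-- The reproducing property of the exponential functions: a translation by `y` reduces it to the
mean value property. -/
theorem integral_reproducing {f : (Fin d → ℂ) → ℂ} (hf : Differentiable ℂ f) (y : Fin d → ℂ)
    (hi : Integrable (fun z => conj (exp (z ⬝ᵥ star y)) * f z) (gauss d)) :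
    ∫ z, conj (exp (z ⬝ᵥ star y)) * f z ∂gauss d = f y := by
  have hg : Differentiable ℂ fun w : Fin d → ℂ => exp (-(w ⬝ᵥ star y)) * f (w + y) := by
    unfold dotProduct
    exact Differentiable.mul (by fun_prop) (hf.comp (differentiable_id.add_const y))
  have e : ∀ w, (gaussDensity d (w + y) : ℂ) * (conj (exp ((w + y) ⬝ᵥ star y)) * f (w + y)) =
      gaussDensity d w * (exp (-(w ⬝ᵥ star y)) * f (w + y)) := fun w => by
    rw [← mul_assoc, gaussDensity_translate, mul_assoc]
  have hgi : Integrable (fun w => exp (-(w ⬝ᵥ star y)) * f (w + y)) (gauss d) := by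
    rw [integrable_gauss_iff] at hi ⊢
    exact (hi.comp_add_right y).congr (Eventually.of_forall e)
  have := integral_gauss_entire hg hgi
  simp only [zero_dotProduct, neg_zero, Complex.exp_zero, one_mul, zero_add] at this
  rw [← this, integral_gauss, integral_gauss, ← integral_add_right_eq_self _ y]
  exact integral_congr_ae (Eventually.of_forall e)

theorem inner_H (f g : H ε d) : ⟪f, g⟫_ℂ = ∫ z, conj (f.toFun z) * g.toFun z ∂gauss d := rfl

theorem inner_expVec_plus (β : Fin d → ℂ) (f : H .plus d) :
    ⟪expVec .plus 0 β, f⟫_ℂ = f.toFun (star β) := by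
  have h1 := Fock.integrable_inner (⟨expFun .plus 0 β, expFun_mem .plus 0 β⟩ : Fock .plus d) f
  have h2 : (fun z => conj (expFun .plus 0 β z) * f.toFun z) =
      fun z => conj (exp (z ⬝ᵥ star (star β))) * f.toFun z := by
    funext z
    simp [expFun, cj]
  have h3 := integral_reproducing (f := f.toFun) f.2.1 (star β) (h2 ▸ h1)
  rw [← h3, inner_H]
  exact congrArg (fun F => ∫ z, F z ∂gauss d) h2

theorem expVec_plus_smul (α : ℂ) (β : Fin d → ℂ) :
    expVec .plus α β = exp α • expVec .plus 0 β := by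
  refine Subtype.ext (funext fun z => ?_)
  change exp (α + z ⬝ᵥ β) = exp α * exp (0 + z ⬝ᵥ β)
  rw [zero_add, Complex.exp_add]

theorem inner_expVec_expVec_plus (α α' : ℂ) (β β' : Fin d → ℂ) :
    ⟪expVec .plus α β, expVec .plus α' β'⟫_ℂ = exp (conj α + α' + star β ⬝ᵥ β') := by
  rw [expVec_plus_smul, inner_smul_left, inner_expVec_plus, ← Complex.exp_conj, add_assoc,
    Complex.exp_add]
  rfl

theorem H.real_smul_eq (c : ℝ) (f : H ε d) : c • f = (c : ℂ) • f := rfl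

theorem H.memLp (f : H ε d) : MemLp f.toFun 2 (gauss d) := f.2.2

/-- The inclusion of `H^+` in the space `L²` of the Gaussian measure. -/
def fockToL2 (d : ℕ) : H .plus d →ₗᵢ[ℂ] Lp ℂ 2 (gauss d) :=
  LinearMap.isometryOfInner
    { toFun := fun f => MemLp.toLp f.toFun (H.memLp f)
      map_add' := fun f g => MemLp.toLp_add (H.memLp f) (H.memLp g)
      map_smul' := fun c f => MemLp.toLp_const_smul c (H.memLp f) } fun f g => by
    rw [MeasureTheory.L2.inner_def, inner_H]
    refine integral_congr_ae ?_
    filter_upwards [MemLp.coeFn_toLp (H.memLp f), MemLp.coeFn_toLp (H.memLp g)] with z hf hg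
    change inner ℂ ((MemLp.toLp f.toFun (H.memLp f) : Lp ℂ 2 (gauss d)) z)
      ((MemLp.toLp g.toFun (H.memLp g) : Lp ℂ 2 (gauss d)) z) = _
    rw [hf, hg, RCLike.inner_apply, mul_comm]

theorem fockToL2_ae (f : H .plus d) : fockToL2 d f =ᵐ[gauss d] f.toFun := MemLp.coeFn_toLp (H.memLp f)

/-- The exponential vectors are total in `H^+`: by the reproducing property, a sequence of their
linear combinations that converges in `L²` to the projection of `f` converges pointwise to `f`. -/
theorem dense_span_expVec_plus (d : ℕ) : Dense (Submodule.span ℂ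
    (Set.range fun p : ℂ × (Fin d → ℂ) => expVec .plus p.1 p.2) : Set (H .plus d)) := by
  intro f
  set V := Submodule.span ℂ (Set.range fun p : ℂ × (Fin d → ℂ) => expVec .plus p.1 p.2) with hV
  set K := (V.map (fockToL2 d).toLinearMap).topologicalClosure with hK
  have : CompleteSpace K := (Submodule.isClosed_topologicalClosure _).completeSpace_coe
  obtain ⟨s, hs, hlim⟩ := mem_closure_iff_seq_limit.1
    (show K.starProjection (fockToL2 d f) ∈ closure (V.map (fockToL2 d).toLinearMap : Set _) from
      K.starProjection_apply_mem _)
  choose t ht hts using hs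
  have hpt : ∀ y, Tendsto (fun n => (t n).toFun y) atTop (𝓝 (f.toFun y)) := by
    intro y
    have h1 : ∀ k : H .plus d, k.toFun y = ⟪fockToL2 d (expVec .plus 0 (star y)), fockToL2 d k⟫_ℂ :=
      fun k => by rw [LinearIsometry.inner_map_map, inner_expVec_plus, star_star]
    have hmem : fockToL2 d (expVec .plus 0 (star y)) ∈ K :=
      Submodule.le_topologicalClosure _
        ⟨_, Submodule.subset_span ⟨(0, star y), rfl⟩, rfl⟩
    have h2 := K.sub_starProjection_mem_orthogonal (fockToL2 d f) _ hmem
    rw [inner_sub_right, sub_eq_zero] at h2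
    rw [h1 f, h2]
    have h3 : ∀ n, (t n).toFun y = ⟪fockToL2 d (expVec .plus 0 (star y)), s n⟫_ℂ := fun n => by
      rw [h1, ← hts n]
      rfl
    simp only [h3]
    exact tendsto_const_nhds.inner hlim
  have hproj : K.starProjection (fockToL2 d f) = fockToL2 d f := by
    obtain ⟨φ, hmono, hφ⟩ := (tendstoInMeasure_of_tendsto_Lp hlim).exists_seq_tendsto_ae
    refine Lp.ext ?_
    have hall : ∀ᵐ z ∂gauss d, ∀ n, (s n : (Fin d → ℂ) → ℂ) z = (t n).toFun z :=
      ae_all_iff.2 fun n => by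
        rw [← hts n]
        exact fockToL2_ae (t n)
    filter_upwards [hφ, hall, fockToL2_ae f] with z h1 h2 h3
    rw [h3]
    simp only [h2] at h1
    exact tendsto_nhds_unique h1 ((hpt z).comp hmono.tendsto_atTop)
  rw [hproj] at hlim
  refine mem_closure_of_tendsto (f := t) (b := atTop) ?_ (Eventually.of_forall ht)
  rw [tendsto_iff_dist_tendsto_zero] at hlim ⊢
  refine hlim.congr fun n => ?_
  rw [← hts n]
  exact (fockToL2 d).isometry.dist_eq _ _

/-- The exponential vectors are also total over the real numbers, because their multiples by
nonzero complex numbers are exponential vectors. -/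
theorem dense_real_span_expVec_plus (d : ℕ) : Dense (Submodule.span ℝ
    (Set.range fun p : ℂ × (Fin d → ℂ) => expVec .plus p.1 p.2) : Set (H .plus d)) := by
  refine (dense_span_expVec_plus d).mono fun f hf => ?_
  have hsmul : ∀ (c : ℂ) (f : H .plus d),
      f ∈ Submodule.span ℝ (Set.range fun p : ℂ × (Fin d → ℂ) => expVec .plus p.1 p.2) →
      c • f ∈ Submodule.span ℝ (Set.range fun p : ℂ × (Fin d → ℂ) => expVec .plus p.1 p.2) := by
    intro c f hf
    induction hf using Submodule.span_induction with
    | mem x hx =>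
      obtain ⟨⟨α, β⟩, rfl⟩ := hx
      rcases eq_or_ne c 0 with rfl | hc
      · rw [zero_smul]
        exact Submodule.zero_mem _
      · refine Submodule.subset_span ⟨(Complex.log c + α, β), ?_⟩
        change expVec .plus (Complex.log c + α) β = c • expVec .plus α β
        rw [expVec_plus_smul, expVec_plus_smul α, smul_smul, Complex.exp_add, Complex.exp_log hc]
    | zero => rw [smul_zero]; exact Submodule.zero_mem _
    | add x y _ _ hx hy => rw [smul_add]; exact Submodule.add_mem _ hx hy
    | smul a x _ hx =>
      rw [H.real_smul_eq, smul_comm, ← H.real_smul_eq]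
      exact Submodule.smul_mem _ _ hx
  induction hf using Submodule.span_induction with
  | mem x hx => exact Submodule.subset_span hx
  | zero => exact Submodule.zero_mem _
  | add x y _ _ hx hy => exact Submodule.add_mem _ hx hy
  | smul a x _ hx => exact hsmul a x hx

theorem dense_span_range_comp {F : Type*} [NormedAddCommGroup F] [NormedSpace ℝ F] {ι : Type*}
    {e : ι → H .plus d} (he : Dense (Submodule.span ℝ (Set.range e) : Set (H .plus d)))
    (J : H .plus d →ₗ[ℝ] F) (hc : Continuous J) (hs : Function.Surjective J) :
    Dense (Submodule.span ℝ (Set.range fun i => J (e i)) : Set F) := by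
  have h1 := hs.denseRange.dense_image hc he
  rwa [← Submodule.map_coe, Submodule.map_span, ← Set.range_comp] at h1

/-- Complex conjugation of functions, `H^+ → H^-`. -/
def conjH (f : H .plus d) : H .minus d :=
  (⟨fun z => conj (f.toFun z), (by
    have h1 : (fun z => cj .minus (conj (f.toFun z))) = fun z => cj .plus (f.toFun z) :=
      funext fun z => Complex.conj_conj _
    rw [h1]
    exact f.2.1 : Differentiable ℂ fun z => cj .minus (conj (f.toFun z))),
    (H.memLp f).star⟩ : Fock .minus d)

theorem conjH_surjective : Function.Surjective (conjH (d := d)) := by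
  intro g
  refine ⟨(⟨fun z => conj (g.toFun z), g.2.1, (H.memLp g).star⟩ : Fock .plus d), ?_⟩
  exact Subtype.ext (funext fun z => Complex.conj_conj _)

theorem inner_conjH (f g : H .plus d) : ⟪conjH f, conjH g⟫_ℂ = conj ⟪f, g⟫_ℂ := by
  rw [inner_H, inner_H, ← integral_conj]
  refine integral_congr_ae (Eventually.of_forall fun z => ?_)
  change conj (conj (f.toFun z)) * conj (g.toFun z) = conj (conj (f.toFun z) * g.toFun z)
  rw [map_mul]

theorem norm_conjH (f : H .plus d) : ‖conjH f‖ = ‖f‖ := by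
  rw [← sq_eq_sq₀ (norm_nonneg _) (norm_nonneg _), ← inner_self_eq_norm_sq (𝕜 := ℂ),
    ← inner_self_eq_norm_sq (𝕜 := ℂ), inner_conjH]
  simp

/-- Complex conjugation as a real-linear isometry. -/
def conjHIso (d : ℕ) : H .plus d →ₗᵢ[ℝ] H .minus d where
  toFun := conjH
  map_add' f g := Subtype.ext (funext fun z => map_add conj (f.toFun z) (g.toFun z))
  map_smul' c f := Subtype.ext (funext fun z => by
    change conj ((c : ℂ) * f.toFun z) = (c : ℂ) * conj (f.toFun z)
    rw [map_mul, Complex.conj_ofReal])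
  norm_map' := norm_conjH

theorem conjH_expVec (α : ℂ) (β : Fin d → ℂ) : conjH (expVec .plus α β) = expVec .minus α β := rfl

theorem inner_expVec_expVec (ε : Sgn) (α α' : ℂ) (β β' : Fin d → ℂ) :
    ⟪expVec ε α β, expVec ε α' β'⟫_ℂ = cj ε (exp (conj α + α' + star β ⬝ᵥ β')) := by
  cases ε
  · exact inner_expVec_expVec_plus α α' β β'
  · rw [← conjH_expVec, ← conjH_expVec, inner_conjH, inner_expVec_expVec_plus]
    rfl

theorem dense_span_expVec (ε : Sgn) (d : ℕ) : Dense (Submodule.span ℂ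
    (Set.range fun p : ℂ × (Fin d → ℂ) => expVec ε p.1 p.2) : Set (H ε d)) := by
  cases ε
  · exact dense_span_expVec_plus d
  · have h1 := dense_span_range_comp (dense_real_span_expVec_plus d) (conjHIso d).toLinearMap
      (conjHIso d).continuous conjH_surjective
    refine h1.mono fun f hf => ?_
    induction hf using Submodule.span_induction with
    | mem x hx => exact Submodule.subset_span hx
    | zero => exact Submodule.zero_mem _
    | add x y _ _ hx hy => exact Submodule.add_mem _ hx hy
    | smul a x _ hx => exact Submodule.smul_mem _ (a : ℂ) hx

/-- The real-linear isometry `f ↦ (2^{-1/2} f, 2^{-1/2} f̄)` of `H^+` onto `H^0`. -/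
def pairH (d : ℕ) : H .plus d →ₗᵢ[ℝ] H0 d where
  toFun f := show pairs d from ⟨WithLp.toLp 2 ((((√2)⁻¹ : ℝ) : ℂ) • f, (((√2)⁻¹ : ℝ) : ℂ) • conjH f),
    fun z => by
      change (((√2)⁻¹ : ℝ) : ℂ) * conj (f.toFun z) = conj ((((√2)⁻¹ : ℝ) : ℂ) * f.toFun z)
      rw [map_mul, Complex.conj_ofReal]⟩
  map_add' f g := by
    apply Subtype.ext
    apply WithLp.ofLp_injective 2
    refine Prod.ext (smul_add _ _ _) ?_
    change (((√2)⁻¹ : ℝ) : ℂ) • conjHIso d (f + g) = _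
    rw [map_add, smul_add]
    rfl
  map_smul' c f := by
    apply Subtype.ext
    apply WithLp.ofLp_injective 2
    refine Prod.ext (smul_comm _ (c : ℂ) f) ?_
    change (((√2)⁻¹ : ℝ) : ℂ) • conjHIso d (c • f) = _
    rw [map_smul]
    exact smul_comm _ (c : ℂ) (conjH f)
  norm_map' f := by
    change ‖WithLp.toLp 2 ((((√2)⁻¹ : ℝ) : ℂ) • f, (((√2)⁻¹ : ℝ) : ℂ) • conjH f)‖ = ‖f‖
    rw [WithLp.prod_norm_eq_of_L2]
    change √(‖(((√2)⁻¹ : ℝ) : ℂ) • f‖ ^ 2 + ‖(((√2)⁻¹ : ℝ) : ℂ) • conjH f‖ ^ 2) = ‖f‖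
    rw [norm_smul, norm_smul, norm_conjH, mul_pow, ← two_mul,
      Complex.norm_real, Real.norm_eq_abs, sq_abs, inv_pow, Real.sq_sqrt zero_le_two,
      ← mul_assoc, mul_inv_cancel₀ two_ne_zero, one_mul, Real.sqrt_sq (norm_nonneg _)]

theorem pairH_surjective (d : ℕ) : Function.Surjective (pairH d) := by
  rintro ⟨p, hp⟩
  have h2 : ((√2)⁻¹ : ℝ) * √2 = 1 := inv_mul_cancel₀ (by positivity)
  have h2c : (((√2)⁻¹ : ℝ) : ℂ) * ((√2 : ℝ) : ℂ) = 1 := by exact_mod_cast h2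
  refine ⟨((√2 : ℝ) : ℂ) • p.fst, ?_⟩
  apply Subtype.ext
  apply WithLp.ofLp_injective 2
  refine Prod.ext ?_ ?_
  · change (((√2)⁻¹ : ℝ) : ℂ) • ((√2 : ℝ) : ℂ) • p.fst = p.fst
    rw [smul_smul, h2c, one_smul]
  · refine Subtype.ext (funext fun z => ?_)
    change (((√2)⁻¹ : ℝ) : ℂ) * conj (((√2 : ℝ) : ℂ) * p.fst.toFun z) = p.snd.toFun z
    rw [map_mul, Complex.conj_ofReal, ← mul_assoc, h2c, one_mul, hp z]

theorem dense_span_expVec0 (d : ℕ) : Dense (Submodule.span ℝ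
    (Set.range fun p : ℂ × (Fin d → ℂ) => expVec0 p.1 p.2) : Set (H0 d)) :=
  dense_span_range_comp (dense_real_span_expVec_plus d) (pairH d).toLinearMap
    (pairH d).continuous (pairH_surjective d)

theorem inner_expVec0 (α α' : ℂ) (β β' : Fin d → ℂ) :
    ⟪expVec0 α β, expVec0 α' β'⟫_ℝ = (exp (conj α + α' + star β ⬝ᵥ β')).re := by
  have h1 : expVec0 α β = pairH d (expVec .plus α β) := rfl
  have h2 : expVec0 α' β' = pairH d (expVec .plus α' β') := rfl
  rw [h1, h2, LinearIsometry.inner_map_map, ← inner_expVec_expVec_plus]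
  rfl

theorem T_expVec (ε : Sgn) (g : Parabolic0 d) (α : ℂ) (β : Fin d → ℂ) :
    T ε g (expVec ε α β) = expVec ε
      (α + (b11 (g : UGroup d))⁻¹ * (b31 (g : UGroup d) + b32 (g : UGroup d) ⬝ᵥ β))
      ((b11 (g : UGroup d))⁻¹ • (b21 (g : UGroup d) + b22 (g : UGroup d) *ᵥ β)) := by
  refine Subtype.ext (funext fun z => ?_)
  change cj ε (multiplier (g : UGroup d) z) * cj ε (exp (α + affMap (g : UGroup d) z ⬝ᵥ β)) =
    cj ε (exp _)
  rw [← cj_mul, multiplier, ← Complex.exp_add]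
  congr 2
  simp only [affMap, smul_dotProduct, add_dotProduct, dotProduct_smul, dotProduct_add,
    smul_eq_mul, ← dotProduct_mulVec]
  ring

theorem T0_expVec0 (g : Parabolic0 d) (α : ℂ) (β : Fin d → ℂ) :
    T0 g (expVec0 α β) = expVec0
      (α + (b11 (g : UGroup d))⁻¹ * (b31 (g : UGroup d) + b32 (g : UGroup d) ⬝ᵥ β))
      ((b11 (g : UGroup d))⁻¹ • (b21 (g : UGroup d) + b22 (g : UGroup d) *ᵥ β)) := by
  apply Subtype.ext
  apply WithLp.ofLp_injective 2
  refine Prod.ext ?_ ?_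
  · change T .plus g ((((√2)⁻¹ : ℝ) : ℂ) • expVec .plus α β) = _ • expVec .plus _ _
    rw [map_smul, T_expVec]
  · change T .minus g ((((√2)⁻¹ : ℝ) : ℂ) • expVec .minus α β) = _ • expVec .minus _ _
    rw [map_smul, T_expVec]

end Fock

/-! ### Sections of the direct integral defined by currents in the Lobachevsky space -/

/-- The data common to the spaces `H^+`, `H^-` and `H^0`: a total family of vectors `e α β` with
inner products `exp(ᾱ + α' + β* β')`, complex-conjugated for `H^-` and replaced by the real part
for `H^0` (this is the map `ρ`), the vacuum vector `e 0 0`, and isometries labelled by `P₀` that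
permute the family. -/
structure ExpSystem (𝕜 : Type*) [RCLike 𝕜] (E : Type*) [NormedAddCommGroup E]
    [InnerProductSpace 𝕜 E] (d : ℕ) where
  ρ : ℂ →L[ℝ] 𝕜
  isScalarMap : IsScalarMap ρ
  vac : UnitVec E
  e : ℂ → (Fin d → ℂ) → E
  S : Parabolic0 d → E →ₗᵢ[𝕜] E
  inner_e : ∀ α β α' β', ⟪e α β, e α' β'⟫_𝕜 = ρ (exp (conj α + α' + star β ⬝ᵥ β'))
  e_zero : e 0 0 = vac
  dense_e : Dense (Submodule.span 𝕜 (Set.range fun p : ℂ × (Fin d → ℂ) => e p.1 p.2) : Set E)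
  S_e : ∀ (g : Parabolic0 d) α β, S g (e α β) =
    e (α + (b11 (g : UGroup d))⁻¹ * (b31 (g : UGroup d) + b32 (g : UGroup d) ⬝ᵥ β))
      ((b11 (g : UGroup d))⁻¹ • (b21 (g : UGroup d) + b22 (g : UGroup d) *ᵥ β))

namespace ExpSystem

variable {𝕜 : Type*} [RCLike 𝕜] {E : Type*} [NormedAddCommGroup E] [InnerProductSpace 𝕜 E] {d : ℕ}
  (A : ExpSystem 𝕜 E d)

theorem norm_sub_sq (α α' : ℂ) (β β' : Fin d → ℂ) : ‖A.e α β - A.e α' β'‖ ^ 2 =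
    (exp (conj α + α + star β ⬝ᵥ β)).re - 2 * (exp (conj α + α' + star β ⬝ᵥ β')).re +
      (exp (conj α' + α' + star β' ⬝ᵥ β')).re := by
  rw [@_root_.norm_sub_sq 𝕜, ← inner_self_eq_norm_sq (𝕜 := 𝕜), ← inner_self_eq_norm_sq (𝕜 := 𝕜),
    A.inner_e, A.inner_e, A.inner_e, A.isScalarMap.re, A.isScalarMap.re, A.isScalarMap.re]

theorem continuous_e : Continuous fun p : ℂ × (Fin d → ℂ) => A.e p.1 p.2 := by
  refine continuous_iff_continuousAt.2 fun q => ?_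
  rw [ContinuousAt, tendsto_iff_norm_sub_tendsto_zero]
  have h : Continuous fun p : ℂ × (Fin d → ℂ) => ‖A.e p.1 p.2 - A.e q.1 q.2‖ ^ 2 := by
    simp only [A.norm_sub_sq, dotProduct, Pi.star_apply, RCLike.star_def]
    fun_prop
  have h2 := (Real.continuous_sqrt.comp h).tendsto q
  simpa [Function.comp_def, Real.sqrt_sq (norm_nonneg _)] using h2

/-- The distance to the vacuum is at most linear in the weight `r`, so that the tensor products over
configurations with summable weights converge. -/
theorem norm_e_sub_vac_le {v : ℂ × (Fin d → ℂ)} (hv : 0 ≤ lobHeight v) (r : ℝ) (hr : 0 ≤ r) :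
    ‖A.e ((r : ℂ) ^ 2 * v.1) ((r : ℂ) • v.2) - A.vac‖ ≤ r * (2 * √‖v.1‖) := by
  refine (sq_le_sq₀ (norm_nonneg _) (by positivity)).1 ?_
  have hs : 0 ≤ ∑ i, ‖v.2 i‖ ^ 2 := Finset.sum_nonneg fun i _ => sq_nonneg _
  have hva : -v.1.re ≤ ‖v.1‖ := (neg_le_abs _).trans (Complex.abs_re_le_norm _)
  unfold lobHeight at hv
  have e1 : conj ((r : ℂ) ^ 2 * v.1) + (r : ℂ) ^ 2 * v.1 +
      star ((r : ℂ) • v.2) ⬝ᵥ ((r : ℂ) • v.2) = ((-r ^ 2 * lobHeight v : ℝ) : ℂ) := by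
    rw [ofReal_mul, ← lobKer_self, lobKer]
    simp only [map_mul, map_pow, Complex.conj_ofReal, star_smul, smul_dotProduct, dotProduct_smul,
      smul_eq_mul, RCLike.star_def]
    push_cast
    ring
  rw [← A.e_zero, A.norm_sub_sq, e1]
  simp only [star_zero, dotProduct_zero, map_zero, add_zero, Complex.exp_zero,
    Complex.one_re]
  have h1 : (exp ((-r ^ 2 * lobHeight v : ℝ) : ℂ)).re ≤ 1 := by
    rw [← ofReal_exp, ofReal_re, Real.exp_le_one_iff]
    have : 0 ≤ r ^ 2 * lobHeight v := by unfold lobHeight; positivity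
    linarith
  have h2 : ‖exp (conj ((r : ℂ) ^ 2 * v.1)) - 1‖ ≤ r ^ 2 * ‖v.1‖ := by
    refine (norm_exp_sub_one_le_of_re_nonpos ?_).trans ?_
    · rw [Complex.conj_re, ← ofReal_pow, re_ofReal_mul]
      have : v.1.re ≤ 0 := by linarith
      exact mul_nonpos_of_nonneg_of_nonpos (sq_nonneg _) this
    · simp
  have h3 := (neg_le_abs _).trans ((Complex.abs_re_le_norm _).trans h2)
  rw [Complex.sub_re, Complex.one_re] at h3
  rw [mul_pow, mul_pow, Real.sq_sqrt (norm_nonneg _)]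
  linarith [mul_nonneg (sq_nonneg r) (norm_nonneg v.1)]

variable {X : Type*} [MeasurableSpace X]

/-- The section `F_v(ξ) = ⊗_k e(r_k² a(x_k), r_k b(x_k))` for `v = (a, b)`. -/
def F (v : X → ℂ × (Fin d → ℂ)) (ξ : Config X) : TensorPow 𝕜 A.vac :=
  tprod 𝕜 A.vac fun k =>
    A.e (((ξ k).1 : ℂ) ^ 2 * (v (ξ k).2).1) (((ξ k).1 : ℂ) • (v (ξ k).2).2)

theorem norm_factor_sub_vac_le {v : X → ℂ × (Fin d → ℂ)} {C : ℝ} (hC : ∀ x, ‖v x‖ ≤ C)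
    (hv : ∀ x, 0 ≤ lobHeight (v x)) (ξ : Config X) (k : ℕ) :
    ‖A.e (((ξ k).1 : ℂ) ^ 2 * (v (ξ k).2).1) (((ξ k).1 : ℂ) • (v (ξ k).2).2) - A.vac‖ ≤
      (ξ k).1 * (2 * √C) := by
  refine (A.norm_e_sub_vac_le (hv _) _ (ξ k).1.2.le).trans ?_
  have : (0 : ℝ) ≤ (ξ k).1 := (ξ k).1.2.le
  gcongr
  exact (norm_fst_le _).trans (hC _)

theorem summable_factor {v : X → ℂ × (Fin d → ℂ)} {C : ℝ} (hC : ∀ x, ‖v x‖ ≤ C)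
    (hv : ∀ x, 0 ≤ lobHeight (v x)) {ξ : Config X} (hξ : Summable fun k => ((ξ k).1 : ℝ)) :
    Summable fun k =>
      ‖A.e (((ξ k).1 : ℂ) ^ 2 * (v (ξ k).2).1) (((ξ k).1 : ℂ) • (v (ξ k).2).2) - A.vac‖ :=
  (hξ.mul_right _).of_nonneg_of_le (fun _ => norm_nonneg _)
    (A.norm_factor_sub_vac_le hC hv ξ)

theorem summable_factor_of_mem {v : X → ℂ × (Fin d → ℂ)} (hv : v ∈ LobCurrents d X)
    {ξ : Config X} (hξ : Summable fun k => ((ξ k).1 : ℝ)) :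
    Summable fun k =>
      ‖A.e (((ξ k).1 : ℂ) ^ 2 * (v (ξ k).2).1) (((ξ k).1 : ℂ) • (v (ξ k).2).2) - A.vac‖ := by
  obtain ⟨-, C, δ, hδ, h⟩ := mem_LobCurrents_iff.1 hv
  exact A.summable_factor (fun x => (h x).1) (fun x => hδ.le.trans (h x).2) hξ

theorem inner_F {v w : X → ℂ × (Fin d → ℂ)} (hv : v ∈ LobCurrents d X)
    (hw : w ∈ LobCurrents d X) {ξ : Config X} (hξ : Summable fun k => ((ξ k).1 : ℝ)) :
    ⟪A.F v ξ, A.F w ξ⟫_𝕜 = laplaceProd A.ρ (fun x => lobKer (w x) (v x)) ξ := by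
  rw [F, F, inner_tprod (A.summable_factor_of_mem hv hξ) (A.summable_factor_of_mem hw hξ),
    laplaceProd]
  refine tprod_congr fun k => ?_
  rw [A.inner_e]
  congr 2
  simp only [lobKer, map_mul, map_pow, Complex.conj_ofReal, star_smul, smul_dotProduct,
    dotProduct_smul, smul_eq_mul, RCLike.star_def]
  ring

/-- Finitely many factors depend continuously on the parameters. -/
theorem continuous_truncation (N : ℕ) : Continuous fun p : ℕ → ℂ × (Fin d → ℂ) =>
    tprod 𝕜 A.vac (truncSeq A.vac (fun k => A.e (p k).1 (p k).2) N) := by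
  refine continuous_iff_seqContinuous.2 fun p q hpq => ?_
  have hk : ∀ k, Tendsto (fun n => truncSeq A.vac (fun k => A.e (p n k).1 (p n k).2) N k) atTop
      (𝓝 (truncSeq A.vac (fun k => A.e (q k).1 (q k).2) N k)) := by
    intro k
    unfold truncSeq
    split_ifs
    · exact (A.continuous_e.tendsto (q k)).comp ((continuous_apply k).tendsto q |>.comp hpq)
    · exact tendsto_const_nhds
  have hn : ∀ k, Tendsto (fun n => ‖truncSeq A.vac (fun k => A.e (p n k).1 (p n k).2) N k - A.vac‖)
      atTop (𝓝 ‖truncSeq A.vac (fun k => A.e (q k).1 (q k).2) N k - A.vac‖) := fun k =>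
    ((hk k).sub_const _).norm
  have hle : ∀ n k, ‖truncSeq A.vac (fun k => A.e (p n k).1 (p n k).2) N k - A.vac‖ ≤
      ⨆ n, ‖truncSeq A.vac (fun k => A.e (p n k).1 (p n k).2) N k - A.vac‖ := fun n k =>
    le_ciSup (hn k).bddAbove_range n
  refine tendsto_tprod_vec
    (b := fun k => ⨆ n, ‖truncSeq A.vac (fun k => A.e (p n k).1 (p n k).2) N k - A.vac‖)
    ?_ hle (fun k => le_of_tendsto' (hn k) fun n => hle n k) hk
  refine summable_of_hasFiniteSupport ((Set.finite_lt_nat N).subset fun k hk => ?_)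
  by_contra h1
  have h2 : ¬ k < N := h1
  simp [truncSeq, h2] at hk

variable [StandardBorelSpace X] (m : Measure X) [IsProbabilityMeasure m] [NullSingletonClass m]

/-- The section `F_v` is the limit of its finite truncations. -/
theorem aestronglyMeasurable_F {v : X → ℂ × (Fin d → ℂ)} (hv : v ∈ LobCurrents d X) :
    AEStronglyMeasurable (A.F v) (lebesgueInf m) := by
  have hm : Measurable fun (ξ : Config X) (k : ℕ) =>
      ((((ξ k).1 : ℂ) ^ 2 * (v (ξ k).2).1, ((ξ k).1 : ℂ) • (v (ξ k).2).2) : ℂ × (Fin d → ℂ)) := by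
    refine measurable_pi_iff.2 fun k => ?_
    have h1 := Complex.measurable_ofReal.comp (measurable_weight (X := X) k)
    have h2 := hv.1.comp (measurable_point (X := X) k)
    exact ((h1.pow_const 2).mul h2.fst).prodMk (h1.smul h2.snd)
  refine aestronglyMeasurable_of_tendsto_ae atTop (fun N =>
    ((A.continuous_truncation N).stronglyMeasurable.comp_measurable hm).aestronglyMeasurable) ?_
  filter_upwards [ae_goodConfig m] with ξ hξ
  exact tendsto_truncSeq (A.summable_factor_of_mem hv hξ.2.1)

/-- The Laplace functional at `f = lobKer w v`; its real part is bounded away from zero. -/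
theorem laplace_lobKer {v w : X → ℂ × (Fin d → ℂ)} (hv : v ∈ LobCurrents d X)
    (hw : w ∈ LobCurrents d X) :
    Integrable (laplaceProd A.ρ fun x => lobKer (w x) (v x)) (lebesgueInf m) ∧
      ∫ ξ, laplaceProd A.ρ (fun x => lobKer (w x) (v x)) ξ ∂lebesgueInf m =
        NormedSpace.exp (A.ρ (∫ x, (expoInt 1 - 1 / 2 * cKer (w x) (v x)) ∂m)) := by
  obtain ⟨C, δ, hδ, h⟩ := LobCurrents.exists_lobKer_bounds hw hv
  exact laplace m A.isScalarMap (measurable_lobKer hw.1 hv.1) hδ (fun x => (h x).1)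
    fun x => (h x).2

theorem memLp_F {v : X → ℂ × (Fin d → ℂ)} (hv : v ∈ LobCurrents d X) :
    MemLp (A.F v) 2 (lebesgueInf m) := by
  rw [memLp_two_iff_integrable_sq_norm (A.aestronglyMeasurable_F m hv)]
  refine (A.laplace_lobKer m hv hv).1.re.congr ?_
  filter_upwards [ae_goodConfig m] with ξ hξ
  rw [← A.inner_F hv hv hξ.2.1, inner_self_eq_norm_sq]

/-- The class of `F_v` in the direct integral. -/
def vec (v : X → ℂ × (Fin d → ℂ)) : INT 𝕜 A.vac m := toINT m (A.F v)

theorem vec_ae {v : X → ℂ × (Fin d → ℂ)} (hv : v ∈ LobCurrents d X) :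
    A.vec m v =ᵐ[lebesgueInf m] A.F v := by
  rw [vec, toINT, dif_pos (A.memLp_F m hv)]
  exact MemLp.coeFn_toLp _

/-- The Gram kernel of the family `F_v`. -/
theorem inner_vec {v w : X → ℂ × (Fin d → ℂ)} (hv : v ∈ LobCurrents d X)
    (hw : w ∈ LobCurrents d X) : ⟪A.vec m v, A.vec m w⟫_𝕜 =
      NormedSpace.exp (A.ρ (∫ x, (expoInt 1 - 1 / 2 * cKer (w x) (v x)) ∂m)) := by
  rw [← (A.laplace_lobKer m hv hw).2, MeasureTheory.L2.inner_def]
  refine integral_congr_ae ?_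
  filter_upwards [A.vec_ae m hv, A.vec_ae m hw, ae_goodConfig m] with ξ h1 h2 h3
  rw [h1, h2, A.inner_F hv hw h3.2.1]

end ExpSystem

/-! ### The systems of exponential vectors in `H^+`, `H^-` and `H^0` -/

variable {d : ℕ}

/-- The identity or the complex conjugation as a real-linear map. -/
def cjL (ε : Sgn) : ℂ →L[ℝ] ℂ :=
  match ε with
  | .plus => ContinuousLinearMap.id ℝ ℂ
  | .minus => conjCLE

theorem cjL_apply (ε : Sgn) (z : ℂ) : cjL ε z = cj ε z := by cases ε <;> rfl

/-- The spaces `H^±` with the representations `T^±`. -/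
def complexSystem (ε : Sgn) (d : ℕ) : ExpSystem ℂ (H ε d) d where
  ρ := cjL ε
  isScalarMap := by
    refine ⟨?_, fun z => ?_, fun z => ?_⟩
    · cases ε <;> simp [cjL]
    · rw [cjL_apply, norm_cj]
    · cases ε <;> simp [cjL]
  vac := vac ε d
  e := expVec ε
  S := T ε
  inner_e α β α' β' := by rw [cjL_apply, inner_expVec_expVec]
  e_zero := rfl
  dense_e := dense_span_expVec ε d
  S_e := T_expVec ε

/-- The space `H^0` with the representation `T^0`. -/
def realSystem (d : ℕ) : ExpSystem ℝ (H0 d) d where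
  ρ := reCLM
  isScalarMap := ⟨Complex.one_re, fun z => Complex.abs_re_le_norm z, fun _ => rfl⟩
  vac := vac0 d
  e := expVec0
  S := T0
  inner_e α β α' β' := inner_expVec0 α α' β β'
  e_zero := rfl
  dense_e := dense_span_expVec0 d
  S_e := T0_expVec0

/-! ### Measures on configurations are determined by their Laplace transforms -/

/-- Finite measures on the cube `[0, 1]^ℚ` with the same moments are equal. -/
theorem ext_of_moments {P P' : Measure (ℚ → unitInterval)} [IsFiniteMeasure P] [IsFiniteMeasure P']
    (h : ∀ s : Multiset ℚ, ∫ y, (s.map fun q => (y q : ℝ)).prod ∂P =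
      ∫ y, (s.map fun q => (y q : ℝ)).prod ∂P') : P = P' := by
  let c : ℚ → BoundedContinuousFunction (ℚ → unitInterval) ℝ := fun q =>
    BoundedContinuousFunction.mkOfCompact ⟨fun y => (y q : ℝ), by fun_prop⟩
  let A : StarSubalgebra ℝ (BoundedContinuousFunction (ℚ → unitInterval) ℝ) :=
    { Algebra.adjoin ℝ (Set.range c) with
      star_mem' := fun {a} ha => by
        have : star a = a := by ext y; simp
        rw [this]
        exact ha }
  -- the coordinate functions generate a subalgebra that separates points, spanned by the monomials
  refine ext_of_forall_mem_subalgebra_integral_eq_of_polish (𝕜 := ℝ) (A := A) ?_ fun g hg => ?_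
  · intro x y hxy
    obtain ⟨q, hq⟩ := Function.ne_iff.1 hxy
    refine ⟨fun z => (z q : ℝ), ⟨(c q).toContinuousMap, ⟨c q, ?_, rfl⟩, rfl⟩, fun h => hq ?_⟩
    · exact Algebra.subset_adjoin ⟨q, rfl⟩
    · exact Subtype.ext h
  · have hg' : g ∈ Submodule.span ℝ (Submonoid.closure (Set.range c) : Set _) := by
      rw [← Algebra.adjoin_eq_span]
      exact hg
    clear hg
    induction hg' using Submodule.span_induction with
    | mem x hx =>
      have : ∃ s : Multiset ℚ, ∀ y, x y = (s.map fun q => (y q : ℝ)).prod := by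
        induction hx using Submonoid.closure_induction with
        | mem x hx =>
          obtain ⟨q, rfl⟩ := hx
          exact ⟨{q}, fun y => by simp [c]⟩
        | one => exact ⟨0, fun y => by simp⟩
        | mul x y _ _ hx hy =>
          obtain ⟨s, hs⟩ := hx
          obtain ⟨t, ht⟩ := hy
          exact ⟨s + t, fun z => by simp [hs, ht]⟩
      obtain ⟨s, hs⟩ := this
      simp only [hs, h]
    | zero => simp
    | add x y _ _ hx hy =>
      simp only [BoundedContinuousFunction.coe_add, Pi.add_apply]
      rw [integral_add (x.integrable P) (y.integrable P),
        integral_add (x.integrable P') (y.integrable P'), hx, hy]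
    | smul a x _ hx =>
      simp only [BoundedContinuousFunction.coe_smul]
      rw [integral_smul, integral_smul, hx]

variable {X : Type*} [MeasurableSpace X]

/-- The sum `∑ r_k² f(x_k)`. -/
def wsum (f : X → ℝ) (ξ : Config X) : ℝ := ∑' k, ((ξ k).1 : ℝ) ^ 2 * f (ξ k).2

theorem measurable_wsum {f : X → ℝ} (hf : Measurable f) : Measurable (wsum f) :=
  Measurable.tsum fun k => ((measurable_weight k).pow_const 2).mul (hf.comp (measurable_point k))

theorem wsum_nonneg {f : X → ℝ} (hf : ∀ x, 0 ≤ f x) (ξ : Config X) : 0 ≤ wsum f ξ :=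
  tsum_nonneg fun _ => mul_nonneg (sq_nonneg _) (hf _)

theorem summable_wsum {f : X → ℝ} {C : ℝ} (hf : ∀ x, 0 ≤ f x) (hC : ∀ x, f x ≤ C) {ξ : Config X}
    (hξ : Summable fun k => ((ξ k).1 : ℝ)) : Summable fun k => ((ξ k).1 : ℝ) ^ 2 * f (ξ k).2 :=
  ((summable_sq (fun k => (ξ k).1.2.le) hξ).mul_right C).of_nonneg_of_le
    (fun _ => mul_nonneg (sq_nonneg _) (hf _))
    fun _ => mul_le_mul_of_nonneg_left (hC _) (sq_nonneg _)

theorem laplaceProd_real {f : X → ℝ} {C : ℝ} (hf : ∀ x, 0 ≤ f x) (hC : ∀ x, f x ≤ C)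
    {ξ : Config X} (hξ : Summable fun k => ((ξ k).1 : ℝ)) :
    laplaceProd reCLM (fun x => (f x : ℂ)) ξ = Real.exp (-wsum f ξ) := by
  have h1 := (summable_wsum hf hC hξ).hasSum.neg.rexp
  rw [wsum, ← h1.tprod_eq, laplaceProd]
  refine tprod_congr fun k => ?_
  change (exp _).re = _
  have : -((ξ k).1 : ℂ) ^ 2 * (f (ξ k).2 : ℂ) = ((-(((ξ k).1 : ℝ) ^ 2 * f (ξ k).2) : ℝ) : ℂ) := by
    push_cast; ring
  rw [this, ← ofReal_exp, ofReal_re]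
  rfl

variable [StandardBorelSpace X]

/-- The indicator function of `{x | ι x ≤ q}`, where `ι` is an embedding in the real line. -/
def belowInd (X : Type*) [MeasurableSpace X] [StandardBorelSpace X] (q : ℚ) : X → ℝ :=
  Set.indicator {x | embeddingReal X x ≤ q} 1

theorem measurable_belowInd (q : ℚ) : Measurable (belowInd X q) :=
  measurable_one.indicator (measurableSet_le (measurable_embeddingReal X) measurable_const)

theorem belowInd_nonneg (q : ℚ) (x : X) : 0 ≤ belowInd X q x :=
  Set.indicator_nonneg (fun _ _ => zero_le_one) x

theorem belowInd_le_one (q : ℚ) (x : X) : belowInd X q x ≤ 1 :=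
  Set.indicator_le_self' (fun _ _ => zero_le_one) x

/-- The coordinates `exp(-∑ r_k² 1[ι x_k ≤ q])` of a configuration. They form a multiplicative
family, and determine the measure `∑ r_k² δ_{x_k}`. -/
def coords (ξ : Config X) (q : ℚ) : unitInterval :=
  ⟨Real.exp (-wsum (belowInd X q) ξ), (Real.exp_pos _).le,
    Real.exp_le_one_iff.2 (neg_nonpos.2 (wsum_nonneg (belowInd_nonneg q) ξ))⟩

theorem measurable_coords : Measurable (coords (X := X)) :=
  measurable_pi_iff.2 fun q =>
    (measurable_wsum (measurable_belowInd q)).neg.exp.subtype_mk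

theorem multiset_sum_belowInd_mem (s : Multiset ℚ) (x : X) :
    0 ≤ (s.map fun q => belowInd X q x).sum ∧ (s.map fun q => belowInd X q x).sum ≤ s.card := by
  refine ⟨Multiset.sum_nonneg fun y hy => ?_, ?_⟩
  · obtain ⟨q, -, rfl⟩ := Multiset.mem_map.1 hy
    exact belowInd_nonneg q x
  · have := Multiset.sum_le_card_nsmul (s.map fun q => belowInd X q x) 1 fun y hy => by
      obtain ⟨q, -, rfl⟩ := Multiset.mem_map.1 hy
      exact belowInd_le_one q x
    simpa using this

theorem prod_coords {ξ : Config X} (hξ : Summable fun k => ((ξ k).1 : ℝ)) (s : Multiset ℚ) :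
    (s.map fun q => (coords ξ q : ℝ)).prod =
      Real.exp (-wsum (fun x => (s.map fun q => belowInd X q x).sum) ξ) := by
  induction s using Multiset.induction with
  | empty => simp [wsum]
  | cons q s ih =>
    have h0 := fun x : X => (multiset_sum_belowInd_mem s x).1
    have h1 := fun x : X => (multiset_sum_belowInd_mem s x).2
    rw [Multiset.map_cons, Multiset.prod_cons, ih, coords, ← Real.exp_add, ← neg_add]
    congr 2
    rw [wsum, wsum, wsum, ← (summable_wsum (belowInd_nonneg q) (belowInd_le_one q) hξ).tsum_add
      (summable_wsum h0 h1 hξ)]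
    simp [mul_add]

/-- The measure `∑ r_k² δ_{ι x_k}` on the real line. -/
def atomMeasure (ξ : Config X) : Measure ℝ :=
  Measure.sum fun k => ENNReal.ofReal (((ξ k).1 : ℝ) ^ 2) • Measure.dirac (embeddingReal X (ξ k).2)

theorem atomMeasure_Iic {ξ : Config X} (hξ : Summable fun k => ((ξ k).1 : ℝ)) (q : ℚ) :
    atomMeasure ξ (Set.Iic (q : ℝ)) = ENNReal.ofReal (wsum (belowInd X q) ξ) := by
  rw [atomMeasure, Measure.sum_apply _ measurableSet_Iic, wsum, ENNReal.ofReal_tsum_of_nonneg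
    (fun _ => mul_nonneg (sq_nonneg _) (belowInd_nonneg q _))
    (summable_wsum (belowInd_nonneg q) (belowInd_le_one q) hξ)]
  refine tsum_congr fun k => ?_
  rw [Measure.smul_apply, Measure.dirac_apply' _ measurableSet_Iic, ENNReal.ofReal_mul (sq_nonneg _),
    smul_eq_mul]
  congr 1
  by_cases h : embeddingReal X (ξ k).2 ≤ q
  · simp [belowInd, h]
  · simp [belowInd, h]

theorem atomMeasure_singleton {ξ : Config X} (hξ : Function.Injective fun k => (ξ k).2) (k : ℕ) :
    atomMeasure ξ {embeddingReal X (ξ k).2} = ENNReal.ofReal (((ξ k).1 : ℝ) ^ 2) := by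
  rw [atomMeasure, Measure.sum_apply _ (measurableSet_singleton _), tsum_eq_single k]
  · simp
  · intro j hj
    have : embeddingReal X (ξ j).2 ≠ embeddingReal X (ξ k).2 := fun h =>
      hj (hξ ((measurableEmbedding_embeddingReal X).injective h))
    simp [this]

theorem atomMeasure_eq {ξ η : Config X} (hξ : Summable fun k => ((ξ k).1 : ℝ))
    (hη : Summable fun k => ((η k).1 : ℝ)) (h : coords ξ = coords η) :
    atomMeasure ξ = atomMeasure η := by
  have key : ∀ q : ℚ, atomMeasure ξ (Set.Iic (q : ℝ)) = atomMeasure η (Set.Iic (q : ℝ)) := by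
    intro q
    have h1 := congrArg Subtype.val (congrFun h q)
    simp only [coords, Real.exp_eq_exp, neg_inj] at h1
    rw [atomMeasure_Iic hξ, atomMeasure_Iic hη, h1]
  refine Measure.ext_of_generateFrom_of_iUnion _ (fun n : ℕ => Set.Iic ((n : ℚ) : ℝ))
    ((BorelSpace.measurable_eq (α := ℝ)).trans Real.borel_eq_generateFrom_Iic_rat)
    Real.isPiSystem_Iic_rat ?_ ?_ ?_ ?_
  · refine Set.eq_univ_of_forall fun x => Set.mem_iUnion.2 ?_
    obtain ⟨n, hn⟩ := exists_nat_ge x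
    exact ⟨n, by simpa using hn⟩
  · exact fun n => Set.mem_iUnion.2 ⟨(n : ℚ), rfl⟩
  · intro n
    rw [atomMeasure_Iic hξ]
    exact ENNReal.ofReal_ne_top
  · intro s hs
    obtain ⟨q, hq⟩ := Set.mem_iUnion.1 hs
    rw [Set.mem_singleton_iff.1 hq]
    exact key q

theorem exists_atom_eq {ξ η : Config X} (hξ : Summable fun k => ((ξ k).1 : ℝ))
    (hη : Summable fun k => ((η k).1 : ℝ)) (hξ' : Function.Injective fun k => (ξ k).2)
    (hη' : Function.Injective fun k => (η k).2) (h : coords ξ = coords η) (k : ℕ) :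
    ∃ j, η j = ξ k := by
  have h1 := atomMeasure_singleton hξ' k
  rw [atomMeasure_eq hξ hη h] at h1
  have hpos : (0 : ℝ) < ((ξ k).1 : ℝ) ^ 2 := pow_pos (ξ k).1.2 2
  obtain ⟨j, hj⟩ : ∃ j, (η j).2 = (ξ k).2 := by
    by_contra hne
    push Not at hne
    have h2 : atomMeasure η {embeddingReal X (ξ k).2} = 0 := by
      rw [atomMeasure, Measure.sum_apply _ (measurableSet_singleton _), ENNReal.tsum_eq_zero]
      intro j
      have : embeddingReal X (η j).2 ≠ embeddingReal X (ξ k).2 := fun h =>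
        hne j ((measurableEmbedding_embeddingReal X).injective h)
      simp [this]
    rw [h2] at h1
    exact absurd (ENNReal.ofReal_eq_zero.1 h1.symm) (not_le.2 hpos)
  refine ⟨j, Prod.ext ?_ hj⟩
  rw [← hj, atomMeasure_singleton hη' j,
    ENNReal.ofReal_eq_ofReal_iff (sq_nonneg _) (sq_nonneg _)] at h1
  exact Subtype.ext ((sq_eq_sq₀ (η j).1.2.le (ξ k).1.2.le).1 h1)

/-- A configuration with decreasing weights is determined by its set of atoms, hence by its
coordinates. -/
theorem coords_injOn : Set.InjOn (coords (X := X)) (goodConfig X) := by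
  intro ξ hξ η hη h
  have h1 := exists_atom_eq hξ.2.1 hη.2.1 hξ.2.2 hη.2.2 h
  have h2 := exists_atom_eq hη.2.1 hξ.2.1 hη.2.2 hξ.2.2 h.symm
  have hr : Set.range (fun k => (ξ k).1) = Set.range fun k => (η k).1 := by
    refine Set.Subset.antisymm ?_ ?_
    · rintro _ ⟨k, rfl⟩
      obtain ⟨j, hj⟩ := h1 k
      exact ⟨j, congrArg Prod.fst hj⟩
    · rintro _ ⟨k, rfl⟩
      obtain ⟨j, hj⟩ := h2 k
      exact ⟨j, congrArg Prod.fst hj⟩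
  have hw : (fun k => OrderDual.toDual (ξ k).1) = fun k => OrderDual.toDual (η k).1 :=
    (StrictMono.range_inj hξ.1.dual_right hη.1.dual_right).1 hr
  funext k
  obtain ⟨j, hj⟩ := h1 k
  have h3 : (η j).1 = (η k).1 := by
    rw [hj]
    exact congrFun hw k
  rw [← hj, hη.1.injective h3]

/-- Measures concentrated on `goodConfig X` are determined by their images in the cube. -/
theorem ext_of_map_coords {P P' : Measure (Config X)}
    (hP : ∀ᵐ ξ ∂P, ξ ∈ goodConfig X) (hP' : ∀ᵐ ξ ∂P', ξ ∈ goodConfig X)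
    (h : P.map coords = P'.map coords) : P = P' := by
  have key : ∀ (Q : Measure (Config X)), (∀ᵐ ξ ∂Q, ξ ∈ goodConfig X) → ∀ B, MeasurableSet B →
      Q B = Q.map coords (coords '' (B ∩ goodConfig X)) := by
    intro Q hQ B hB
    -- injective measurable images of measurable sets in standard Borel spaces are measurable
    have hm : MeasurableSet (coords '' (B ∩ goodConfig X)) :=
      (hB.inter measurableSet_goodConfig).image_of_measurable_injOn measurable_coords
        (coords_injOn.mono Set.inter_subset_right)
    rw [Measure.map_apply measurable_coords hm]
    refine measure_congr ?_
    filter_upwards [hQ] with ξ hξ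
    refine propext ⟨fun h => ⟨ξ, ⟨h, hξ⟩, rfl⟩, ?_⟩
    rintro ⟨η, ⟨h1, h2⟩, h3⟩
    rw [← coords_injOn h2 hξ h3]
    exact h1
  ext B hB
  rw [key P hP B hB, key P' hP' B hB, h]

theorem measurable_multiset_sum_belowInd (s : Multiset ℚ) :
    Measurable fun x : X => (s.map fun q => belowInd X q x).sum := by
  induction s using Multiset.induction with
  | empty => simp
  | cons q s ih =>
    simp only [Multiset.map_cons, Multiset.sum_cons]
    exact (measurable_belowInd q).add ih

theorem measurable_multiset_prod_coe (s : Multiset ℚ) :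
    Measurable fun y : ℚ → unitInterval => (s.map fun q => (y q : ℝ)).prod := by
  induction s using Multiset.induction with
  | empty => simp
  | cons q s ih =>
    simp only [Multiset.map_cons, Multiset.prod_cons]
    exact (measurable_subtype_coe.comp (measurable_pi_apply q)).mul ih

theorem multiset_prod_coe_mem (s : Multiset ℚ) (y : ℚ → unitInterval) :
    0 ≤ (s.map fun q => (y q : ℝ)).prod ∧ (s.map fun q => (y q : ℝ)).prod ≤ 1 := by
  induction s using Multiset.induction with
  | empty => simp
  | cons q s ih =>
    rw [Multiset.map_cons, Multiset.prod_cons]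
    exact ⟨mul_nonneg (y q).2.1 ih.1, mul_le_one₀ (y q).2.2 ih.1 ih.2⟩

/-- An integrable function orthogonal to all the functions `exp(-∑ r_k² f(x_k))` with bounded
`f ≥ 0` vanishes almost everywhere: its positive and negative parts are densities of finite measures
with the same moments in the cube. -/
theorem ae_eq_zero_of_integral_exp {μ : Measure (Config X)} (hμ : ∀ᵐ ξ ∂μ, ξ ∈ goodConfig X)
    {G : Config X → ℝ} (hG : Integrable G μ)
    (h : ∀ (f : X → ℝ) (C : ℝ), Measurable f → (∀ x, 0 ≤ f x) → (∀ x, f x ≤ C) →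
      ∫ ξ, Real.exp (-wsum f ξ) * G ξ ∂μ = 0) : G =ᵐ[μ] 0 := by
  have hpos := hG.aemeasurable.ennreal_ofReal
  have hneg := hG.neg.aemeasurable.ennreal_ofReal
  have hG' : ∫⁻ ξ, ENNReal.ofReal (G ξ) ∂μ ≠ ∞ := hG.lintegral_lt_top.ne
  have hG'' : ∫⁻ ξ, ENNReal.ofReal ((-G) ξ) ∂μ ≠ ∞ := hG.neg.lintegral_lt_top.ne
  set P := μ.withDensity fun ξ => ENNReal.ofReal (G ξ) with hP
  set P' := μ.withDensity fun ξ => ENNReal.ofReal ((-G) ξ) with hP'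
  have : IsFiniteMeasure P := isFiniteMeasure_withDensity hG'
  have : IsFiniteMeasure P' := isFiniteMeasure_withDensity hG''
  have hPP : P = P' := by
    refine ext_of_map_coords (withDensity_absolutelyContinuous _ _ hμ)
      (withDensity_absolutelyContinuous _ _ hμ) (ext_of_moments fun s => ?_)
    have hm := measurable_multiset_prod_coe s
    rw [integral_map measurable_coords.aemeasurable hm.aestronglyMeasurable,
      integral_map measurable_coords.aemeasurable hm.aestronglyMeasurable, hP, hP',
      integral_withDensity_eq_integral_toReal_smul₀ hpos
        (Eventually.of_forall fun _ => ENNReal.ofReal_lt_top),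
      integral_withDensity_eq_integral_toReal_smul₀ hneg
        (Eventually.of_forall fun _ => ENNReal.ofReal_lt_top), ← sub_eq_zero]
    have hb : ∀ ξ : Config X, ‖(s.map fun q => (coords ξ q : ℝ)).prod‖ ≤ 1 := by
      intro ξ
      have h1 := multiset_prod_coe_mem s (coords ξ)
      rw [Real.norm_eq_abs, abs_of_nonneg h1.1]
      exact h1.2
    have hi : ∀ g : Config X → ℝ, Integrable g μ → Integrable (fun ξ =>
        (ENNReal.ofReal (g ξ)).toReal • (s.map fun q => (coords ξ q : ℝ)).prod) μ := fun g hg => by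
      refine Integrable.mul_bdd (c := 1) hg.real_toNNReal ?_ (Eventually.of_forall hb)
      exact (hm.comp measurable_coords).aestronglyMeasurable
    rw [← integral_sub (hi G hG) (hi (-G) hG.neg)]
    refine Eq.trans (integral_congr_ae ?_) (h _ s.card (measurable_multiset_sum_belowInd s)
      (fun x => (multiset_sum_belowInd_mem s x).1) fun x => (multiset_sum_belowInd_mem s x).2)
    filter_upwards [hμ] with ξ hξ
    rw [prod_coords hξ.2.1, ← sub_smul, smul_eq_mul, mul_comm]
    congr 1
    rw [ENNReal.toReal_ofReal', ENNReal.toReal_ofReal', Pi.neg_apply]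
    exact max_zero_sub_eq_self (G ξ)
  have := (withDensity_eq_iff hpos hneg hG').1 hPP
  filter_upwards [this] with ξ hξ
  have h1 := congrArg ENNReal.toReal hξ
  rw [ENNReal.toReal_ofReal', ENNReal.toReal_ofReal', Pi.neg_apply] at h1
  have h2 := max_zero_sub_eq_self (G ξ)
  rw [h1, sub_self] at h2
  exact h2.symm

/-! ### Totality of the sections -/

section StepCurrents

variable {d : ℕ} {X : Type*} [MeasurableSpace X] [StandardBorelSpace X]

theorem nonempty_Lob (d : ℕ) : Nonempty (Lob d) := ⟨⟨basePt d, basePt_mem⟩⟩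

/-- A dense sequence in the Lobachevsky space. -/
def lobSeq (d : ℕ) (n : ℕ) : ℂ × (Fin d → ℂ) :=
  haveI := nonempty_Lob d
  (TopologicalSpace.denseSeq (Lob d) n : ℂ × (Fin d → ℂ))

theorem lobSeq_mem (n : ℕ) : lobSeq d n ∈ Lob d := Subtype.prop _

theorem exists_lobSeq_dist_lt {t : ℂ × (Fin d → ℂ)} (ht : t ∈ Lob d) {ε : ℝ} (hε : 0 < ε) :
    ∃ n, ‖lobSeq d n - t‖ < ε := by
  have := nonempty_Lob d
  obtain ⟨n, hn⟩ := (TopologicalSpace.denseRange_denseSeq (Lob d)).exists_dist_lt ⟨t, ht⟩ hε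
  rw [dist_comm] at hn
  exact ⟨n, by rwa [← dist_eq_norm]⟩

/-- The step function equal to `lobSeq n` on the preimage of the interval `(p, q)` for the first
`(p, q, n)` in the list for which this applies, and to `u` elsewhere. -/
def stepCurrent (u : ℂ × (Fin d → ℂ)) : List (ℚ × ℚ × ℕ) → X → ℂ × (Fin d → ℂ)
  | [], _ => u
  | a :: l, x => if embeddingReal X x ∈ Set.Ioo (a.1 : ℝ) a.2.1 then lobSeq d a.2.2
      else stepCurrent u l x

theorem stepCurrent_mem {u : ℂ × (Fin d → ℂ)} (hu : u ∈ Lob d) (l : List (ℚ × ℚ × ℕ)) :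
    stepCurrent u l ∈ LobCurrents d X := by
  suffices h : Measurable (stepCurrent (X := X) u l) ∧
      ∃ K ⊆ Lob d, K.Finite ∧ ∀ x : X, stepCurrent u l x ∈ K by
    obtain ⟨h1, K, h2, h3, h4⟩ := h
    exact ⟨h1, K, h2, h3.isCompact, h4⟩
  induction l with
  | nil => exact ⟨measurable_const, {u}, by simpa using hu, Set.finite_singleton u, fun x => rfl⟩
  | cons a l ih =>
    obtain ⟨h1, K, h2, h3, h4⟩ := ih
    refine ⟨Measurable.ite (measurable_embeddingReal X measurableSet_Ioo) measurable_const h1,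
      insert (lobSeq d a.2.2) K, Set.insert_subset (lobSeq_mem _) h2, h3.insert _, fun x => ?_⟩
    unfold stepCurrent
    split_ifs
    · exact Set.mem_insert _ _
    · exact Set.mem_insert_of_mem _ (h4 x)

/-- A step current with the prescribed values `lobSeq (n k)` at the first `N` points of a sequence,
and with the value `u` at the next points up to the place `J`. -/
theorem exists_stepCurrent (u : ℂ × (Fin d → ℂ)) {x : ℕ → X} (hx : Function.Injective x)
    (n : ℕ → ℕ) (J N : ℕ) : ∃ l, (∀ k < N, stepCurrent u l (x k) = lobSeq d (n k)) ∧
      (∀ k, N ≤ k → k < J → stepCurrent u l (x k) = u) ∧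
      ∀ y : X, stepCurrent u l y = u ∨ ∃ k < N, stepCurrent u l y = lobSeq d (n k) := by
  induction N with
  | zero => exact ⟨[], by simp, fun _ _ _ => rfl, fun _ => Or.inl rfl⟩
  | succ N ih =>
    obtain ⟨l, h1, h2, h3⟩ := ih
    set S : Set ℝ := (fun k => embeddingReal X (x k)) '' {k | k < J + N ∧ k ≠ N} with hS
    have hfin : S.Finite := (((Set.finite_lt_nat (J + N)).subset fun k hk => hk.1).image _)
    have hinj : ∀ i j, embeddingReal X (x i) = embeddingReal X (x j) → i = j := fun i j h =>
      hx ((measurableEmbedding_embeddingReal X).injective h)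
    have hN : embeddingReal X (x N) ∈ Sᶜ := by
      rintro ⟨k, hk, h⟩
      exact hk.2 (hinj _ _ h)
    obtain ⟨I, hI, hmem, hsub⟩ := Real.isTopologicalBasis_Ioo_rat.exists_subset_of_mem_open hN
      hfin.isClosed.isOpen_compl
    simp only [Set.mem_iUnion, Set.mem_singleton_iff] at hI
    obtain ⟨p, q, -, rfl⟩ := hI
    have hout : ∀ k, k < J + N → k ≠ N → embeddingReal X (x k) ∉ Set.Ioo (p : ℝ) q :=
      fun k hk hkN h => hsub h ⟨k, ⟨hk, hkN⟩, rfl⟩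
    refine ⟨(p, q, n N) :: l, fun k hk => ?_, fun k hk hkJ => ?_, fun y => ?_⟩
    · rcases (Nat.lt_succ_iff_lt_or_eq.1 hk) with hk | rfl
      · unfold stepCurrent
        rw [if_neg (hout k (by omega) (by omega)), h1 k hk]
      · unfold stepCurrent
        rw [if_pos hmem]
    · unfold stepCurrent
      rw [if_neg (hout k (by omega) (by omega)), h2 k (by omega) hkJ]
    · unfold stepCurrent
      split_ifs
      · exact Or.inr ⟨N, Nat.lt_succ_self N, rfl⟩
      · rcases h3 y with h | ⟨k, hk, h⟩
        · exact Or.inl h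
        · exact Or.inr ⟨k, hk.trans (Nat.lt_succ_self N), h⟩

end StepCurrents

namespace ExpSystem

variable {𝕜 : Type*} [RCLike 𝕜] {E : Type*} [NormedAddCommGroup E] [InnerProductSpace 𝕜 E] {d : ℕ}
  (A : ExpSystem 𝕜 E d)

/-- Both sides have the same inner products with a total family. -/
theorem e_add_ofReal (α : ℂ) (t : ℝ) (β : Fin d → ℂ) :
    A.e (α + t) β = (Real.exp t : 𝕜) • A.e α β := by
  refine A.dense_e.eq_of_inner_right (𝕜 := 𝕜) fun v hv => ?_
  induction hv using Submodule.span_induction with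
  | mem x hx =>
    obtain ⟨⟨α', β'⟩, rfl⟩ := hx
    change ⟪A.e α' β', A.e (α + t) β⟫_𝕜 = ⟪A.e α' β', _⟫_𝕜
    rw [inner_smul_right, A.inner_e, A.inner_e, ← realLinear_ofReal_mul, ofReal_exp,
      ← Complex.exp_add]
    congr 2
    ring
  | zero => simp
  | add x y _ _ hx hy => rw [inner_add_left, inner_add_left, hx, hy]
  | smul a x _ hx => rw [inner_smul_left, inner_smul_left, hx]

/-- The exponential vectors with parameters in the Lobachevsky space are total. -/
theorem dense_e_Lob :
    (Submodule.span 𝕜 ((fun p : ℂ × (Fin d → ℂ) => A.e p.1 p.2) '' Lob d)).topologicalClosure = ⊤ := by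
  rw [← Submodule.dense_iff_topologicalClosure_eq_top]
  refine A.dense_e.mono (Submodule.span_le.2 ?_)
  rintro _ ⟨⟨α, β⟩, rfl⟩
  -- a real shift of `α` multiplies the exponential vector by a number and moves `(α, β)` into `L`
  set t : ℝ := α.re + ∑ i, ‖β i‖ ^ 2 + 1
  have h1 : α = (α - t) + t := by ring
  change A.e α β ∈ _
  rw [h1, A.e_add_ofReal]
  refine Submodule.smul_mem _ _ (Submodule.subset_span ⟨(α - t, β), ?_, rfl⟩)
  have h2 : 0 ≤ ∑ i, ‖β i‖ ^ 2 := Finset.sum_nonneg fun i _ => sq_nonneg _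
  change 2 * (α - t).re + ∑ i, ‖β i‖ ^ 2 < 0
  rw [Complex.sub_re, ofReal_re]
  simp only [t]
  linarith

variable {X : Type*} [MeasurableSpace X]

/-- Subtracting a function from the first component of `v` multiplies `F_v(ξ)` by the exponential
of a sum over the atoms. -/
theorem F_sub {v : X → ℂ × (Fin d → ℂ)} (hv : v ∈ LobCurrents d X) {f : X → ℝ} {C : ℝ}
    (hf : ∀ x, 0 ≤ f x) (hC : ∀ x, f x ≤ C)
    (hvf : (fun x => ((v x).1 - f x, (v x).2)) ∈ LobCurrents d X) {ξ : Config X}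
    (hξ : Summable fun k => ((ξ k).1 : ℝ)) :
    A.F (fun x => ((v x).1 - f x, (v x).2)) ξ = (Real.exp (-wsum f ξ) : 𝕜) • A.F v ξ := by
  have hs := A.summable_factor_of_mem hv hξ
  have hs' := A.summable_factor_of_mem hvf hξ
  refine TensorPow.ext_inner fun g hg => ?_
  rw [F, F, inner_smul_right, inner_tprod hg hs', inner_tprod hg hs]
  have h1 : HasProd (fun k => ((Real.exp (-(((ξ k).1 : ℝ) ^ 2 * f (ξ k).2)) : ℝ) : 𝕜))
      (Real.exp (-wsum f ξ) : 𝕜) :=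
    (summable_wsum hf hC hξ).hasSum.neg.rexp.map (RCLike.ofRealAm (K := 𝕜))
      RCLike.continuous_ofReal
  rw [← h1.tprod_eq, ← h1.multipliable.tprod_mul (multipliable_inner hg hs)]
  refine tprod_congr fun k => ?_
  rw [← inner_smul_right, ← A.e_add_ofReal]
  congr 2
  push_cast
  ring

variable [StandardBorelSpace X] (m : Measure X) [IsProbabilityMeasure m] [NullSingletonClass m]

theorem integral_inner_vec {v : X → ℂ × (Fin d → ℂ)} (hv : v ∈ LobCurrents d X)
    (Φ : INT 𝕜 A.vac m) : ⟪A.vec m v, Φ⟫_𝕜 = ∫ ξ, ⟪A.F v ξ, Φ ξ⟫_𝕜 ∂lebesgueInf m := by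
  rw [MeasureTheory.L2.inner_def]
  refine integral_congr_ae ?_
  filter_upwards [A.vec_ae m hv] with ξ h
  rw [h]

theorem integrable_inner_vec {v : X → ℂ × (Fin d → ℂ)} (hv : v ∈ LobCurrents d X)
    (Φ : INT 𝕜 A.vac m) : Integrable (fun ξ => ⟪A.F v ξ, Φ ξ⟫_𝕜) (lebesgueInf m) := by
  refine (MeasureTheory.L2.integrable_inner (𝕜 := 𝕜) (A.vec m v) Φ).congr ?_
  filter_upwards [A.vec_ae m hv] with ξ h
  rw [h]

/-- If `Φ` is orthogonal to all `F_v`, then its values are orthogonal to those of every single `F_v`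
almost everywhere: along with `F_v`, the family contains the products of `F_v` with the functions
`exp(-∑ r_k² f(x_k))`, which separate configurations. -/
theorem ae_inner_eq_zero {Φ : INT 𝕜 A.vac m}
    (hΦ : ∀ v ∈ LobCurrents d X, ⟪A.vec m v, Φ⟫_𝕜 = 0) {v : X → ℂ × (Fin d → ℂ)}
    (hv : v ∈ LobCurrents d X) : ∀ᵐ ξ ∂lebesgueInf m, ⟪A.F v ξ, Φ ξ⟫_𝕜 = 0 := by
  have hint := A.integrable_inner_vec m hv Φ
  have key : ∀ (f : X → ℝ) (C : ℝ), Measurable f → (∀ x, 0 ≤ f x) → (∀ x, f x ≤ C) →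
      ∫ ξ, (Real.exp (-wsum f ξ) : 𝕜) * ⟪A.F v ξ, Φ ξ⟫_𝕜 ∂lebesgueInf m = 0 ∧
      Integrable (fun ξ => (Real.exp (-wsum f ξ) : 𝕜) * ⟪A.F v ξ, Φ ξ⟫_𝕜) (lebesgueInf m) := by
    intro f C hfm hf0 hfC
    have hvf : (fun x => ((v x).1 - f x, (v x).2)) ∈ LobCurrents d X := by
      obtain ⟨hm, K, δ, hδ, h⟩ := mem_LobCurrents_iff.1 hv
      refine mem_LobCurrents_iff.2 ⟨?_, K + C, δ, hδ, fun x => ⟨?_, ?_⟩⟩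
      · exact (hm.fst.sub (Complex.measurable_ofReal.comp hfm)).prodMk hm.snd
      · have h1 : ((v x).1 - f x, (v x).2) = v x - ((f x : ℂ), (0 : Fin d → ℂ)) := by
          ext <;> simp
        rw [h1]
        refine (norm_sub_le _ _).trans (add_le_add (h x).1 ?_)
        rw [Prod.norm_def]
        simp only [norm_zero, Complex.norm_real, Real.norm_eq_abs, abs_of_nonneg (hf0 x)]
        exact max_le (hfC x) ((hf0 x).trans (hfC x))
      · refine (h x).2.trans ?_
        simp only [lobHeight, Complex.sub_re, ofReal_re]
        linarith [hf0 x]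
    have e1 : (fun ξ => ⟪A.F (fun x => ((v x).1 - f x, (v x).2)) ξ, Φ ξ⟫_𝕜) =ᵐ[lebesgueInf m]
        fun ξ => (Real.exp (-wsum f ξ) : 𝕜) * ⟪A.F v ξ, Φ ξ⟫_𝕜 := by
      filter_upwards [ae_goodConfig m] with ξ hξ
      rw [A.F_sub hv hf0 hfC hvf hξ.2.1, inner_smul_left, RCLike.conj_ofReal]
    refine ⟨?_, (A.integrable_inner_vec m hvf Φ).congr e1⟩
    rw [← integral_congr_ae e1, ← A.integral_inner_vec m hvf, hΦ _ hvf]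
  have hre : (fun ξ => RCLike.re ⟪A.F v ξ, Φ ξ⟫_𝕜) =ᵐ[lebesgueInf m] 0 := by
    refine ae_eq_zero_of_integral_exp (ae_goodConfig m) hint.re fun f C hfm hf0 hfC => ?_
    obtain ⟨h1, h2⟩ := key f C hfm hf0 hfC
    have h3 := integral_re h2
    rw [h1, map_zero] at h3
    simpa only [RCLike.re_ofReal_mul] using h3
  have him : (fun ξ => RCLike.im ⟪A.F v ξ, Φ ξ⟫_𝕜) =ᵐ[lebesgueInf m] 0 := by
    refine ae_eq_zero_of_integral_exp (ae_goodConfig m) hint.im fun f C hfm hf0 hfC => ?_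
    obtain ⟨h1, h2⟩ := key f C hfm hf0 hfC
    have h3 := integral_im h2
    rw [h1, map_zero] at h3
    simpa only [RCLike.im_ofReal_mul] using h3
  filter_upwards [hre, him] with ξ h1 h2
  exact RCLike.ext (by simpa using h1) (by simpa using h2)

/-- The points `(-1/(j+1), 0)` of the Lobachevsky space, which tend to its boundary point `0`. -/
def nearZero (d j : ℕ) : ℂ × (Fin d → ℂ) := (-(1 / ((j : ℂ) + 1)), 0)

theorem nearZero_mem (j : ℕ) : nearZero d j ∈ Lob d := by
  change 2 * (-(1 / ((j : ℂ) + 1))).re + ∑ i, ‖(0 : Fin d → ℂ) i‖ ^ 2 < 0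
  have h : (-(1 / ((j : ℂ) + 1))) = ((-(1 / ((j : ℝ) + 1)) : ℝ) : ℂ) := by push_cast; rfl
  rw [h, ofReal_re]
  have : (0 : ℝ) < 1 / ((j : ℝ) + 1) := by positivity
  simp
  positivity

theorem tendsto_nearZero : Tendsto (nearZero d) atTop (𝓝 0) := by
  refine Tendsto.prodMk_nhds ?_ tendsto_const_nhds
  simpa using (tendsto_one_div_add_atTop_nhds_zero_nat (𝕜 := ℂ)).neg

/-- The values at one configuration of the sections of step currents are total. A decomposable vector
with `N` exponential factors and all other factors equal to the vacuum is approximated by step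
currents which take the required values at the first `N` points of the configuration and tend to the
boundary point `0` at all the others. -/
theorem eq_zero_of_inner_stepCurrent {ξ : Config X} (hξ : ξ ∈ goodConfig X)
    {φ : TensorPow 𝕜 A.vac}
    (h : ∀ l j, ⟪A.F (stepCurrent (nearZero d j) l) ξ, φ⟫_𝕜 = 0) : φ = 0 := by
  have htop : (𝕜 ∙ φ)ᗮ = ⊤ := by
    refine eq_top_of_trunc_mem A.dense_e_Lob (Submodule.isClosed_orthogonal _) fun N f hf => ?_
    have hp' : ∀ k, ∃ p : ℂ × (Fin d → ℂ), k < N → p ∈ Lob d ∧ A.e p.1 p.2 = f k := fun k => by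
      by_cases hk : k < N
      · obtain ⟨p, hp⟩ := hf k hk
        exact ⟨p, fun _ => hp⟩
      · exact ⟨0, fun h => absurd h hk⟩
    choose p hp using hp'
    have hr : ∀ k, ((ξ k).1 : ℂ) ≠ 0 := fun k => ofReal_ne_zero.2 (ξ k).1.2.ne'
    -- the point of `L` whose exponential vector at the weight `r_k` is `f k`
    set t : ℕ → ℂ × (Fin d → ℂ) := fun k =>
      ((((ξ k).1 : ℂ) ^ 2)⁻¹ * (p k).1, ((ξ k).1 : ℂ)⁻¹ • (p k).2) with ht
    have htL : ∀ k < N, t k ∈ Lob d := by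
      intro k hk
      have h1 : 2 * (p k).1.re + ∑ i, ‖(p k).2 i‖ ^ 2 < 0 := (hp k hk).1
      have h2 : 0 < (((ξ k).1 : ℝ) ^ 2)⁻¹ := inv_pos.2 (pow_pos (ξ k).1.2 2)
      have h3 := mul_neg_of_pos_of_neg h2 h1
      change 2 * ((((ξ k).1 : ℂ) ^ 2)⁻¹ * (p k).1).re + ∑ i, ‖((ξ k).1 : ℂ)⁻¹ * (p k).2 i‖ ^ 2 < 0
      have h4 : (((ξ k).1 : ℂ) ^ 2)⁻¹ = (((((ξ k).1 : ℝ) ^ 2)⁻¹ : ℝ) : ℂ) := by push_cast; rfl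
      rw [h4, re_ofReal_mul]
      simp only [norm_mul, norm_inv, Complex.norm_real, mul_pow, Real.norm_eq_abs, inv_pow, sq_abs,
        ← Finset.mul_sum]
      linarith
    have hn' : ∀ j k : ℕ, ∃ n, k < N → ‖lobSeq d n - t k‖ < 1 / ((j : ℝ) + 1) := fun j k => by
      by_cases hk : k < N
      · obtain ⟨n, hn⟩ := exists_lobSeq_dist_lt (htL k hk) (Nat.one_div_pos_of_nat (n := j) (α := ℝ))
        exact ⟨n, fun _ => hn⟩
      · exact ⟨0, fun h => absurd h hk⟩
    choose n hn using hn'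
    have hl := fun j => exists_stepCurrent (nearZero d j) hξ.2.2 (n j) j N
    choose l hl1 hl2 hl3 using hl
    -- the step currents `l j` are bounded uniformly in `j`
    set C : ℝ := (∑ k ∈ Finset.range N, ‖t k‖) + 1
    have hC : ∀ (j : ℕ) (x : X), ‖stepCurrent (nearZero d j) (l j) x‖ ≤ C := by
      intro j x
      have hj : 1 / ((j : ℝ) + 1) ≤ 1 := by
        rw [div_le_one (by positivity)]
        simp
      rcases hl3 j x with hx | ⟨k, hk, hx⟩
      · rw [hx, nearZero, Prod.norm_def]
        have h0 : ‖-(1 / ((j : ℂ) + 1))‖ = 1 / ((j : ℝ) + 1) := by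
          have : -(1 / ((j : ℂ) + 1)) = ((-(1 / ((j : ℝ) + 1)) : ℝ) : ℂ) := by push_cast; rfl
          rw [this, Complex.norm_real, Real.norm_eq_abs, abs_neg, abs_of_pos (by positivity)]
        have h1 : 0 ≤ ∑ k ∈ Finset.range N, ‖t k‖ := Finset.sum_nonneg fun _ _ => norm_nonneg _
        simp only [norm_zero, h0]
        exact max_le (by simp only [C]; linarith) (by simp only [C]; linarith)
      · rw [hx]
        have h1 := hn j k hk
        have h2 : ‖t k‖ ≤ ∑ k ∈ Finset.range N, ‖t k‖ :=
          Finset.single_le_sum (f := fun k => ‖t k‖) (fun _ _ => norm_nonneg _)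
            (Finset.mem_range.2 hk)
        have h3 := norm_le_norm_add_norm_sub' (lobSeq d (n j k)) (t k)
        simp only [C]
        linarith
    have hpos : ∀ j x, 0 ≤ lobHeight (stepCurrent (X := X) (nearZero d j) (l j) x) := fun j x =>
      (lobHeight_pos_iff.2 (LobCurrents.mem_lob (stepCurrent_mem (nearZero_mem j) (l j)) x)).le
    have hlim : ∀ k, Tendsto (fun j =>
        A.e (((ξ k).1 : ℂ) ^ 2 * (stepCurrent (nearZero d j) (l j) (ξ k).2).1)
          (((ξ k).1 : ℂ) • (stepCurrent (nearZero d j) (l j) (ξ k).2).2)) atTop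
        (𝓝 (truncSeq A.vac f N k)) := by
      intro k
      have hcont : Continuous fun v : ℂ × (Fin d → ℂ) =>
          A.e (((ξ k).1 : ℂ) ^ 2 * v.1) (((ξ k).1 : ℂ) • v.2) :=
        A.continuous_e.comp (by fun_prop : Continuous fun v : ℂ × (Fin d → ℂ) =>
          ((((ξ k).1 : ℂ) ^ 2 * v.1, ((ξ k).1 : ℂ) • v.2) : ℂ × (Fin d → ℂ)))
      by_cases hk : k < N
      · have h1 : Tendsto (fun j => stepCurrent (nearZero d j) (l j) (ξ k).2) atTop (𝓝 (t k)) := by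
          rw [tendsto_iff_norm_sub_tendsto_zero]
          refine squeeze_zero (fun _ => norm_nonneg _) (fun j => ?_)
            tendsto_one_div_add_atTop_nhds_zero_nat
          rw [hl1 j k hk]
          exact (hn j k hk).le
        have h2 := (hcont.tendsto (t k)).comp h1
        have h3 : truncSeq A.vac f N k = A.e (((ξ k).1 : ℂ) ^ 2 * (t k).1)
            (((ξ k).1 : ℂ) • (t k).2) := by
          rw [truncSeq, if_pos hk, ← (hp k hk).2, ht]
          simp only [mul_inv_cancel_left₀ (pow_ne_zero 2 (hr k)), smul_smul,
            mul_inv_cancel₀ (hr k), one_smul]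
        rw [h3]
        exact h2
      · have h1 : Tendsto (fun j => stepCurrent (nearZero d j) (l j) (ξ k).2) atTop (𝓝 0) := by
          refine tendsto_nearZero.congr' ?_
          filter_upwards [eventually_gt_atTop k] with j hj
          exact (hl2 j k (not_lt.1 hk) hj).symm
        have h2 := (hcont.tendsto 0).comp h1
        rw [truncSeq, if_neg hk, ← A.e_zero]
        simpa [Function.comp_def] using h2
    have hb := hξ.2.1.mul_right (2 * √C)
    have hle := fun j k => A.norm_factor_sub_vac_le (hC j) (hpos j) ξ k
    have := tendsto_tprod_vec (𝕜 := 𝕜) hb hle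
      (fun k => le_of_tendsto' (((hlim k).sub_const _).norm) fun j => hle j k) hlim
    exact (Submodule.isClosed_orthogonal _).mem_of_tendsto this (Eventually.of_forall fun j =>
      Submodule.mem_orthogonal_singleton_iff_inner_left.2 (h (l j) j))
  have : φ ∈ (𝕜 ∙ φ)ᗮ := htop ▸ Submodule.mem_top
  exact inner_self_eq_zero.1 (Submodule.mem_orthogonal_singleton_iff_inner_left.1 this)

/-- The vectors `F_v` are total. The sections of step currents form a countable family, so that a
vector orthogonal to all `F_v` is, at almost every configuration, orthogonal to all their values. -/
theorem span_vec_closure :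
    (Submodule.span 𝕜 (A.vec m '' LobCurrents d X)).topologicalClosure = ⊤ := by
  rw [Submodule.topologicalClosure_eq_top_iff, Submodule.eq_bot_iff]
  intro Φ hΦ
  have h0 : ∀ v ∈ LobCurrents d X, ⟪A.vec m v, Φ⟫_𝕜 = 0 := fun v hv =>
    hΦ _ (Submodule.subset_span ⟨v, hv, rfl⟩)
  refine Lp.ext ?_
  have hall : ∀ᵐ ξ ∂lebesgueInf m, ∀ a : List (ℚ × ℚ × ℕ) × ℕ,
      ⟪A.F (stepCurrent (nearZero d a.2) a.1) ξ, Φ ξ⟫_𝕜 = 0 :=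
    ae_all_iff.2 fun a => A.ae_inner_eq_zero m h0 (stepCurrent_mem (nearZero_mem a.2) a.1)
  filter_upwards [hall, ae_goodConfig m, Lp.coeFn_zero (TensorPow 𝕜 A.vac) 2 (lebesgueInf m)]
    with ξ h1 h2 h3
  rw [h3]
  exact A.eq_zero_of_inner_stepCurrent h2 fun l j => h1 (l, j)

end ExpSystem

/-! ### Quasi-invariance of the infinite-dimensional Lebesgue measure under multiplicators -/

/-- An injective sequence of positive numbers that tends to zero can be enumerated in decreasing
order: the place of a term is the number of the larger terms. -/
theorem exists_perm_strictAnti {w : ℕ → ℝ} (h0 : ∀ k, 0 < w k) (hw : Tendsto w atTop (𝓝 0))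
    (hinj : Function.Injective w) : ∃ σ : Equiv.Perm ℕ, StrictAnti fun k => w (σ k) := by
  have hfin : ∀ k, {j | w k < w j}.Finite := by
    intro k
    have h1 := hw.eventually (gt_mem_nhds (h0 k))
    rw [← Nat.cofinite_eq_atTop, eventually_cofinite] at h1
    refine h1.subset fun j hj => ?_
    exact not_lt.2 (le_of_lt hj)
  set rank : ℕ → ℕ := fun k => (hfin k).toFinset.card with hrank
  have hlt : ∀ i j, w j < w i → rank i < rank j := by
    intro i j hij
    refine Finset.card_lt_card ⟨fun k hk => ?_, fun hsub => ?_⟩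
    · rw [Set.Finite.mem_toFinset] at hk ⊢
      exact hij.trans hk
    · have h1 : i ∈ (hfin j).toFinset := (hfin j).mem_toFinset.2 hij
      exact lt_irrefl (w i) ((hfin i).mem_toFinset.1 (hsub h1))
  have hri : Function.Injective rank := by
    intro i j hij
    rcases lt_trichotomy (w i) (w j) with h | h | h
    · exact absurd hij (hlt _ _ h).ne'
    · exact hinj h
    · exact absurd hij (hlt _ _ h).ne
  have hsurj : Function.Surjective rank := by
    intro n
    obtain ⟨k, hk⟩ : ∃ k, n < rank k := by
      by_contra hne
      push Not at hne
      exact Set.infinite_range_of_injective hri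
        ((Set.finite_le_nat n).subset (Set.range_subset_iff.2 hne))
    have h1 : (hfin k).toFinset.image rank = Finset.range (rank k) := by
      refine Finset.eq_of_subset_of_card_le (fun i hi => ?_) ?_
      · obtain ⟨j, hj, rfl⟩ := Finset.mem_image.1 hi
        exact Finset.mem_range.2 (hlt _ _ ((hfin k).mem_toFinset.1 hj))
      · rw [Finset.card_range, Finset.card_image_of_injective _ hri]
    have h2 := Finset.mem_range.2 hk
    rw [← h1] at h2
    obtain ⟨j, -, hj⟩ := Finset.mem_image.1 h2
    exact ⟨j, hj⟩
  set τ := Equiv.ofBijective rank ⟨hri, hsurj⟩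
  refine ⟨τ.symm, fun i j hij => ?_⟩
  by_contra hle
  rcases (not_lt.1 hle).lt_or_eq with h | h
  · have h1 := hlt _ _ h
    have h2 : ∀ k, rank (τ.symm k) = k := fun k => τ.apply_symm_apply k
    rw [h2, h2] at h1
    omega
  · exact hij.ne (τ.symm.injective (hinj h))

section QuasiInvariance

variable {X : Type*} [MeasurableSpace X]

theorem wsum_scaleConfig (r : X → RPos) (f : X → ℝ) (ξ : Config X) :
    wsum f (scaleConfig r ξ) = wsum (fun x => (r x : ℝ) ^ 2 * f x) ξ := by
  refine tsum_congr fun k => ?_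
  change ((r (ξ k).2 : ℝ) * (ξ k).1) ^ 2 * f (ξ k).2 = _
  ring

theorem wsum_perm (f : X → ℝ) (ξ : Config X) (σ : Equiv.Perm ℕ) :
    wsum f (fun k => ξ (σ k)) = wsum f ξ :=
  σ.tsum_eq fun k => ((ξ k).1 : ℝ) ^ 2 * f (ξ k).2

theorem wsum_add {f g : X → ℝ} {C D : ℝ} (hf : ∀ x, 0 ≤ f x) (hC : ∀ x, f x ≤ C)
    (hg : ∀ x, 0 ≤ g x) (hD : ∀ x, g x ≤ D) {ξ : Config X}
    (hξ : Summable fun k => ((ξ k).1 : ℝ)) : wsum f ξ + wsum g ξ = wsum (fun x => f x + g x) ξ := by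
  rw [wsum, wsum, wsum, ← (summable_wsum hf hC hξ).tsum_add (summable_wsum hg hD hξ)]
  simp only [mul_add]

theorem summable_scaleConfig {r : X → RPos} {C : ℝ} (hC : ∀ x, (r x : ℝ) ≤ C) {ξ : Config X}
    (hξ : Summable fun k => ((ξ k).1 : ℝ)) : Summable fun k => ((scaleConfig r ξ k).1 : ℝ) :=
  (hξ.mul_left C).of_nonneg_of_le (fun k => (scaleConfig r ξ k).1.2.le)
    fun k => mul_le_mul_of_nonneg_right (hC _) (ξ k).1.2.le

variable [StandardBorelSpace X] (m : Measure X) [IsProbabilityMeasure m] [NullSingletonClass m]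

theorem laplace_real {f : X → ℝ} {C δ : ℝ} (hf : Measurable f) (hδ : 0 < δ) (hfδ : ∀ x, δ ≤ f x)
    (hC : ∀ x, f x ≤ C) : Integrable (fun ξ => Real.exp (-wsum f ξ)) (lebesgueInf m) ∧
      ∫ ξ, Real.exp (-wsum f ξ) ∂lebesgueInf m =
        Real.exp (∫ x, ((expoInt 1).re - 1 / 2 * Real.log (f x)) ∂m) := by
  have h0 : ∀ x, 0 ≤ f x := fun x => hδ.le.trans (hfδ x)
  have hρ : IsScalarMap reCLM :=
    ⟨Complex.one_re, fun z => Complex.abs_re_le_norm z, fun _ => rfl⟩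
  have hb : ∀ x, ‖(f x : ℂ)‖ ≤ C := fun x => by
    rw [Complex.norm_real, Real.norm_eq_abs, abs_of_nonneg (h0 x)]
    exact hC x
  have hre : ∀ x, δ ≤ ((f x : ℂ)).re := fun x => by simpa using hfδ x
  have hm : Measurable fun x => (f x : ℂ) := Complex.measurable_ofReal.comp hf
  obtain ⟨h1, h2⟩ := laplace m hρ hm hδ hb hre
  have hae : laplaceProd reCLM (fun x => (f x : ℂ)) =ᵐ[lebesgueInf m]
      fun ξ => Real.exp (-wsum f ξ) := by
    filter_upwards [ae_goodConfig m] with ξ hξ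
    exact laplaceProd_real h0 hC hξ.2.1
  refine ⟨h1.congr hae, ?_⟩
  rw [← integral_congr_ae hae, h2, ← Real.exp_eq_exp_ℝ, ← reCLM.integral_comp_comm]
  · congr 1
    refine integral_congr_ae (Eventually.of_forall fun x => ?_)
    change (expoInt 1 - 1 / 2 * Complex.log (f x)).re = _
    rw [← Complex.ofReal_log (h0 x), Complex.sub_re]
    congr 1
    have : (1 / 2 * (Real.log (f x) : ℂ)) = ((1 / 2 * Real.log (f x) : ℝ) : ℂ) := by push_cast; rfl
    rw [this, ofReal_re]
  · refine (integrable_const _).sub (Integrable.const_mul ?_ _)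
    exact Integrable.of_bound hm.clog.aestronglyMeasurable _
      (Eventually.of_forall fun x => norm_log_le hδ (hb x) (hre x))

/-- Up to a constant factor, the multiplication of the weights by `r` takes the measure with
density `exp(-∑ (r(x_k) r_k)²)` to the measure with density `exp(-∑ r_k²)`, as far as the
coordinates of the cube can tell. -/
theorem map_coords_scaleConfig {r : X → RPos} (hr : Measurable r) {C δ : ℝ} (hδ : 0 < δ)
    (hrδ : ∀ x, δ ≤ r x) (hrC : ∀ x, (r x : ℝ) ≤ C) :
    ∃ c : ℝ≥0∞, ((lebesgueInf m).withDensity fun ξ =>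
        ENNReal.ofReal (Real.exp (-wsum (fun x => (r x : ℝ) ^ 2) ξ))).map
          (coords ∘ scaleConfig r) =
      c • ((lebesgueInf m).withDensity fun ξ =>
        ENNReal.ofReal (Real.exp (-wsum (fun _ => 1) ξ))).map coords := by
  have hrm : Measurable fun x => (r x : ℝ) := measurable_subtype_coe.comp hr
  have hb : ∀ x, δ ^ 2 ≤ (r x : ℝ) ^ 2 ∧ (r x : ℝ) ^ 2 ≤ C ^ 2 := fun x =>
    ⟨pow_le_pow_left₀ hδ.le (hrδ x) 2, pow_le_pow_left₀ (r x).2.le (hrC x) 2⟩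
  set P := (lebesgueInf m).withDensity fun ξ =>
    ENNReal.ofReal (Real.exp (-wsum (fun x => (r x : ℝ) ^ 2) ξ)) with hP
  set P' := (lebesgueInf m).withDensity fun ξ =>
    ENNReal.ofReal (Real.exp (-wsum (fun _ : X => 1) ξ)) with hP'
  have hi1 := (laplace_real m (hrm.pow_const 2) (pow_pos hδ 2) (fun x => (hb x).1)
    fun x => (hb x).2).1
  have hi2 := (laplace_real m (f := fun _ => 1) measurable_const zero_lt_one (fun _ => le_rfl)
    fun _ => le_rfl).1
  have : IsFiniteMeasure P := isFiniteMeasure_withDensity_ofReal hi1.2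
  have : IsFiniteMeasure P' := isFiniteMeasure_withDensity_ofReal hi2.2
  set a : ℝ := Real.exp (-∫ x, Real.log (r x) ∂m) with ha
  refine ⟨ENNReal.ofReal a, ?_⟩
  have : IsFiniteMeasure (ENNReal.ofReal a • P'.map coords) :=
    ⟨by
      rw [Measure.smul_apply, smul_eq_mul]
      exact ENNReal.mul_lt_top ENNReal.ofReal_lt_top (measure_lt_top _ _)⟩
  have hs := measurable_scaleConfig hr
  refine ext_of_moments fun s => ?_
  have hm := measurable_multiset_prod_coe s
  set g : X → ℝ := fun x => (s.map fun q => belowInd X q x).sum with hg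
  have hgm : Measurable g := measurable_multiset_sum_belowInd s
  have hg0 := fun x : X => (multiset_sum_belowInd_mem s x).1
  have hg1 := fun x : X => (multiset_sum_belowInd_mem s x).2
  rw [integral_smul_measure, ENNReal.toReal_ofReal (Real.exp_pos _).le,
    integral_map (measurable_coords.comp hs).aemeasurable hm.aestronglyMeasurable,
    integral_map measurable_coords.aemeasurable hm.aestronglyMeasurable, hP, hP',
    integral_withDensity_eq_integral_toReal_smul₀ hi1.aemeasurable.ennreal_ofReal
      (Eventually.of_forall fun _ => ENNReal.ofReal_lt_top),
    integral_withDensity_eq_integral_toReal_smul₀ hi2.aemeasurable.ennreal_ofReal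
      (Eventually.of_forall fun _ => ENNReal.ofReal_lt_top)]
  simp only [ENNReal.toReal_ofReal (Real.exp_pos _).le, Function.comp_apply]
  have e1 : (fun ξ => Real.exp (-wsum (fun x => (r x : ℝ) ^ 2) ξ) •
      (s.map fun q => (coords (scaleConfig r ξ) q : ℝ)).prod) =ᵐ[lebesgueInf m]
      fun ξ => Real.exp (-wsum (fun x => (r x : ℝ) ^ 2 * (1 + g x)) ξ) := by
    filter_upwards [ae_goodConfig m] with ξ hξ
    rw [prod_coords (summable_scaleConfig hrC hξ.2.1), smul_eq_mul, ← Real.exp_add, ← neg_add,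
      wsum_scaleConfig, wsum_add (C := C ^ 2) (D := C ^ 2 * s.card) (fun x => sq_nonneg _)
      (fun x => (hb x).2) (fun x => mul_nonneg (sq_nonneg _) (hg0 x))
      (fun x => mul_le_mul (hb x).2 (hg1 x) (hg0 x) (sq_nonneg _)) hξ.2.1]
    simp only [mul_add, mul_one, hg]
  have e2 : (fun ξ : Config X => Real.exp (-wsum (fun _ => 1) ξ) •
      (s.map fun q => (coords ξ q : ℝ)).prod) =ᵐ[lebesgueInf m]
      fun ξ => Real.exp (-wsum (fun x => 1 + g x) ξ) := by
    filter_upwards [ae_goodConfig m] with ξ hξ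
    rw [prod_coords hξ.2.1, smul_eq_mul, ← Real.exp_add, ← neg_add,
      wsum_add (C := 1) (fun x => zero_le_one) (fun x => le_rfl) hg0 hg1 hξ.2.1]
  -- both sides are now Laplace functionals, whose logarithms differ by `-∫ log r dm`
  have h1g : ∀ x, 1 ≤ 1 + g x := fun x => le_add_of_nonneg_right (hg0 x)
  have h2g : ∀ x, 1 + g x ≤ 1 + s.card := fun x => add_le_add le_rfl (hg1 x)
  rw [integral_congr_ae e1, integral_congr_ae e2,
    (laplace_real m (f := fun x => (r x : ℝ) ^ 2 * (1 + g x)) ((hrm.pow_const 2).mul (hgm.const_add 1)) (pow_pos hδ 2)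
      (fun x => (hb x).1.trans (le_mul_of_one_le_right (sq_nonneg _) (h1g x)))
      (C := C ^ 2 * (1 + s.card)) (fun x => mul_le_mul (hb x).2 (h2g x)
        (zero_le_one.trans (h1g x)) (sq_nonneg _))).2,
    (laplace_real m (hgm.const_add 1) zero_lt_one h1g h2g).2, smul_eq_mul, ← Real.exp_add]
  congr 1
  have hil : Integrable (fun x => Real.log (r x)) m := by
    refine Integrable.of_bound (C := max |Real.log δ| |Real.log C|) hrm.log.aestronglyMeasurable
      (Eventually.of_forall fun x => ?_)
    rw [Real.norm_eq_abs]
    exact abs_le_max_abs_abs (Real.log_le_log hδ (hrδ x)) (Real.log_le_log (r x).2 (hrC x))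
  have hil2 : Integrable (fun x => Real.log (1 + g x)) m := by
    refine Integrable.of_bound (C := max |Real.log 1| |Real.log (1 + s.card)|)
      (hgm.const_add 1).log.aestronglyMeasurable (Eventually.of_forall fun x => ?_)
    rw [Real.norm_eq_abs]
    exact abs_le_max_abs_abs (Real.log_le_log zero_lt_one (h1g x))
      (Real.log_le_log (zero_lt_one.trans_le (h1g x)) (h2g x))
  rw [← integral_neg]
  refine Eq.trans ?_ (integral_add hil.neg
    ((integrable_const (expoInt 1).re).sub (hil2.const_mul (1 / 2))))
  refine integral_congr_ae (Eventually.of_forall fun x => ?_)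
  change _ - 1 / 2 * Real.log ((r x : ℝ) ^ 2 * (1 + g x)) = -Real.log (r x) + (_ - _)
  rw [Real.log_mul (pow_pos (r x).2 2).ne' (zero_lt_one.trans_le (h1g x)).ne', Real.log_pow]
  push_cast
  ring

theorem goodConfig_perm {r : X → RPos} {C : ℝ} (hrC : ∀ x, (r x : ℝ) ≤ C) {ξ : Config X}
    (hξ : ξ ∈ goodConfig X) {σ : Equiv.Perm ℕ}
    (hσ : StrictAnti fun k => (scaleConfig r ξ (σ k)).1) :
    (fun k => scaleConfig r ξ (σ k)) ∈ goodConfig X :=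
  ⟨hσ, (summable_scaleConfig hrC hξ.2.1).comp_injective σ.injective,
    hξ.2.2.comp σ.injective⟩

/-- Quasi-invariance: a property of almost all configurations `ξ` is shared by the decreasing
enumerations of `r ξ` for almost all `ξ`. -/
theorem ae_sorted_scaleConfig {r : X → RPos} (hr : Measurable r) {C δ : ℝ} (hδ : 0 < δ)
    (hrδ : ∀ x, δ ≤ r x) (hrC : ∀ x, (r x : ℝ) ≤ C) {p : Config X → Prop}
    (hp : ∀ᵐ ξ ∂lebesgueInf m, p ξ) : ∀ᵐ ξ ∂lebesgueInf m, ∀ σ : Equiv.Perm ℕ,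
      StrictAnti (fun k => (scaleConfig r ξ (σ k)).1) → p fun k => scaleConfig r ξ (σ k) := by
  set N := toMeasurable (lebesgueInf m) {ξ | ¬ p ξ} ∩ goodConfig X with hN
  have hNm : MeasurableSet N := (measurableSet_toMeasurable _ _).inter measurableSet_goodConfig
  have hN0 : lebesgueInf m N = 0 :=
    measure_mono_null Set.inter_subset_left ((measure_toMeasurable _).trans hp)
  have him : MeasurableSet (coords '' N) :=
    hNm.image_of_measurable_injOn measurable_coords (coords_injOn.mono Set.inter_subset_right)
  have hpre : lebesgueInf m (coords ⁻¹' (coords '' N)) = 0 := by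
    refine measure_mono_null (t := N ∪ (goodConfig X)ᶜ) ?_
      (measure_union_null hN0 (ae_goodConfig m))
    rintro ξ ⟨η, hη, h⟩
    by_cases hξ : ξ ∈ goodConfig X
    · left
      rwa [← coords_injOn hη.2 hξ h]
    · exact Or.inr hξ
  obtain ⟨c, hc⟩ := map_coords_scaleConfig m hr hδ hrδ hrC
  have h1 := congrArg (fun Q => Q (coords '' N)) hc
  have hs := measurable_scaleConfig hr
  simp only [Measure.smul_apply] at h1
  rw [Measure.map_apply (measurable_coords.comp hs) him, Measure.map_apply measurable_coords him,
    withDensity_absolutelyContinuous _ _ hpre, smul_zero] at h1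
  have h2 := (withDensity_absolutelyContinuous' (μ := lebesgueInf m)
    (measurable_wsum (f := fun x => (r x : ℝ) ^ 2)
      ((measurable_subtype_coe.comp hr).pow_const 2)).neg.exp.ennreal_ofReal.aemeasurable
    (Eventually.of_forall fun ξ => (ENNReal.ofReal_pos.2 (Real.exp_pos _)).ne')) h1
  filter_upwards [ae_goodConfig m, measure_eq_zero_iff_ae_notMem.1 h2] with ξ hξ hξ2 σ hσ
  by_contra hne
  refine hξ2 ⟨_, ⟨subset_toMeasurable _ _ hne, goodConfig_perm hrC hξ hσ⟩, ?_⟩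
  funext q
  refine Subtype.ext ?_
  change Real.exp (-wsum _ (fun k => scaleConfig r ξ (σ k))) = Real.exp (-wsum _ (scaleConfig r ξ))
  rw [wsum_perm]

theorem ae_exists_sort {r : X → RPos} (hr : Measurable r) {C : ℝ} (hrC : ∀ x, (r x : ℝ) ≤ C) :
    ∀ᵐ ξ ∂lebesgueInf m, ∃ σ : Equiv.Perm ℕ, StrictAnti fun k => (scaleConfig r ξ (σ k)).1 := by
  filter_upwards [ae_goodConfig m, ae_scaled_injective m hr] with ξ hξ hinj
  exact exists_perm_strictAnti (w := fun k => ((scaleConfig r ξ k).1 : ℝ))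
    (fun k => (scaleConfig r ξ k).1.2) (summable_scaleConfig hrC hξ.2.1).tendsto_atTop_zero
    (Subtype.val_injective.comp hinj)

end QuasiInvariance

/-! ### The integral models -/

section Parabolic

variable {d : ℕ}

theorem mat_dil_inv (r : RPos) : mat ((dil r)⁻¹ : UGroup d) =
    Matrix.diagonal (Sum.elim (fun _ => (r : ℂ)) (Sum.elim (fun _ => 1) fun _ => (r : ℂ)⁻¹)) := rfl

theorem lobAct_dil (r : RPos) (v : ℂ × (Fin d → ℂ)) :
    lobAct (dil r) v = ((r : ℂ) ^ 2 * v.1, (r : ℂ) • v.2) := by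
  have h : ((r : ℝ) : ℂ) ≠ 0 := ofReal_ne_zero.2 r.2.ne'
  have h12 : b12 (dil r : UGroup d) = 0 := funext fun i => by simp [b12, mat_dil]
  have h32 : b32 (dil r : UGroup d) = 0 := funext fun i => by simp [b32, mat_dil]
  have h21 : b21 (dil r : UGroup d) = 0 := funext fun i => by simp [b21, mat_dil]
  have h23 : b23 (dil r : UGroup d) = 0 := funext fun i => by simp [b23, mat_dil]
  have h22 : b22 (dil r : UGroup d) = 1 := by
    ext i j
    by_cases hij : i = j
    · subst hij
      simp [b22, mat_dil]
    · simp [b22, mat_dil, hij, Matrix.diagonal_apply_ne]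
  have h13 : b13 (dil r : UGroup d) = 0 := by simp [b13, mat_dil]
  have h31 : b31 (dil r : UGroup d) = 0 := by simp [b31, mat_dil]
  have h33 : b33 (dil r : UGroup d) = r := by simp [b33, mat_dil]
  rw [lobAct, h12, h32, h21, h23, h22, h13, h31, h33, b11_dil]
  ext
  · simp only [zero_dotProduct, zero_mul, add_zero, inv_inv, zero_add]
    ring
  · simp

/-- On `P₀` the action on `L` has the form of the action of `T(g)` on the parameters of exponential
vectors. -/
theorem lobAct_parabolic0 (g : Parabolic0 d) (v : ℂ × (Fin d → ℂ)) : lobAct (g : UGroup d) v =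
    (v.1 + (b11 (g : UGroup d))⁻¹ * (b31 (g : UGroup d) + b32 (g : UGroup d) ⬝ᵥ v.2),
      (b11 (g : UGroup d))⁻¹ • (b21 (g : UGroup d) + b22 (g : UGroup d) *ᵥ v.2)) := by
  obtain ⟨g, hP, hn⟩ := g
  have h0 := b11_ne_zero hP
  have h33 : b33 g = b11 g := by
    have h1 := b33_conj_mul hP
    have h2 : b11 g * conj (b11 g) = 1 := by rw [Complex.mul_conj', hn]; simp
    have h3 := mul_left_cancel₀ h0 (h1.trans h2.symm)
    exact star_injective h3
  change lobAct g v = _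
  rw [lobAct, hP.1, hP.2.1, hP.2.2, h33]
  simp only [zero_dotProduct, zero_mul, add_zero, smul_zero]
  ext
  · simp only []
    field_simp
    ring
  · rfl

/-- The group `P₀` preserves the boundary of `L`. -/
theorem lobHeight_lobAct_zero (g : Parabolic0 d) : lobHeight (lobAct (g : UGroup d) 0) = 0 := by
  have h0 : lobFac (g : UGroup d) 0 ≠ 0 := by
    have h1 : lobFac (g : UGroup d) 0 = b11 (g : UGroup d) := by simp [lobFac]
    rw [h1]
    exact b11_ne_zero g.2.1
  have h2 := lobKer_lobAct h0 h0
  have h3 : lobKer (0 : ℂ × (Fin d → ℂ)) 0 = 0 := by simp [lobKer]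
  rw [h3, lobKer_self, mul_eq_zero, or_iff_left (mul_ne_zero h0 ((map_ne_zero _).2 h0))] at h2
  exact_mod_cast h2

theorem autP0_blocks (r : RPos) (g : Parabolic0 d) :
    b11 (autP0 r g : UGroup d) = b11 (g : UGroup d) ∧
    b21 (autP0 r g : UGroup d) = (r : ℂ) • b21 (g : UGroup d) ∧
    b22 (autP0 r g : UGroup d) = b22 (g : UGroup d) ∧
    b31 (autP0 r g : UGroup d) = (r : ℂ) ^ 2 * b31 (g : UGroup d) ∧
    b32 (autP0 r g : UGroup d) = (r : ℂ) • b32 (g : UGroup d) := by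
  have h : ((r : ℝ) : ℂ) ≠ 0 := ofReal_ne_zero.2 r.2.ne'
  have hmat : ∀ i j, mat (autP0 r g : UGroup d) i j =
      Sum.elim (fun _ => (r : ℂ)⁻¹) (Sum.elim (fun _ => 1) fun _ => (r : ℂ)) i *
        mat (g : UGroup d) i j *
        Sum.elim (fun _ => (r : ℂ)) (Sum.elim (fun _ => 1) fun _ => (r : ℂ)⁻¹) j := by
    intro i j
    change mat ((dil r : UGroup d) * (g : UGroup d) * (dil r : UGroup d)⁻¹) i j = _
    rw [mat_mul, mat_mul, mat_dil, mat_dil_inv, Matrix.mul_diagonal, Matrix.diagonal_mul]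
  refine ⟨?_, funext fun i => ?_, Matrix.ext fun i j => ?_, ?_, funext fun i => ?_⟩
  · simp only [b11, hmat, Sum.elim_inl]
    field_simp
  · simp [b21, hmat, mul_comm]
  · simp [b22, hmat]
  · simp only [b31, hmat, Sum.elim_inl, Sum.elim_inr]
    ring
  · simp [b32, hmat]

theorem dil_mul_unip (p : Parabolic d) : (dil (radial p) : UGroup d) * (unip p : UGroup d) = p :=
  mul_inv_cancel_left _ _

theorem norm_b31_unip (p : Parabolic d) :
    ‖b31 (unip p : UGroup d)‖ = ‖b11 (p : UGroup d)‖ * ‖b31 (p : UGroup d)‖ := by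
  have : b31 (unip p : UGroup d) = ((radial p : RPos) : ℂ)⁻¹ * b31 (p : UGroup d) := by
    change mat ((dil (radial p) : UGroup d)⁻¹ * (p : UGroup d)) _ _ = _
    rw [mat_mul, mat_dil_inv, Matrix.diagonal_mul]
    rfl
  rw [this, norm_mul, norm_inv, Complex.norm_real]
  simp [radial]

theorem radial_bounds {X : Type*} [MeasurableSpace X] {p : X → Parabolic d}
    (hp : (fun x => (p x : UGroup d)) ∈ CurrentGroup d X) :
    Measurable (fun x => radial (p x)) ∧ ∃ C δ D : ℝ, 0 < δ ∧ ∀ x, δ ≤ radial (p x) ∧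
      (radial (p x) : ℝ) ≤ C ∧ ‖(lobAct (unip (p x) : UGroup d) 0).1‖ ≤ D := by
  obtain ⟨hm, C, hC⟩ := hp
  refine ⟨(hm _ _).norm.inv.subtype_mk, C, (max C 1)⁻¹, C * C, by positivity, fun x => ⟨?_, ?_, ?_⟩⟩
  · have h0 := norm_pos_iff.2 (b11_ne_zero (p x).2)
    exact inv_anti₀ h0 ((hC x _ _).trans (le_max_left _ _))
  · have h1 := congrArg norm (b33_conj_mul (p x).2)
    rw [norm_mul, RCLike.norm_conj, norm_one] at h1
    change ‖b11 (p x : UGroup d)‖⁻¹ ≤ C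
    rw [inv_eq_of_mul_eq_one_right h1]
    exact hC x _ _
  · rw [lobAct_parabolic0]
    simp only [Prod.fst_zero, Prod.snd_zero, dotProduct_zero, add_zero, zero_add]
    rw [norm_mul, norm_inv, (unip (p x)).2.2, inv_one, one_mul, norm_b31_unip]
    exact mul_le_mul (hC x _ _) (hC x _ _) (norm_nonneg _)
      ((norm_nonneg _).trans (hC x (.inl ()) (.inl ())))

end Parabolic

namespace ExpSystem

variable {𝕜 : Type*} [RCLike 𝕜] {E : Type*} [NormedAddCommGroup E] [InnerProductSpace 𝕜 E] {d : ℕ}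
  (A : ExpSystem 𝕜 E d)

/-- The operator `T_r(g)` acts on the factor at an atom of weight `r` by the action of `g` on `L`. -/
theorem S_autP0 (r : RPos) (g : Parabolic0 d) (v : ℂ × (Fin d → ℂ)) :
    A.S (autP0 r g) (A.e ((r : ℂ) ^ 2 * v.1) ((r : ℂ) • v.2)) =
      A.e ((r : ℂ) ^ 2 * (lobAct (g : UGroup d) v).1) ((r : ℂ) • (lobAct (g : UGroup d) v).2) := by
  obtain ⟨h11, h21, h22, h31, h32⟩ := autP0_blocks r g
  rw [A.S_e, h11, h21, h22, h31, h32, lobAct_parabolic0]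
  congr 1
  · simp only [smul_dotProduct, dotProduct_smul, smul_eq_mul]
    ring
  · rw [Matrix.mulVec_smul, ← smul_add, smul_comm]

theorem norm_S_autP0_vac_sub_le (r : RPos) (g : Parabolic0 d) {D : ℝ}
    (hD : ‖(lobAct (g : UGroup d) 0).1‖ ≤ D) :
    ‖A.S (autP0 r g) A.vac - A.vac‖ ≤ r * (2 * √D) := by
  have h1 := A.S_autP0 r g 0
  simp only [Prod.fst_zero, Prod.snd_zero, mul_zero, smul_zero, A.e_zero] at h1
  rw [h1]
  refine (A.norm_e_sub_vac_le (lobHeight_lobAct_zero g).ge _ r.2.le).trans ?_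
  have : (0 : ℝ) ≤ r := r.2.le
  gcongr

variable {X : Type*} [MeasurableSpace X] (m : Measure X)

/-- The integral model acts on the section `F_v` by the action of `P^X` on `v`, up to a factor. -/
theorem intModel_F {p : X → Parabolic d} (hp : (fun x => (p x : UGroup d)) ∈ CurrentGroup d X)
    {v : X → ℂ × (Fin d → ℂ)} (hv : v ∈ LobCurrents d X) {ξ : Config X}
    (hξ : Summable fun k => ((ξ k).1 : ℝ))
    (hσ : ∃ σ : Equiv.Perm ℕ, StrictAnti fun k => (scaleConfig (fun x => radial (p x)) ξ (σ k)).1) :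
    intModel A.S m p (A.F v) ξ = (Real.exp (1 / 2 * ∫ x, Real.log (radial (p x)) ∂m) : 𝕜) •
      A.F (actX (fun x => (p x : UGroup d)) v) ξ := by
  obtain ⟨-, C, δ, D, hδ, hb⟩ := radial_bounds hp
  have e1 : evalAt 𝕜 (actP0 A.S (fun x => unip (p x)) (A.F v))
      (scaleConfig (fun x => radial (p x)) ξ) = A.F (actX (fun x => (p x : UGroup d)) v) ξ := by
    rw [evalAt, dif_pos hσ]
    set σ := hσ.choose
    set η : Config X := fun k => scaleConfig (fun x => radial (p x)) ξ (σ k) with hη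
    have hs : Summable fun k => ((η k).1 : ℝ) :=
      (summable_scaleConfig (fun x => (hb x).2.1) hξ).comp_injective σ.injective
    have hA : Summable fun k =>
        ‖A.S (autP0 (η k).1 (unip (p (η k).2))) A.vac - A.vac‖ :=
      (hs.mul_right (2 * √D)).of_nonneg_of_le (fun _ => norm_nonneg _)
        fun k => A.norm_S_autP0_vac_sub_le _ _ (hb _).2.2
    have hf := A.summable_factor_of_mem hv hs
    have hf' : Summable fun k => ‖A.S (autP0 (η k).1 (unip (p (η k).2)))
        (A.e (((η k).1 : ℂ) ^ 2 * (v (η k).2).1) (((η k).1 : ℂ) • (v (η k).2).2)) - A.vac‖ := by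
      refine (hf.add hA).of_nonneg_of_le (fun _ => norm_nonneg _) fun k => ?_
      refine (norm_sub_le_norm_sub_add_norm_sub _ (A.S (autP0 (η k).1 (unip (p (η k).2))) A.vac)
        _).trans (add_le_add (le_of_eq ?_) le_rfl)
      rw [← map_sub, LinearIsometry.norm_map]
    change permOp 𝕜 A.vac σ (tensorOp A.vac (fun k => A.S (autP0 (η k).1 (unip (p (η k).2))))
      (A.F v η)) = _
    rw [F, tensorOp_tprod hA hf, permOp_tprod σ hf', F]
    congr 1
    funext k
    rw [A.S_autP0]
    have h1 : η (σ.symm k) = scaleConfig (fun x => radial (p x)) ξ k := by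
      simp only [hη, Equiv.apply_symm_apply]
    have h2 : actX (fun x => (p x : UGroup d)) v (ξ k).2 = lobAct (dil (radial (p (ξ k).2)))
        (lobAct (unip (p (ξ k).2) : UGroup d) (v (ξ k).2)) := by
      rw [← lobAct_mul _ _ (LobCurrents.mem_lob hv _), dil_mul_unip]
      rfl
    rw [h1, h2, lobAct_dil]
    congr 1
    · change (((radial (p (ξ k).2) : ℝ) * ((ξ k).1 : ℝ) : ℝ) : ℂ) ^ 2 *
        (lobAct (unip (p (ξ k).2) : UGroup d) (v (ξ k).2)).1 = _
      push_cast
      ring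
    · change (((radial (p (ξ k).2) : ℝ) * ((ξ k).1 : ℝ) : ℝ) : ℂ) •
        (lobAct (unip (p (ξ k).2) : UGroup d) (v (ξ k).2)).2 = _
      rw [smul_smul]
      push_cast
      rw [mul_comm]
  rw [← e1]
  rfl

/-- At each configuration, the integral model applies a bounded operator to the value of the section
at the decreasing enumeration of the dilated configuration. -/
theorem exists_intModel_eq (p : X → Parabolic d) {ξ : Config X}
    (hσ : ∃ σ : Equiv.Perm ℕ, StrictAnti fun k => (scaleConfig (fun x => radial (p x)) ξ (σ k)).1) :
    ∃ (M : TensorPow 𝕜 A.vac →L[𝕜] TensorPow 𝕜 A.vac) (σ : Equiv.Perm ℕ),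
      (StrictAnti fun k => (scaleConfig (fun x => radial (p x)) ξ (σ k)).1) ∧
      ∀ Φ, intModel A.S m p Φ ξ = M (Φ fun k => scaleConfig (fun x => radial (p x)) ξ (σ k)) := by
  refine ⟨(Real.exp (1 / 2 * ∫ x, Real.log (radial (p x)) ∂m) : 𝕜) •
    (permOp 𝕜 A.vac hσ.choose).comp (tensorOp A.vac fun k =>
      A.S (autP0 (scaleConfig (fun x => radial (p x)) ξ (hσ.choose k)).1
        (unip (p (scaleConfig (fun x => radial (p x)) ξ (hσ.choose k)).2)))),
    hσ.choose, hσ.choose_spec, fun Φ => ?_⟩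
  have e1 : evalAt 𝕜 (actP0 A.S (fun x => unip (p x)) Φ) (scaleConfig (fun x => radial (p x)) ξ) =
      permOp 𝕜 A.vac hσ.choose (actP0 A.S (fun x => unip (p x)) Φ
        fun k => scaleConfig (fun x => radial (p x)) ξ (hσ.choose k)) := by
    rw [evalAt, dif_pos hσ]
  change (Real.exp (1 / 2 * ∫ x, Real.log (radial (p x)) ∂m) : 𝕜) •
    evalAt 𝕜 (actP0 A.S (fun x => unip (p x)) Φ) (scaleConfig (fun x => radial (p x)) ξ) = _
  rw [e1]
  rfl

variable [StandardBorelSpace X] [IsProbabilityMeasure m] [NullSingletonClass m]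

/-- A bounded operator that acts on the sections `F_v` like the integral model coincides with the
integral model. The vectors on which they agree form a closed subspace, because the integral model
respects almost everywhere convergence by quasi-invariance. -/
theorem ae_eq_intModel {p : X → Parabolic d} (hp : (fun x => (p x : UGroup d)) ∈ CurrentGroup d X)
    (U : INT 𝕜 A.vac m →L[𝕜] INT 𝕜 A.vac m)
    (hU : ∀ v ∈ LobCurrents d X, U (A.vec m v) =
      (Real.exp (1 / 2 * ∫ x, Real.log (radial (p x)) ∂m) : 𝕜) •
        A.vec m (actX (fun x => (p x : UGroup d)) v)) (Φ : INT 𝕜 A.vac m) :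
    U Φ =ᵐ[lebesgueInf m] intModel A.S m p Φ := by
  obtain ⟨hr, C, δ, D, hδ, hb⟩ := radial_bounds hp
  have hsort := ae_exists_sort m hr (fun x => (hb x).2.1)
  have hqi := fun {q : Config X → Prop} (hq : ∀ᵐ ξ ∂lebesgueInf m, q ξ) =>
    ae_sorted_scaleConfig m hr hδ (fun x => (hb x).1) (fun x => (hb x).2.1) hq
  let K : Submodule 𝕜 (INT 𝕜 A.vac m) :=
    { carrier := {Φ | U Φ =ᵐ[lebesgueInf m] intModel A.S m p Φ}
      zero_mem' := by
        have h0 := Lp.coeFn_zero (TensorPow 𝕜 A.vac) 2 (lebesgueInf m)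
        change U 0 =ᵐ[lebesgueInf m] intModel A.S m p (0 : INT 𝕜 A.vac m)
        rw [map_zero]
        filter_upwards [h0, hqi h0, hsort] with ξ h1 h2 h3
        obtain ⟨M, σ, hσ, hM⟩ := A.exists_intModel_eq m p h3
        rw [hM, h2 σ hσ, h1, Pi.zero_apply, Pi.zero_apply, map_zero]
      add_mem' := by
        intro Φ Ψ hΦ hΨ
        change U (Φ + Ψ) =ᵐ[lebesgueInf m] intModel A.S m p (Φ + Ψ : INT 𝕜 A.vac m)
        rw [map_add]
        filter_upwards [hΦ, hΨ, Lp.coeFn_add (U Φ) (U Ψ), hqi (Lp.coeFn_add Φ Ψ), hsort]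
          with ξ h1 h2 h3 h4 h5
        obtain ⟨M, σ, hσ, hM⟩ := A.exists_intModel_eq m p h5
        rw [hM, h4 σ hσ, h3, Pi.add_apply, Pi.add_apply, map_add, h1, h2, hM, hM]
      smul_mem' := by
        intro c Φ hΦ
        change U (c • Φ) =ᵐ[lebesgueInf m] intModel A.S m p (c • Φ : INT 𝕜 A.vac m)
        rw [map_smul]
        filter_upwards [hΦ, Lp.coeFn_smul c (U Φ), hqi (Lp.coeFn_smul c Φ), hsort]
          with ξ h1 h3 h4 h5
        obtain ⟨M, σ, hσ, hM⟩ := A.exists_intModel_eq m p h5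
        rw [hM, h4 σ hσ, h3, Pi.smul_apply, Pi.smul_apply, map_smul, h1, hM] }
  have hcl : IsClosed (K : Set (INT 𝕜 A.vac m)) := by
    refine IsSeqClosed.isClosed fun Ψ Φ hΨ hlim => ?_
    obtain ⟨φ, hφ, h1⟩ := (tendstoInMeasure_of_tendsto_Lp hlim).exists_seq_tendsto_ae
    have hlim2 := ((U.continuous.tendsto Φ).comp hlim).comp hφ.tendsto_atTop
    obtain ⟨ψ, hψ, h2⟩ := (tendstoInMeasure_of_tendsto_Lp hlim2).exists_seq_tendsto_ae
    have hall : ∀ᵐ ξ ∂lebesgueInf m, ∀ n, U (Ψ n) ξ = intModel A.S m p (Ψ n) ξ :=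
      ae_all_iff.2 hΨ
    filter_upwards [hall, h2, hqi h1, hsort] with ξ h3 h4 h5 h6
    obtain ⟨M, σ, hσ, hM⟩ := A.exists_intModel_eq m p h6
    have h7 := (M.continuous.tendsto _).comp ((h5 σ hσ).comp hψ.tendsto_atTop)
    rw [hM]
    refine tendsto_nhds_unique h4 (h7.congr fun n => ?_)
    simp only [Function.comp_apply, h3, hM]
  have hvec : A.vec m '' LobCurrents d X ⊆ K := by
    rintro _ ⟨v, hv, rfl⟩
    change U (A.vec m v) =ᵐ[lebesgueInf m] intModel A.S m p (A.vec m v)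
    have hpv : actX (fun x => (p x : UGroup d)) v ∈ LobCurrents d X := actX_mem ⟨_, hp⟩ hv
    rw [hU v hv]
    filter_upwards [Lp.coeFn_smul (Real.exp (1 / 2 * ∫ x, Real.log (radial (p x)) ∂m) : 𝕜)
      (A.vec m (actX (fun x => (p x : UGroup d)) v)), A.vec_ae m hpv, hqi (A.vec_ae m hv), hsort,
      ae_goodConfig m] with ξ h1 h2 h3 h4 h5
    have h6 := A.intModel_F m hp hv h5.2.1 h4
    obtain ⟨M, σ, hσ, hM⟩ := A.exists_intModel_eq m p h4
    rw [hM] at h6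
    rw [hM, h3 σ hσ, h6, h1, Pi.smul_apply, h2]
  have := Submodule.topologicalClosure_minimal _ (Submodule.span_le.2 hvec) hcl
  rw [A.span_vec_closure m] at this
  exact this (Submodule.mem_top : Φ ∈ ⊤)

end ExpSystem

/-! ### The operators of the current group -/

/-- Linear combinations with the same coefficients of two families with the same Gram matrix have
the same norm. -/
theorem norm_linearCombination_eq {𝕜 V W ι : Type*} [RCLike 𝕜] [NormedAddCommGroup V]
    [InnerProductSpace 𝕜 V] [NormedAddCommGroup W] [InnerProductSpace 𝕜 W] {a : ι → V} {b : ι → W}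
    (h : ∀ i j, ⟪a i, a j⟫_𝕜 = ⟪b i, b j⟫_𝕜) (x : ι →₀ 𝕜) :
    ‖Finsupp.linearCombination 𝕜 a x‖ = ‖Finsupp.linearCombination 𝕜 b x‖ := by
  refine (sq_eq_sq₀ (norm_nonneg _) (norm_nonneg _)).1 ?_
  rw [← inner_self_eq_norm_sq (𝕜 := 𝕜), ← inner_self_eq_norm_sq (𝕜 := 𝕜)]
  congr 1
  simp only [Finsupp.linearCombination_apply, Finsupp.sum, sum_inner, inner_sum, inner_smul_left,
    inner_smul_right, h]

section Parabolic

variable {d : ℕ}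

theorem lobFac_parabolic (p : Parabolic d) (v : ℂ × (Fin d → ℂ)) :
    lobFac (p : UGroup d) v = b11 (p : UGroup d) := by
  rw [lobFac, p.2.1, p.2.2.1]
  simp

theorem cKer_parabolic (p : Parabolic d) {v w : ℂ × (Fin d → ℂ)} (hv : v ∈ Lob d)
    (hw : w ∈ Lob d) : cKer (lobAct (p : UGroup d) v) (lobAct (p : UGroup d) w) =
      2 * (Real.log (radial p) : ℂ) + cKer v w := by
  have h0 := b11_ne_zero p.2
  have h1 := lobKer_lobAct (lobFac_ne_zero (p : UGroup d) hv) (lobFac_ne_zero (p : UGroup d) hw)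
  rw [lobFac_parabolic, lobFac_parabolic, Complex.mul_conj'] at h1
  have h2 : lobKer (lobAct (p : UGroup d) v) (lobAct (p : UGroup d) w) =
      (((radial p : ℝ) ^ 2 : ℝ) : ℂ) * lobKer v w := by
    have h3 : ((‖b11 (p : UGroup d)‖ : ℝ) : ℂ) ≠ 0 := ofReal_ne_zero.2 (norm_ne_zero_iff.2 h0)
    rw [← h1]
    simp only [radial]
    push_cast
    field_simp
  have hne : lobKer v w ≠ 0 := fun h => by
    have := lobKer_re_pos hv hw
    rw [h] at this
    exact lt_irrefl _ this
  rw [cKer_eq, cKer_eq, h2, Complex.log_ofReal_mul (pow_pos (radial p).2 2) hne, Real.log_pow]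
  push_cast
  ring

/-- On the parabolic subgroup, the function `u` depends only on the multiplicator. -/
theorem uFun_parabolic (p : Parabolic d) {v : ℂ × (Fin d → ℂ)} (hv : v ∈ Lob d) :
    uFun .plus (p : UGroup d) v = (Real.log (radial p) : ℂ) := by
  have h0 := basePt_mem (d := d)
  have e : ∀ z, cj .plus z = z := fun _ => rfl
  rw [uFun, e, cKer_parabolic p hv h0, cKer_parabolic p h0 h0]
  ring

end Parabolic

namespace ExpSystem

variable {𝕜 : Type*} [RCLike 𝕜] {E : Type*} [NormedAddCommGroup E] [InnerProductSpace 𝕜 E] {d : ℕ}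
  (A : ExpSystem 𝕜 E d)

theorem conj_ρ (z : ℂ) : conj (A.ρ z) = A.ρ (conj z) := by
  rcases eq_or_ne z 0 with rfl | hz
  · simp
  have h1 := inner_conj_symm (𝕜 := 𝕜) (A.e 0 (0 : Fin d → ℂ)) (A.e (conj (log z)) 0)
  rw [A.inner_e, A.inner_e] at h1
  simpa [Complex.exp_conj, Complex.exp_log hz] using h1

theorem ρ_ofReal (t : ℝ) : A.ρ (t : ℂ) = (t : 𝕜) := by
  have h1 := realLinear_ofReal_mul A.ρ t 1
  rwa [mul_one, A.isScalarMap.one, mul_one] at h1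

theorem exp_half_mul_ofReal (t : ℝ) :
    NormedSpace.exp (1 / 2 * A.ρ (t : ℂ)) = (Real.exp (1 / 2 * t) : 𝕜) := by
  have h1 := NormedSpace.map_exp (RCLike.ofRealAm (K := 𝕜)) RCLike.continuous_ofReal (1 / 2 * t)
  rw [← Real.exp_eq_exp_ℝ] at h1
  refine Eq.trans ?_ h1.symm
  rw [A.ρ_ofReal]
  congr 1
  change _ = ((1 / 2 * t : ℝ) : 𝕜)
  push_cast
  rfl

variable {X : Type*} [MeasurableSpace X] (m : Measure X)

/-- The multiplier `exp(½ ∫ u(g, v) dm)`, with the map `ρ` applied to the integral. -/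
def mult (g : CurrentGroup d X) (v : X → ℂ × (Fin d → ℂ)) : 𝕜 :=
  NormedSpace.exp (1 / 2 * A.ρ (∫ x, uFun .plus ((g : X → UGroup d) x) (v x) ∂m))

theorem mult_ne_zero (g : CurrentGroup d X) (v : X → ℂ × (Fin d → ℂ)) : A.mult m g v ≠ 0 :=
  (NormedSpace.isUnit_exp _).ne_zero

variable [IsProbabilityMeasure m]

/-- The cocycle identity for the multipliers, up to a factor that does not depend on `v`. -/
theorem mult_mul (g k : CurrentGroup d X) : ∃ θ : ℝ, ∀ v ∈ LobCurrents d X,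
    A.mult m (g * k) v = NormedSpace.exp (1 / 2 * A.ρ (θ * I)) *
      (A.mult m k v * A.mult m g (actX (k : X → UGroup d) v)) := by
  refine ⟨∫ x, (uFun .plus (((g * k : CurrentGroup d X) : X → UGroup d) x) (basePt d) -
    uFun .plus ((k : X → UGroup d) x) (basePt d) -
    uFun .plus ((g : X → UGroup d) x) (lobAct ((k : X → UGroup d) x) (basePt d))).im ∂m,
    fun v hv => ?_⟩
  have i1 := integrable_uFun m (g * k) hv
  have i2 := integrable_uFun m k hv
  have i3 := integrable_uFun m g (actX_mem k hv)
  have h1 : ∫ x, uFun .plus (((g * k : CurrentGroup d X) : X → UGroup d) x) (v x) ∂m =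
      ((∫ x, (uFun .plus (((g * k : CurrentGroup d X) : X → UGroup d) x) (basePt d) -
        uFun .plus ((k : X → UGroup d) x) (basePt d) - uFun .plus ((g : X → UGroup d) x)
          (lobAct ((k : X → UGroup d) x) (basePt d))).im ∂m : ℝ) : ℂ) * I +
      ((∫ x, uFun .plus ((k : X → UGroup d) x) (v x) ∂m) +
        ∫ x, uFun .plus ((g : X → UGroup d) x) (actX (k : X → UGroup d) v x) ∂m) := by
    rw [← sub_eq_iff_eq_add, ← integral_add i2 i3, ← integral_complex_ofReal, ← integral_mul_const]
    refine (integral_sub i1 (i2.add i3)).symm.trans ?_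
    refine integral_congr_ae (Eventually.of_forall fun x => ?_)
    have h2 := uFun_mul ((g : X → UGroup d) x) ((k : X → UGroup d) x) (LobCurrents.mem_lob hv x)
    rw [sub_sub] at h2
    exact h2
  unfold mult
  rw [h1, map_add, map_add, mul_add, mul_add, NormedSpace.exp_add, NormedSpace.exp_add]

variable [StandardBorelSpace X] [NullSingletonClass m]

/-- The map `F_v ↦ exp(½ ∫ u(g, v) dm) F_{gv}` preserves the Gram kernel. -/
theorem inner_mult_vec (g : CurrentGroup d X) {v w : X → ℂ × (Fin d → ℂ)}
    (hv : v ∈ LobCurrents d X) (hw : w ∈ LobCurrents d X) :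
    ⟪A.mult m g v • A.vec m (actX (g : X → UGroup d) v),
      A.mult m g w • A.vec m (actX (g : X → UGroup d) w)⟫_𝕜 = ⟪A.vec m v, A.vec m w⟫_𝕜 := by
  have i1 := integrable_uFun m g hv
  have i2 := integrable_uFun m g hw
  have i3 := LobCurrents.integrable_cKer m hw hv
  have i4 := LobCurrents.integrable_cKer m (actX_mem g hw) (actX_mem g hv)
  have i0 : Integrable (fun _ : X => expoInt 1) m := integrable_const _
  have h1 : ∫ x, cKer (actX (g : X → UGroup d) w x) (actX (g : X → UGroup d) v x) ∂m =
      (∫ x, cKer (w x) (v x) ∂m) + (∫ x, uFun .plus ((g : X → UGroup d) x) (w x) ∂m) +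
        conj (∫ x, uFun .plus ((g : X → UGroup d) x) (v x) ∂m) := by
    have i1' : Integrable (fun x => conj (uFun .plus ((g : X → UGroup d) x) (v x))) m :=
      (LinearIsometryEquiv.integrable_comp_iff conjLIE).2 i1
    rw [← integral_conj, ← integral_add i3 i2]
    refine Eq.trans ?_ (integral_add (i3.add i2) i1')
    refine integral_congr_ae (Eventually.of_forall fun x => ?_)
    exact cKer_lobAct _ (LobCurrents.mem_lob hw x) (LobCurrents.mem_lob hv x)
  rw [inner_smul_left, inner_smul_right, A.inner_vec m (actX_mem g hv) (actX_mem g hw),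
    A.inner_vec m hv hw, integral_sub i0 (i4.const_mul _), integral_sub i0 (i3.const_mul _),
    integral_const_mul, integral_const_mul, h1]
  have h2 : conj (A.mult m g v) = NormedSpace.exp
      (1 / 2 * A.ρ (conj (∫ x, uFun .plus ((g : X → UGroup d) x) (v x) ∂m))) := by
    unfold mult
    rw [← RCLike.star_def, NormedSpace.star_exp, RCLike.star_def, map_mul, A.conj_ρ]
    simp [map_ofNat]
  have h3 : ∀ z : ℂ, A.ρ (1 / 2 * z) = 1 / 2 * A.ρ z := fun z => by
    have := realLinear_ofReal_mul A.ρ (1 / 2) z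
    push_cast at this
    exact this
  rw [h2, mult, ← mul_assoc, ← NormedSpace.exp_add, ← NormedSpace.exp_add]
  congr 1
  simp only [map_sub, h3, map_add]
  ring

/-- The family `F_{gv}` with nonzero multipliers is total as well, since `v ↦ gv` is a permutation. -/
theorem denseRange_linearCombination_mult (g : CurrentGroup d X) :
    DenseRange (Finsupp.linearCombination 𝕜 fun v : LobCurrents d X =>
      A.mult m g v • A.vec m (actX (g : X → UGroup d) v)) := by
  have h1 := (Submodule.dense_iff_topologicalClosure_eq_top).2 (A.span_vec_closure m)
  rw [DenseRange, ← LinearMap.coe_range, Finsupp.range_linearCombination]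
  refine h1.mono (Submodule.span_le.2 ?_)
  rintro _ ⟨w, hw, rfl⟩
  have hv := actX_mem g⁻¹ hw
  have h2 : actX (g : X → UGroup d) (actX ((g⁻¹ : CurrentGroup d X) : X → UGroup d) w) = w := by
    rw [← actX_mul g g⁻¹ hw, mul_inv_cancel]
    exact actX_one w
  have h3 : A.vec m w = (A.mult m g (actX ((g⁻¹ : CurrentGroup d X) : X → UGroup d) w))⁻¹ •
      (A.mult m g (actX ((g⁻¹ : CurrentGroup d X) : X → UGroup d) w) • A.vec m
        (actX (g : X → UGroup d) (actX ((g⁻¹ : CurrentGroup d X) : X → UGroup d) w))) := by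
    rw [inv_smul_smul₀ (A.mult_ne_zero m g _), h2]
  rw [h3]
  exact Submodule.smul_mem _ _ (Submodule.subset_span ⟨⟨_, hv⟩, rfl⟩)

theorem denseRange_linearCombination :
    DenseRange (Finsupp.linearCombination 𝕜 fun v : LobCurrents d X => A.vec m v) := by
  have h1 := (Submodule.dense_iff_topologicalClosure_eq_top).2 (A.span_vec_closure m)
  rw [DenseRange, ← LinearMap.coe_range, Finsupp.range_linearCombination]
  rwa [Set.image_eq_range] at h1

/-- The operator `F_v ↦ exp(½ ∫ u(g, v) dm) F_{gv}`; it is defined by the equality of the Gram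
matrices of the two total families. -/
def op (g : CurrentGroup d X) : INT 𝕜 A.vac m ≃ₗᵢ[𝕜] INT 𝕜 A.vac m :=
  LinearEquiv.extendOfIsometry (LinearEquiv.refl 𝕜 (LobCurrents d X →₀ 𝕜))
    (Finsupp.linearCombination 𝕜 fun v : LobCurrents d X => A.vec m v)
    (Finsupp.linearCombination 𝕜 fun v : LobCurrents d X =>
      A.mult m g v • A.vec m (actX (g : X → UGroup d) v))
    (A.denseRange_linearCombination m) (A.denseRange_linearCombination_mult m g)
    (norm_linearCombination_eq fun v w => A.inner_mult_vec m g v.2 w.2)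

theorem op_vec (g : CurrentGroup d X) {v : X → ℂ × (Fin d → ℂ)} (hv : v ∈ LobCurrents d X) :
    A.op m g (A.vec m v) = A.mult m g v • A.vec m (actX (g : X → UGroup d) v) := by
  have h2 := LinearEquiv.extendOfIsometry_eq (LinearEquiv.refl 𝕜 (LobCurrents d X →₀ 𝕜))
    (Finsupp.linearCombination 𝕜 fun v : LobCurrents d X => A.vec m v)
    (Finsupp.linearCombination 𝕜 fun v : LobCurrents d X =>
      A.mult m g v • A.vec m (actX (g : X → UGroup d) v))
    (A.denseRange_linearCombination m) (A.denseRange_linearCombination_mult m g)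
    (norm_linearCombination_eq fun v w => A.inner_mult_vec m g v.2 w.2) (Finsupp.single ⟨v, hv⟩ 1)
  rw [LinearEquiv.refl_apply, Finsupp.linearCombination_single, one_smul,
    Finsupp.linearCombination_single, one_smul] at h2
  exact h2

theorem ext_of_vec {U V : INT 𝕜 A.vac m →L[𝕜] INT 𝕜 A.vac m}
    (h : ∀ v ∈ LobCurrents d X, U (A.vec m v) = V (A.vec m v)) : U = V := by
  refine ContinuousLinearMap.ext_on
    ((Submodule.dense_iff_topologicalClosure_eq_top).2 (A.span_vec_closure m)) ?_
  rintro _ ⟨v, hv, rfl⟩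
  exact h v hv

/-- The operators are multiplicative up to the factor `exp(½ ρ(iθ))`. -/
theorem op_mul (g k : CurrentGroup d X) : ∃ θ : ℝ, ∀ Φ, A.op m (g * k) Φ =
    NormedSpace.exp (1 / 2 * A.ρ (θ * I)) • A.op m g (A.op m k Φ) := by
  obtain ⟨θ, hθ⟩ := A.mult_mul m g k
  refine ⟨θ, fun Φ => ?_⟩
  have h1 := A.ext_of_vec m (U := ((A.op m (g * k)).toContinuousLinearEquiv :
      INT 𝕜 A.vac m →L[𝕜] INT 𝕜 A.vac m))
    (V := (NormedSpace.exp (1 / 2 * A.ρ (θ * I))) •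
      (((A.op m g).toContinuousLinearEquiv : INT 𝕜 A.vac m →L[𝕜] INT 𝕜 A.vac m).comp
      ((A.op m k).toContinuousLinearEquiv : INT 𝕜 A.vac m →L[𝕜] INT 𝕜 A.vac m))) fun v hv => by
    change A.op m (g * k) (A.vec m v) =
      NormedSpace.exp (1 / 2 * A.ρ (θ * I)) • A.op m g (A.op m k (A.vec m v))
    rw [A.op_vec m _ hv, A.op_vec m k hv, map_smul, A.op_vec m g (actX_mem k hv), smul_smul,
      smul_smul, hθ v hv, actX_mul g k hv, mul_assoc]
  exact congrArg (fun U => U Φ) h1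

theorem op_ae_eq_intModel {p : X → Parabolic d}
    (hp : (fun x => (p x : UGroup d)) ∈ CurrentGroup d X) (Φ : INT 𝕜 A.vac m) :
    A.op m ⟨fun x => (p x : UGroup d), hp⟩ Φ =ᵐ[lebesgueInf m] intModel A.S m p Φ := by
  refine A.ae_eq_intModel m hp ((A.op m ⟨fun x => (p x : UGroup d), hp⟩).toContinuousLinearEquiv :
    INT 𝕜 A.vac m →L[𝕜] INT 𝕜 A.vac m) (fun v hv => ?_) Φ
  refine (A.op_vec m _ hv).trans ?_
  congr 1
  rw [mult, ← A.exp_half_mul_ofReal, ← integral_complex_ofReal]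
  congr 3
  exact integral_congr_ae (Eventually.of_forall fun x =>
    uFun_parabolic (p x) (LobCurrents.mem_lob hv x))

end ExpSystem

theorem integral_uFun {d : ℕ} (ε : Sgn) {X : Type*} [MeasurableSpace X] (m : Measure X)
    (g : X → UGroup d) (v : X → ℂ × (Fin d → ℂ)) :
    ∫ x, uFun ε (g x) (v x) ∂m = cj ε (∫ x, uFun .plus (g x) (v x) ∂m) := by
  cases ε
  · rfl
  · exact integral_conj (f := fun x => uFun .plus (g x) (v x))

section Operators

variable {d : ℕ} {X : Type*} [MeasurableSpace X] (m : Measure X)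

theorem mult_complexSystem (ε : Sgn) (g : CurrentGroup d X) (v : X → ℂ × (Fin d → ℂ)) :
    (complexSystem ε d).mult m g v =
      Complex.exp (1 / 2 * ∫ x, uFun ε ((g : X → UGroup d) x) (v x) ∂m) := by
  rw [integral_uFun, ← cjL_apply, Complex.exp_eq_exp_ℂ]
  rfl

theorem mult_realSystem (g : CurrentGroup d X) (v : X → ℂ × (Fin d → ℂ)) :
    (realSystem d).mult m g v =
      Real.exp (1 / 2 * (∫ x, uFun .plus ((g : X → UGroup d) x) (v x) ∂m).re) := by
  rw [Real.exp_eq_exp_ℝ]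
  rfl

variable [IsProbabilityMeasure m] [StandardBorelSpace X] [NullSingletonClass m]

theorem exists_op_mul_complexSystem (ε : Sgn) (g k : CurrentGroup d X) : ∃ c : ℂ, ‖c‖ = 1 ∧
    ∀ Φ, (complexSystem ε d).op m (g * k) Φ =
      c • (complexSystem ε d).op m g ((complexSystem ε d).op m k Φ) := by
  obtain ⟨θ, hθ⟩ := (complexSystem ε d).op_mul m g k
  refine ⟨_, ?_, hθ⟩
  change ‖NormedSpace.exp (1 / 2 * cjL ε (θ * I))‖ = 1
  rw [← Complex.exp_eq_exp_ℂ, Complex.norm_exp, Real.exp_eq_one_iff, cjL_apply]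
  cases ε <;> simp [cj]

/-- The operators of the current group in `INT H^0`. The multiplier of the projective
representation is the exponential of an imaginary number, and its real part vanishes. -/
def orthogonalRep : CurrentGroup d X →*
    (INT ℝ (realSystem d).vac m ≃ₗᵢ[ℝ] INT ℝ (realSystem d).vac m) :=
  MonoidHom.mk' ((realSystem d).op m) fun g k => by
    obtain ⟨θ, hθ⟩ := (realSystem d).op_mul m g k
    refine LinearIsometryEquiv.ext fun Φ => (hθ Φ).trans ?_
    have h1 : NormedSpace.exp (1 / 2 * (realSystem d).ρ (θ * I)) = (1 : ℝ) := by
      have h2 : (realSystem d).ρ (θ * I) = 0 := by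
        change ((θ : ℂ) * I).re = 0
        simp
      rw [h2, mul_zero, NormedSpace.exp_zero]
    rw [h1, one_smul]
    rfl

end Operators

end CurrentGroups

end

theorem mainTheorem2 (n : ℕ) (_hn : 1 ≤ n) {X : Type*} [MeasurableSpace X] [StandardBorelSpace X]
    (m : Measure X) [IsProbabilityMeasure m] [NullSingletonClass m] :
    -- the current group acts on `L^X`
    (∀ g : CurrentGroup (n - 1) X, ∀ v ∈ LobCurrents (n - 1) X,
      actX (g : X → UGroup (n - 1)) v ∈ LobCurrents (n - 1) X) ∧
    -- the unitary case, for `INT H^+` and `INT H^-`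
    (∀ ε : Sgn,
      (∀ v ∈ LobCurrents (n - 1) X, MemLp (Fsec ε v) 2 (lebesgueInf m)) ∧
      (Submodule.span ℂ ((fun v => toINT m (Fsec ε v)) ''
        LobCurrents (n - 1) X)).topologicalClosure = ⊤ ∧
      ∃ U : CurrentGroup (n - 1) X →
          (INT ℂ (vac ε (n - 1)) m ≃ₗᵢ[ℂ] INT ℂ (vac ε (n - 1)) m),
        (∀ g : CurrentGroup (n - 1) X, ∀ v ∈ LobCurrents (n - 1) X,
          U g (toINT m (Fsec ε v)) =
            Complex.exp (1 / 2 * ∫ x, uFun ε ((g : X → UGroup (n - 1)) x) (v x) ∂m) •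
              toINT m (Fsec ε (actX (g : X → UGroup (n - 1)) v))) ∧
        (∀ g₁ g₂ : CurrentGroup (n - 1) X, ∃ c : ℂ, ‖c‖ = 1 ∧
          ∀ Φ, U (g₁ * g₂) Φ = c • U g₁ (U g₂ Φ)) ∧
        (∀ (p : X → Parabolic (n - 1))
          (hp : (fun x => (p x : UGroup (n - 1))) ∈ CurrentGroup (n - 1) X)
          (Φ : INT ℂ (vac ε (n - 1)) m),
          U ⟨fun x => (p x : UGroup (n - 1)), hp⟩ Φ =ᵐ[lebesgueInf m]
            intModel (T ε) m p Φ)) ∧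
    -- the orthogonal case, for `INT H^0`
    ((∀ v ∈ LobCurrents (n - 1) X, MemLp (Fsec0 v) 2 (lebesgueInf m)) ∧
      (Submodule.span ℝ ((fun v => toINT m (Fsec0 v)) ''
        LobCurrents (n - 1) X)).topologicalClosure = ⊤ ∧
      ∃ U : CurrentGroup (n - 1) X →*
          (INT ℝ (vac0 (n - 1)) m ≃ₗᵢ[ℝ] INT ℝ (vac0 (n - 1)) m),
        (∀ g : CurrentGroup (n - 1) X, ∀ v ∈ LobCurrents (n - 1) X,
          U g (toINT m (Fsec0 v)) =
            Real.exp (1 / 2 * (∫ x, uFun .plus ((g : X → UGroup (n - 1)) x) (v x) ∂m).re) •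
              toINT m (Fsec0 (actX (g : X → UGroup (n - 1)) v))) ∧
        (∀ (p : X → Parabolic (n - 1))
          (hp : (fun x => (p x : UGroup (n - 1))) ∈ CurrentGroup (n - 1) X)
          (Φ : INT ℝ (vac0 (n - 1)) m),
          U ⟨fun x => (p x : UGroup (n - 1)), hp⟩ Φ =ᵐ[lebesgueInf m]
            intModel T0 m p Φ)) := by
  refine ⟨fun g v hv => actX_mem g hv, fun ε => ?_, ?_⟩
  · let A := complexSystem ε (n - 1)
    refine ⟨fun v hv => A.memLp_F m hv, A.span_vec_closure m, A.op m, fun g v hv => ?_,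
      exists_op_mul_complexSystem m ε, fun p hp Φ => A.op_ae_eq_intModel m hp Φ⟩
    rw [← mult_complexSystem]
    exact A.op_vec m g hv
  · let A := realSystem (n - 1)
    refine ⟨fun v hv => A.memLp_F m hv, A.span_vec_closure m, orthogonalRep m, fun g v hv => ?_,
      fun p hp Φ => A.op_ae_eq_intModel m hp Φ⟩
    rw [← mult_realSystem]
    exact A.op_vec m g hv
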